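/- Let $m\ge 1$, $d\ge 0$, $\tau\in\mathbb C\setminus\{0\}$, $k=(k_0,\dots,k_{m-1})\in\mathbb C^m$, and put $\lambda_i=m(k_{i-1}-k_i)-\tau$; indices $i$ are taken in $I=\mathbb Z/m\mathbb Z$. Let $\Gamma=\{e,s,\dots,s^{m-1}\}$ be the cyclic group of order $m$, acting on $\mathbb C(x)$ by $s(f)(x)=f(\mu^{-1}x)$ with $\mu$ a primitive $m$-th root of unity, and let $\epsilon_i=\frac1m\sum_{r=0}^{m-1}\mu^{-ir}s^r\in\mathbb C\Gamma$. Let $y=\tau\frac{d}{dx}-\frac1x\sum_i mk_i\epsilon_i$ be the Dunkl operator, and let $\mathcal P$ be the ring of formal series $\sum_{j\ge0}f_jy^{N-j}$ ($N\in\mathbb Z$, $f_j\in\mathbb C(x)*\Gamma$), with the multiplication determined by $yf=\theta^{-1}(f)y+D(f)$ for $f\in\mathbb C(x)*\Gamma$, where $\theta(\sum_i a_i(x)s^i)=\sum_i a_i(x)\mu^is^i$, $D(f)=\tau\,\partial f-x^{-1}\big[\sum_i mk_i\epsilon_i,f\big]$ and $\partial(\sum_i a_i(x)s^i)=\sum_i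 a_i'(x)s^i$. Write $S_+$ for the part of $S$ with nonnegative powers of $y$ (entrywise for matrices), and let $E_\beta\in\mathrm{Mat}(d,\mathbb C)$ be the diagonal matrix units. The multicomponent spherical sub-hierarchy is the system $$\frac{\partial L}{\partial t_{mj,\beta}}=\big[(L^{mj}R_\beta)_+,L\big],\qquad \frac{\partial R_\alpha}{\partial t_{mj,\beta}}=\big[(L^{mj}R_\beta)_+,R_\alpha\big]\qquad(j\ge0,\ \alpha,\beta=1,\dots,d)$$ for $L=y+\sum_{l\ge0}f_ly^{-l}$ and $R_\alpha=E_\alpha+\sum_{l\ge1}r_{l\alpha}y^{-l}$ in $\mathrm{Mat}(d,\mathbb C)\otimes\mathcal P$ with $[L,R_\alpha]=0$, $R_\alpha R_\beta=\delta_{\alpha\beta}R_\alpha$, $\sum_\alpha R_\alpha=1$, with zero coefficient at $e\in\Gamma$ in the diagonal entries of $f_0$, and with the symmetry $\epsilon_iL=L\epsilon_{i-1}$, $\epsilon_iR_\alpha=R_\alpha\epsilon_i$ ($i\in I$). Let $n=(n_i)_{i\in I}$ be a vector of nonnegative integers, $V=\bigoplus_{i\in I}V_i$ with $V_i=\mathbb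 C^{n_i}$, and let $e_i$ be the projection of $V$ onto $V_i$. Consider data $X,Y\in\mathrm{End}(V)$, $v_i:\mathbb C^d\to V_i$, $w_i:V_i\to\mathbb C^d$ with $X(V_i)\subset V_{i+1}$ and $Y(V_{i+1})\subset V_i$. For $r\ge 0$ and $\beta\in\{1,\dots,d\}$ the $(r,\beta)$-flow on such data is $$\dot X=-\sum_{l\in I}\sum_{a=0}^{r-1}Y^av_lE_\beta w_{l-r}Y^{r-a-1},\quad \dot Y=0,\quad \dot w_i=E_\beta w_{i-r}Y^r,\quad \dot v_i=-Y^rv_{i+r}E_\beta .$$ Let $\mathcal C^{sph}$ be the set of data with $YX-XY-\sum_iv_iw_i=\sum_i\lambda_ie_i$ and $v_i=w_i=0$ for $i\ne0$ (these represent the points of the spherical Calogero–Moser space). For data in $\mathcal C^{sph}$ put $$M=1-\epsilon_0w_0(X-x)^{-1}(Y-y)^{-1}v_0\epsilon_0,\qquad L=MyM^{-1},\qquad R_\alpha=ME_\alpha M^{-1}.$$ (1) For every point of $\mathcal C^{sph}$ the elements $X-x$ and $Y-y$ of $\mathrm{End}(V)\otimes\mathcal P$ and $M\in\mathrm{Mat}(d,\mathbb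 C)\otimes\mathcal P$ are invertible, and $L$, $R_1,\dots,R_d$ satisfy all of the conditions (form, relations, normalization and symmetry) imposed on the unknowns of the multicomponent spherical sub-hierarchy; in particular $\epsilon_iL=L\epsilon_{i-1}$ and $\epsilon_iR_\alpha=R_\alpha\epsilon_i$. (2) Let $j\ge0$ and $\beta\in\{1,\dots,d\}$. If $(X,Y,v,w)(t)\in\mathcal C^{sph}$ satisfies the $(mj,\beta)$-flow for $t$ in an open set of $\mathbb C$, then on that set $\dot L=[(L^{mj}R_\beta)_+,L]$ and $\dot R_\alpha=[(L^{mj}R_\beta)_+,R_\alpha]$ for all $\alpha$. (3) For every point of $\mathcal C^{sph}$ there is a family $(X,Y,v,w)(t)$ with this value at $t=0$, defined for all values $t=(t_{mj,\beta})_{j\ge0,\,1\le\beta\le d}$ of the times with finitely many nonzero entries, which satisfies all of the $(mj,\beta)$-flows simultaneously. Every such family lies in $\mathcal C^{sph}$ for all $t$, and the corresponding $L(t)$, $R_\alpha(t)$ solve the multicomponent spherical sub-hierarchy. Here the derivative of an element of $\mathrm{Mat}(d,\mathbb C)\otimes\mathcal P$ with respect to a time is taken coefficientwise, the coefficients being rational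 functions of $x$ whose coefficients depend differentiably on the time. -/

import Mathlib

open scoped BigOperators Matrix Topology nonZeroDivisors

noncomputable section

/-! ### Formal pseudo-differential operators over a noncommutative coefficient ring -/

/-- An automorphism `σ` of a ring `R` with an additive map `δ` such that
`δ (f g) = σ f * δ g + δ f * g`, that is, such that the rule `y f = σ f y + δ f` is consistent. -/
structure OreDatum (R : Type*) [Ring R] where
  σ : R ≃+* R
  δ : R →+ R
  leibniz : ∀ f g, δ (f * g) = σ f * δ g + δ f * g

/-- Families `(f n)`, `n ∈ ℤ`, with `f n = 0` for all sufficiently large `n`. -/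
def boundedAboveFamilies (R : Type*) [Ring R] : AddSubgroup (ℤ → R) where
  carrier := {f | ∃ N : ℤ, ∀ n, N < n → f n = 0}
  zero_mem' := ⟨0, fun _ _ => rfl⟩
  add_mem' := by
    rintro f g ⟨N, hN⟩ ⟨K, hK⟩
    refine ⟨max N K, fun n hn => ?_⟩
    have h1 := hN n (lt_of_le_of_lt (le_max_left _ _) hn)
    have h2 := hK n (lt_of_le_of_lt (le_max_right _ _) hn)
    simp [h1, h2]
  neg_mem' := by
    rintro f ⟨N, hN⟩
    exact ⟨N, fun n hn => by simp [hN n hn]⟩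

/-- The formal series `∑ f_n y^n`, with coefficients `f_n ∈ R` on the left and only finitely many
nonzero terms with `n > 0`. -/
def Psd {R : Type*} [Ring R] (_O : OreDatum R) : Type _ := boundedAboveFamilies R

namespace Psd

variable {R : Type*} [Ring R] {O : OreDatum R}

instance : AddCommGroup (Psd O) := inferInstanceAs (AddCommGroup (boundedAboveFamilies R))

/-- The coefficient of `y^n`. -/
def coeff (S : Psd O) (n : ℤ) : R := S.1 n

@[ext] theorem ext {S T : Psd O} (h : ∀ n, S.coeff n = T.coeff n) : S = T :=
  Subtype.ext (funext h)

theorem exists_bound (S : Psd O) : ∃ N : ℤ, ∀ n, N < n → S.coeff n = 0 := S.2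

@[simp] theorem coeff_zero (n : ℤ) : (0 : Psd O).coeff n = 0 := rfl
@[simp] theorem coeff_add (S T : Psd O) (n : ℤ) : (S + T).coeff n = S.coeff n + T.coeff n := rfl
@[simp] theorem coeff_neg (S : Psd O) (n : ℤ) : (-S).coeff n = -S.coeff n := rfl
@[simp] theorem coeff_sub (S T : Psd O) (n : ℤ) : (S - T).coeff n = S.coeff n - T.coeff n := rfl

/-- The series with a single term `f y^i`. -/
def single (i : ℤ) (f : R) : Psd O :=
  ⟨fun n => if n = i then f else 0, i, fun n hn => if_neg (by omega)⟩

theorem coeff_single (i : ℤ) (f : R) (n : ℤ) :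
    (single i f : Psd O).coeff n = if n = i then f else 0 := rfl

/-- Left multiplication by `y`, according to the rule `y f = σ f y + δ f`. -/
def mulY : Psd O →+ Psd O where
  toFun S := ⟨fun n => O.σ (S.coeff (n - 1)) + O.δ (S.coeff n), by
    obtain ⟨N, hN⟩ := S.exists_bound
    refine ⟨N + 1, fun n hn => ?_⟩
    simp [hN (n - 1) (by omega), hN n (by omega)]⟩
  map_zero' := by
    ext n
    change O.σ ((0 : Psd O).coeff (n - 1)) + O.δ ((0 : Psd O).coeff n) = 0
    simp
  map_add' S T := by
    ext n
    change O.σ ((S + T).coeff (n - 1)) + O.δ ((S + T).coeff n) =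
      (O.σ (S.coeff (n - 1)) + O.δ (S.coeff n)) + (O.σ (T.coeff (n - 1)) + O.δ (T.coeff n))
    simp only [coeff_add, map_add]
    abel

theorem coeff_mulY (S : Psd O) (n : ℤ) :
    (mulY S).coeff n = O.σ (S.coeff (n - 1)) + O.δ (S.coeff n) := rfl

/-- The map `f ↦ -θ (δ f)`, where `θ` is the inverse of `σ`. -/
def kap (O : OreDatum R) : R →+ R := -((O.σ.symm : R →+ R).comp O.δ)

theorem kap_apply (f : R) : kap O f = -O.σ.symm (O.δ f) := rfl

theorem kap_iter_zero (p : ℕ) : (kap O)^[p] 0 = 0 := Function.iterate_fixed (map_zero _) p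

theorem kap_iter_add (p : ℕ) (f g : R) :
    (kap O)^[p] (f + g) = (kap O)^[p] f + (kap O)^[p] g := by
  induction p generalizing f g with
  | zero => rfl
  | succ p ih => simp only [Function.iterate_succ_apply, map_add, ih]

/-- The coefficients of `y⁻¹ S`, according to the rule
`y⁻¹ f = ∑_{p ≥ 0} (-1)^p (θ δ)^p (θ f) y^{-1-p}`, where `θ` is the inverse of `σ`. -/
def invYCoeff (S : Psd O) (n : ℤ) : R :=
  ∑ᶠ p : ℕ, (kap O)^[p] (O.σ.symm (S.coeff (n + 1 + p)))

theorem invYCoeff_eq_sum (S : Psd O) (n : ℤ) (K : ℕ)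
    (hK : ∀ p : ℕ, K ≤ p → S.coeff (n + 1 + p) = 0) :
    invYCoeff S n = ∑ p ∈ Finset.range K, (kap O)^[p] (O.σ.symm (S.coeff (n + 1 + p))) := by
  refine finsum_eq_sum_of_support_subset _ fun p hp => ?_
  by_contra h
  simp only [Finset.coe_range, Set.mem_Iio, not_lt] at h
  exact hp (by simp [hK p h])

theorem exists_nat_bound (S : Psd O) (n : ℤ) :
    ∃ K : ℕ, ∀ p : ℕ, K ≤ p → S.coeff (n + p) = 0 := by
  obtain ⟨N, hN⟩ := S.exists_bound
  exact ⟨(N + 1 - n).toNat, fun p hp => hN _ (by omega)⟩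

/-- Left multiplication by `y⁻¹`. -/
def mulInvY : Psd O →+ Psd O where
  toFun S := ⟨invYCoeff S, by
    obtain ⟨N, hN⟩ := S.exists_bound
    refine ⟨N, fun n hn => ?_⟩
    rw [invYCoeff_eq_sum S n 0 fun p _ => hN _ (by omega)]
    simp⟩
  map_zero' := by
    ext n
    change invYCoeff 0 n = 0
    rw [invYCoeff_eq_sum 0 n 0 fun p _ => rfl]
    simp
  map_add' S T := by
    ext n
    change invYCoeff (S + T) n = invYCoeff S n + invYCoeff T n
    obtain ⟨K, hK⟩ := exists_nat_bound S (n + 1)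
    obtain ⟨K', hK'⟩ := exists_nat_bound T (n + 1)
    rw [invYCoeff_eq_sum S n (max K K') fun p hp => hK p (by omega),
      invYCoeff_eq_sum T n (max K K') fun p hp => hK' p (by omega),
      invYCoeff_eq_sum (S + T) n (max K K') fun p hp => by
        rw [coeff_add, hK p (by omega), hK' p (by omega), add_zero], ← Finset.sum_add_distrib]
    simp only [coeff_add, map_add, kap_iter_add]

theorem coeff_mulInvY (S : Psd O) (n : ℤ) : (mulInvY S).coeff n = invYCoeff S n := rfl

theorem mulY_mulInvY (S : Psd O) : mulY (mulInvY S) = S := by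
  ext n
  obtain ⟨K, hK⟩ := exists_nat_bound S n
  rw [coeff_mulY, coeff_mulInvY, coeff_mulInvY,
    invYCoeff_eq_sum S n K fun p hp => by
      have := hK (p + 1) (by omega)
      push_cast at this
      rwa [add_assoc, add_comm (1 : ℤ)],
    invYCoeff_eq_sum S (n - 1) (K + 1) fun p hp => by
      rw [sub_add_cancel]; exact hK p (by omega),
    Finset.sum_range_succ']
  simp only [map_add, map_sum, Function.iterate_succ_apply', kap_apply, map_neg,
    RingEquiv.apply_symm_apply, Finset.sum_neg_distrib]
  have : ∀ p : ℕ, n - 1 + 1 + ((p + 1 : ℕ) : ℤ) = n + 1 + p := fun p => by push_cast; ring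
  simp only [this]
  simp

theorem mulInvY_mulY (S : Psd O) : mulInvY (mulY S) = S := by
  ext n
  obtain ⟨K, hK⟩ := exists_nat_bound S n
  rw [coeff_mulInvY, invYCoeff_eq_sum (mulY S) n K fun p hp => by
      have h1 := hK (p + 1) (by omega)
      have h2 := hK p hp
      push_cast at h1
      rw [coeff_mulY, show n + 1 + (p : ℤ) - 1 = n + p by ring, h2,
        show n + 1 + (p : ℤ) = n + (p + 1) by ring, h1]
      simp]
  have key : ∀ p : ℕ, (kap O)^[p] (O.σ.symm ((mulY S).coeff (n + 1 + p))) =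
      (kap O)^[p] (S.coeff (n + p)) - (kap O)^[p + 1] (S.coeff (n + (p + 1 : ℕ))) := by
    intro p
    rw [coeff_mulY, show n + 1 + (p : ℤ) - 1 = n + p by ring,
      show n + 1 + (p : ℤ) = n + (p + 1 : ℕ) by push_cast; ring, map_add,
      RingEquiv.symm_apply_apply, kap_iter_add, Function.iterate_succ_apply, kap_apply,
      sub_eq_add_neg]
    congr 1
    have h := kap_iter_add (O := O) p (O.σ.symm (O.δ (S.coeff (n + (p + 1 : ℕ)))))
      (-O.σ.symm (O.δ (S.coeff (n + (p + 1 : ℕ)))))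
    rw [add_neg_cancel, kap_iter_zero] at h
    exact eq_neg_of_add_eq_zero_left h.symm
  simp only [key]
  rw [Finset.sum_range_sub' (fun p : ℕ => (kap O)^[p] (S.coeff (n + p)))]
  simp [hK K le_rfl]

/-- Left multiplication by `y` as an invertible additive endomorphism. -/
def yUnit (O : OreDatum R) : (AddMonoid.End (Psd O))ˣ where
  val := mulY
  inv := mulInvY
  val_inv := AddMonoidHom.ext mulY_mulInvY
  inv_val := AddMonoidHom.ext mulInvY_mulY

/-- Left multiplication by `y^i`, `i ∈ ℤ`. -/
def ypow (i : ℤ) : Psd O →+ Psd O := ((yUnit O ^ i : (AddMonoid.End (Psd O))ˣ) :)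

theorem ypow_zero (S : Psd O) : ypow 0 S = S := by simp [ypow]

theorem ypow_add_one (i : ℤ) (S : Psd O) : ypow (i + 1) S = mulY (ypow i S) := by
  simp only [ypow, add_comm i 1, zpow_add, zpow_one, Units.val_mul]
  rfl

theorem ypow_sub_one (i : ℤ) (S : Psd O) : ypow (i - 1) S = mulInvY (ypow i S) := by
  have := ypow_add_one (i - 1) S
  rw [sub_add_cancel] at this
  rw [this, mulInvY_mulY]

theorem coeff_ypow_eq_zero (S : Psd O) {N : ℤ} (hN : ∀ n, N < n → S.coeff n = 0) (i : ℤ) :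
    ∀ n, N + i < n → (ypow i S).coeff n = 0 := by
  induction i using Int.induction_on with
  | zero => intro n hn; rw [ypow_zero]; exact hN n (by omega)
  | succ i ih =>
    intro n hn
    rw [ypow_add_one, coeff_mulY, ih _ (by omega), ih _ (by omega)]
    simp
  | pred i ih =>
    intro n hn
    rw [ypow_sub_one, coeff_mulInvY, invYCoeff_eq_sum _ n 0 fun p _ => ih _ (by omega)]
    simp

/-- The product `(∑ f_i y^i) T = ∑ f_i (y^i T)`. -/
instance : Mul (Psd O) where
  mul S T := ⟨fun n => ∑ᶠ i : ℤ, S.coeff i * (ypow i T).coeff n, by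
    obtain ⟨N, hN⟩ := S.exists_bound
    obtain ⟨K, hK⟩ := T.exists_bound
    refine ⟨K + N, fun n hn => ?_⟩
    refine finsum_eq_zero_of_forall_eq_zero fun i => ?_
    rcases le_or_gt i N with h | h
    · rw [coeff_ypow_eq_zero T hK i n (by omega), mul_zero]
    · rw [hN i h, zero_mul]⟩

theorem coeff_mul (S T : Psd O) (n : ℤ) :
    (S * T).coeff n = ∑ᶠ i : ℤ, S.coeff i * (ypow i T).coeff n := rfl

theorem coeff_mul_eq_sum (S T : Psd O) {N K : ℤ} (hN : ∀ n, N < n → S.coeff n = 0)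
    (hK : ∀ n, K < n → T.coeff n = 0) (n a b : ℤ) (ha : a ≤ n - K) (hb : N ≤ b) :
    (S * T).coeff n = ∑ i ∈ Finset.Icc a b, S.coeff i * (ypow i T).coeff n := by
  refine finsum_eq_sum_of_support_subset _ fun i hi => ?_
  by_contra h
  simp only [Finset.coe_Icc, Set.mem_Icc, not_and_or, not_le] at h
  refine hi ?_
  rcases h with h | h
  · simp [coeff_ypow_eq_zero T hK i n (by omega)]
  · simp [hN i (by omega)]

theorem coeff_mul_bound (S T : Psd O) {N K : ℤ} (hN : ∀ n, N < n → S.coeff n = 0)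
    (hK : ∀ n, K < n → T.coeff n = 0) : ∀ n, K + N < n → (S * T).coeff n = 0 := by
  intro n hn
  rw [coeff_mul_eq_sum S T hN hK n (n - K) N le_rfl le_rfl, Finset.Icc_eq_empty (by omega)]
  simp

theorem mulY_mul (S T : Psd O) : mulY S * T = mulY (S * T) := by
  obtain ⟨N, hN⟩ := S.exists_bound
  obtain ⟨K, hK⟩ := T.exists_bound
  have hY : ∀ n, N + 1 < n → (mulY S).coeff n = 0 := fun n hn => by
    rw [coeff_mulY, hN _ (by omega), hN _ (by omega)]; simp
  ext n
  rw [coeff_mulY, coeff_mul_eq_sum S T hN hK (n - 1) (n - K - 1) N (by omega) le_rfl,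
    coeff_mul_eq_sum S T hN hK n (n - K - 1) (N + 1) (by omega) (by omega),
    coeff_mul_eq_sum _ T hY hK n (n - K - 1 + 1) (N + 1) (by omega) le_rfl]
  simp only [map_sum, map_mul, O.leibniz, coeff_mulY, add_mul, Finset.sum_add_distrib]
  have e1 : ∑ i ∈ Finset.Icc (n - K - 1 + 1) (N + 1), O.σ (S.coeff (i - 1)) * (ypow i T).coeff n =
      ∑ i ∈ Finset.Icc (n - K - 1) N, O.σ (S.coeff i) * (ypow (i + 1) T).coeff n := by
    rw [← Finset.map_add_right_Icc (n - K - 1) N 1, Finset.sum_map]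
    simp
  have e2 : ∑ i ∈ Finset.Icc (n - K - 1) (N + 1), O.σ (S.coeff i) * O.δ ((ypow i T).coeff n) =
      ∑ i ∈ Finset.Icc (n - K - 1) N, O.σ (S.coeff i) * O.δ ((ypow i T).coeff n) := by
    refine (Finset.sum_subset (Finset.Icc_subset_Icc le_rfl (by omega)) fun i hi hi' => ?_).symm
    simp only [Finset.mem_Icc] at hi hi'
    simp [hN i (by omega)]
  have e3 : ∑ i ∈ Finset.Icc (n - K - 1) (N + 1), O.δ (S.coeff i) * (ypow i T).coeff n =
      ∑ i ∈ Finset.Icc (n - K - 1 + 1) (N + 1), O.δ (S.coeff i) * (ypow i T).coeff n := by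
    refine (Finset.sum_subset (Finset.Icc_subset_Icc (by omega) le_rfl) fun i hi hi' => ?_).symm
    simp only [Finset.mem_Icc] at hi hi'
    simp [coeff_ypow_eq_zero T hK i n (by omega)]
  rw [e1, e2, e3, ← add_assoc, ← Finset.sum_add_distrib]
  congr 1
  refine Finset.sum_congr rfl fun i _ => ?_
  rw [ypow_add_one, coeff_mulY, mul_add]

theorem mulInvY_mul (S T : Psd O) : mulInvY S * T = mulInvY (S * T) := by
  rw [← mulInvY_mulY (mulInvY S * T), ← mulY_mul, mulY_mulInvY]

theorem ypow_mul (i : ℤ) (S T : Psd O) : ypow i S * T = ypow i (S * T) := by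
  induction i using Int.induction_on with
  | zero => simp [ypow_zero]
  | succ i ih => rw [ypow_add_one, mulY_mul, ih, ypow_add_one]
  | pred i ih => rw [ypow_sub_one, mulInvY_mul, ih, ypow_sub_one]

protected theorem mul_assoc' (S T U : Psd O) : S * T * U = S * (T * U) := by
  obtain ⟨N, hN⟩ := S.exists_bound
  obtain ⟨K, hK⟩ := T.exists_bound
  obtain ⟨J, hJ⟩ := U.exists_bound
  ext n
  rw [coeff_mul_eq_sum (S * T) U (coeff_mul_bound S T hN hK) hJ n (n - J) (K + N) le_rfl le_rfl,
    coeff_mul_eq_sum S (T * U) hN (coeff_mul_bound T U hK hJ) n (n - (J + K)) N le_rfl le_rfl]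
  have h1 : ∀ i ∈ Finset.Icc (n - J) (K + N), (S * T).coeff i * (ypow i U).coeff n =
      ∑ j ∈ Finset.Icc (n - (J + K)) N,
        S.coeff j * (ypow j T).coeff i * (ypow i U).coeff n := by
    intro i hi
    rw [Finset.mem_Icc] at hi
    rw [coeff_mul_eq_sum S T hN hK i (n - (J + K)) N (by omega) le_rfl, Finset.sum_mul]
  rw [Finset.sum_congr rfl h1, Finset.sum_comm]
  refine Finset.sum_congr rfl fun j hj => ?_
  rw [Finset.mem_Icc] at hj
  rw [← ypow_mul, coeff_mul_eq_sum (ypow j T) U (coeff_ypow_eq_zero T hK j) hJ n (n - J) (K + N)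
    le_rfl (by omega), Finset.mul_sum]
  simp only [mul_assoc]

instance : One (Psd O) := ⟨single 0 1⟩

theorem one_def : (1 : Psd O) = single 0 1 := rfl

theorem delta_one : O.δ 1 = 0 := by
  have := O.leibniz 1 1
  simpa using this

theorem mulY_single_one (i : ℤ) : mulY (single i 1 : Psd O) = single (i + 1) 1 := by
  ext n
  rw [coeff_mulY, coeff_single, coeff_single, coeff_single]
  by_cases h : n = i + 1
  · simp [h]
  · rw [if_neg h, if_neg (by omega)]
    split_ifs <;> simp [delta_one]

theorem ypow_one (i : ℤ) : ypow i (1 : Psd O) = single i 1 := by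
  induction i using Int.induction_on with
  | zero => rw [ypow_zero, one_def]
  | succ i ih => rw [ypow_add_one, ih, mulY_single_one]
  | pred i ih => 
    have h := mulInvY_mulY (single (-(i : ℤ) - 1) 1 : Psd O)
    rw [mulY_single_one, sub_add_cancel] at h
    rw [ypow_sub_one, ih, h]

protected theorem one_mul' (S : Psd O) : 1 * S = S := by
  ext n
  rw [coeff_mul, finsum_eq_single _ 0 fun i hi => by simp [one_def, coeff_single, hi], ypow_zero,
    one_def, coeff_single, if_pos rfl, one_mul]

protected theorem mul_one' (S : Psd O) : S * 1 = S := by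
  ext n
  rw [coeff_mul, finsum_eq_single _ n fun i hi => by simp [ypow_one, coeff_single, hi.symm],
    ypow_one, coeff_single, if_pos rfl, mul_one]

protected theorem left_distrib' (S T U : Psd O) : S * (T + U) = S * T + S * U := by
  obtain ⟨N, hN⟩ := S.exists_bound
  obtain ⟨K, hK⟩ := T.exists_bound
  obtain ⟨J, hJ⟩ := U.exists_bound
  ext n
  rw [coeff_add, coeff_mul_eq_sum S T hN hK n (n - max K J) N (by omega) le_rfl,
    coeff_mul_eq_sum S U hN hJ n (n - max K J) N (by omega) le_rfl,
    coeff_mul_eq_sum S (T + U) hN (K := max K J) (fun n hn => by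
      rw [coeff_add, hK _ (by omega), hJ _ (by omega), add_zero]) n (n - max K J) N le_rfl le_rfl,
    ← Finset.sum_add_distrib]
  simp [mul_add]

protected theorem right_distrib' (S T U : Psd O) : (S + T) * U = S * U + T * U := by
  obtain ⟨N, hN⟩ := S.exists_bound
  obtain ⟨K, hK⟩ := T.exists_bound
  obtain ⟨J, hJ⟩ := U.exists_bound
  ext n
  rw [coeff_add, coeff_mul_eq_sum S U hN hJ n (n - J) (max N K) le_rfl (by omega),
    coeff_mul_eq_sum T U hK hJ n (n - J) (max N K) le_rfl (by omega),
    coeff_mul_eq_sum (S + T) U (N := max N K) (fun n hn => by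
      rw [coeff_add, hN _ (by omega), hK _ (by omega), add_zero]) hJ n (n - J) (max N K)
      le_rfl le_rfl, ← Finset.sum_add_distrib]
  simp [add_mul]

instance : Ring (Psd O) where
  __ := (inferInstance : AddCommGroup (Psd O))
  mul_assoc := Psd.mul_assoc'
  one_mul := Psd.one_mul'
  mul_one := Psd.mul_one'
  left_distrib := Psd.left_distrib'
  right_distrib := Psd.right_distrib'
  zero_mul S := by
    have := Psd.right_distrib' 0 0 S
    rwa [add_zero, left_eq_add] at this
  mul_zero S := by
    have := Psd.left_distrib' S 0 0
    rwa [add_zero, left_eq_add] at this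

/-- The coefficient ring inside the ring of formal series, as the series of degree zero. -/
def const (O : OreDatum R) : R →+* Psd O where
  toFun f := single 0 f
  map_one' := rfl
  map_zero' := by ext n; simp [coeff_single]
  map_add' f g := by ext n; simp only [coeff_single, coeff_add]; split_ifs <;> simp
  map_mul' f g := by
    ext n
    rw [coeff_mul, finsum_eq_single _ 0 fun i hi => by simp [coeff_single, hi], ypow_zero]
    simp only [coeff_single, if_pos]
    split_ifs <;> simp

/-- The element `y`. -/
def y (O : OreDatum R) : Psd O := single 1 1

/-- The part `S₊` of `S` with nonnegative powers of `y`. -/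
def pos (S : Psd O) : Psd O :=
  ⟨fun n => if 0 ≤ n then S.coeff n else 0, by
    obtain ⟨N, hN⟩ := S.exists_bound
    exact ⟨N, fun n hn => by simp [hN n hn]⟩⟩

theorem y_mul (S : Psd O) : y O * S = mulY S := by
  ext n
  rw [coeff_mul, finsum_eq_single _ 1 fun i hi => by simp [y, coeff_single, hi], y, coeff_single,
    if_pos rfl, one_mul]
  have := ypow_add_one 0 S
  rw [zero_add, ypow_zero] at this
  rw [this]

/-- The defining commutation rule. -/
theorem y_mul_const (f : R) :
    y O * const O f = const O (O.σ f) * y O + const O (O.δ f) := by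
  have h : const O (O.σ f) * y O = single 1 (O.σ f) := by
    ext n
    rw [coeff_mul, finsum_eq_single _ 0 fun i hi => by simp [const, coeff_single, hi], ypow_zero]
    simp only [const, y, RingHom.coe_mk, MonoidHom.coe_mk, OneHom.coe_mk, coeff_single]
    split_ifs <;> simp
  rw [y_mul, h]
  ext n
  simp only [coeff_mulY, const, RingHom.coe_mk, MonoidHom.coe_mk, OneHom.coe_mk, coeff_single,
    coeff_add]
  by_cases h1 : n = 1
  · simp [h1]
  · by_cases h0 : n = 0
    · simp [h0]
    · rw [if_neg (by omega), if_neg h0, if_neg h1, if_neg h0]; simp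

end Psd

/-! ### Rational functions and the cyclic group -/

/-- The substitution `f(x) ↦ f(c x)`. -/
def ratScale (c : ℂˣ) : RatFunc ℂ →+* RatFunc ℂ :=
  RatFunc.mapRingHom (Polynomial.compRingHom (Polynomial.C (c : ℂ) * Polynomial.X)) (by
    intro p hp
    rw [Submonoid.mem_comap, mem_nonZeroDivisors_iff_ne_zero]
    rw [mem_nonZeroDivisors_iff_ne_zero] at hp
    intro h
    rw [Polynomial.coe_compRingHom_apply] at h
    have h' := congrArg (fun r => r.comp (Polynomial.C ((c⁻¹ : ℂˣ) : ℂ) * Polynomial.X)) h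
    simp only [Polynomial.comp_assoc, Polynomial.mul_comp, Polynomial.C_comp, Polynomial.X_comp,
      Polynomial.zero_comp, ← mul_assoc, ← Polynomial.C_mul, Units.mul_inv, map_one, one_mul,
      Polynomial.comp_X] at h'
    exact hp h')

theorem ratScale_div (c : ℂˣ) (p q : Polynomial ℂ) :
    ratScale c (algebraMap _ _ p / algebraMap _ _ q) =
      algebraMap _ _ (p.comp (Polynomial.C (c : ℂ) * Polynomial.X)) /
        algebraMap _ _ (q.comp (Polynomial.C (c : ℂ) * Polynomial.X)) := by
  unfold ratScale
  rw [RatFunc.coe_mapRingHom_eq_coe_map, RatFunc.map_apply_div]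
  rfl

theorem ratScale_one (f : RatFunc ℂ) : ratScale 1 f = f := by
  rw [← RatFunc.num_div_denom f, ratScale_div]
  simp

theorem ratScale_mul (b c : ℂˣ) (f : RatFunc ℂ) :
    ratScale (b * c) f = ratScale b (ratScale c f) := by
  rw [← RatFunc.num_div_denom f, ratScale_div, ratScale_div, ratScale_div]
  simp only [Polynomial.comp_assoc, Polynomial.mul_comp, Polynomial.C_comp, Polynomial.X_comp,
    ← mul_assoc, ← Polynomial.C_mul, Units.val_mul]
  rw [mul_comm (b : ℂ)]

theorem ratScale_X (c : ℂˣ) : ratScale c RatFunc.X = RatFunc.C (c : ℂ) * RatFunc.X := by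
  have := ratScale_div c Polynomial.X 1
  simpa using this

/-- The derivative `df/dx` of a rational function. -/
def ratDerivFun (f : RatFunc ℂ) : RatFunc ℂ :=
  algebraMap _ _ (Polynomial.derivative f.num * f.denom - f.num * Polynomial.derivative f.denom) /
    algebraMap _ _ (f.denom ^ 2)

theorem quot_rule_aux {A K : Type*} [CommRing A] [Field K] (φ : A →+* K) (p q r s p' q' r' s' : A)
    (hq : φ q ≠ 0) (hs : φ s ≠ 0) (h : p * s = r * q)
    (h' : p' * s + p * s' = r' * q + r * q') :
    φ (p' * q - p * q') / φ (q ^ 2) = φ (r' * s - r * s') / φ (s ^ 2) := by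
  rw [map_pow, map_pow, div_eq_div_iff (pow_ne_zero 2 hq) (pow_ne_zero 2 hs), ← map_pow,
    ← map_pow, ← map_mul, ← map_mul]
  congr 1
  linear_combination (q * s) * h' - (q * s' + q' * s) * h

theorem quot_rule_add {A K : Type*} [CommRing A] [Field K] (φ : A →+* K) (p q r s p' q' r' s' : A)
    (hq : φ q ≠ 0) (hs : φ s ≠ 0) :
    φ ((p' * s + p * s' + (q' * r + q * r')) * (q * s) - (p * s + q * r) * (q' * s + q * s')) /
      φ ((q * s) ^ 2) = φ (p' * q - p * q') / φ (q ^ 2) + φ (r' * s - r * s') / φ (s ^ 2) := by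
  simp only [map_sub, map_add, map_mul, map_pow]
  field_simp
  ring

theorem quot_rule_mul {A K : Type*} [CommRing A] [Field K] (φ : A →+* K) (p q r s p' q' r' s' : A)
    (hq : φ q ≠ 0) (hs : φ s ≠ 0) :
    φ ((p' * r + p * r') * (q * s) - (p * r) * (q' * s + q * s')) / φ ((q * s) ^ 2) =
      φ p / φ q * (φ (r' * s - r * s') / φ (s ^ 2)) +
        φ (p' * q - p * q') / φ (q ^ 2) * (φ r / φ s) := by
  simp only [map_sub, map_add, map_mul, map_pow]
  field_simp
  ring

theorem ratMap_ne_zero {q : Polynomial ℂ} (hq : q ≠ 0) :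
    algebraMap (Polynomial ℂ) (RatFunc ℂ) q ≠ 0 := RatFunc.algebraMap_ne_zero hq

theorem ratDerivFun_div (p q : Polynomial ℂ) (hq : q ≠ 0) :
    ratDerivFun (algebraMap _ _ p / algebraMap _ _ q) =
      algebraMap _ _ (Polynomial.derivative p * q - p * Polynomial.derivative q) /
        algebraMap _ _ (q ^ 2) := by
  generalize hf : (algebraMap _ _ p / algebraMap _ _ q : RatFunc ℂ) = f
  have h1 : f.num * q = p * f.denom := by
    have h := RatFunc.num_div_denom f
    rw [← hf, div_eq_div_iff (ratMap_ne_zero (RatFunc.denom_ne_zero _)) (ratMap_ne_zero hq),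
      ← map_mul, ← map_mul, hf] at h
    exact RatFunc.algebraMap_injective ℂ h
  have h2 := congrArg Polynomial.derivative h1
  rw [Polynomial.derivative_mul, Polynomial.derivative_mul] at h2
  exact quot_rule_aux _ _ _ _ _ _ _ _ _ (ratMap_ne_zero (RatFunc.denom_ne_zero f))
    (ratMap_ne_zero hq) h1 h2

theorem ratDerivFun_add (f g : RatFunc ℂ) :
    ratDerivFun (f + g) = ratDerivFun f + ratDerivFun g := by
  have hf := RatFunc.denom_ne_zero f
  have hg := RatFunc.denom_ne_zero g
  have e : f + g = algebraMap _ _ (f.num * g.denom + f.denom * g.num) /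
      algebraMap _ _ (f.denom * g.denom) := by
    conv_lhs => rw [← RatFunc.num_div_denom f, ← RatFunc.num_div_denom g,
      div_add_div _ _ (ratMap_ne_zero hf) (ratMap_ne_zero hg), ← map_mul, ← map_mul, ← map_mul,
      ← map_add]
  rw [e, ratDerivFun_div _ _ (mul_ne_zero hf hg), Polynomial.derivative_add,
    Polynomial.derivative_mul, Polynomial.derivative_mul, Polynomial.derivative_mul]
  exact quot_rule_add _ _ _ _ _ _ _ _ _ (ratMap_ne_zero hf) (ratMap_ne_zero hg)

/-- The derivation `d/dx` of `ℂ(x)`. -/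
def ratDeriv : RatFunc ℂ →+ RatFunc ℂ := AddMonoidHom.mk' ratDerivFun ratDerivFun_add

theorem ratDeriv_apply (f : RatFunc ℂ) : ratDeriv f = ratDerivFun f := rfl

theorem ratDeriv_div (p q : Polynomial ℂ) (hq : q ≠ 0) :
    ratDeriv (algebraMap _ _ p / algebraMap _ _ q) =
      algebraMap _ _ (Polynomial.derivative p * q - p * Polynomial.derivative q) /
        algebraMap _ _ (q ^ 2) := ratDerivFun_div p q hq

theorem ratDeriv_mul (f g : RatFunc ℂ) :
    ratDeriv (f * g) = f * ratDeriv g + ratDeriv f * g := by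
  have hf := RatFunc.denom_ne_zero f
  have hg := RatFunc.denom_ne_zero g
  have e : f * g = algebraMap _ _ (f.num * g.num) / algebraMap _ _ (f.denom * g.denom) := by
    conv_lhs => rw [← RatFunc.num_div_denom f, ← RatFunc.num_div_denom g, div_mul_div_comm,
      ← map_mul, ← map_mul]
  rw [e, ratDeriv_div _ _ (mul_ne_zero hf hg), Polynomial.derivative_mul,
    Polynomial.derivative_mul]
  refine (quot_rule_mul _ _ _ _ _ _ _ _ _ (ratMap_ne_zero hf) (ratMap_ne_zero hg)).trans ?_
  rw [RatFunc.num_div_denom, RatFunc.num_div_denom]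
  rfl

theorem ratDeriv_scale (c : ℂˣ) (f : RatFunc ℂ) :
    ratDeriv (ratScale c f) = RatFunc.C (c : ℂ) * ratScale c (ratDeriv f) := by
  have hf := RatFunc.denom_ne_zero f
  have hf' : f.denom.comp (Polynomial.C (c : ℂ) * Polynomial.X) ≠ 0 := fun h => by
    have h' := congrArg (fun r => r.comp (Polynomial.C ((c⁻¹ : ℂˣ) : ℂ) * Polynomial.X)) h
    simp only [Polynomial.comp_assoc, Polynomial.mul_comp, Polynomial.C_comp, Polynomial.X_comp,
      Polynomial.zero_comp, ← mul_assoc, ← Polynomial.C_mul, Units.mul_inv, map_one, one_mul,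
      Polynomial.comp_X] at h'
    exact hf h'
  rw [← RatFunc.num_div_denom f, ratScale_div, ratDeriv_div _ _ hf, ratDeriv_div _ _ hf',
    ratScale_div, ← RatFunc.algebraMap_C, ← mul_div_assoc, ← map_mul]
  congr 2
  · simp only [Polynomial.derivative_comp, Polynomial.sub_comp, Polynomial.mul_comp,
      Polynomial.derivative_mul, Polynomial.derivative_C, Polynomial.derivative_X]
    ring
  · simp

/-- The cyclic group `Γ` of order `m`, identified with the group of `m`-th roots of unity in `ℂ`.
If `s` is the generator acting on `ℂ` by a primitive root `μ`, then `s` is the element `μ`. -/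
def CycGroup (m : ℕ) : Type := rootsOfUnity m ℂ

namespace CycGroup

variable {m : ℕ}

instance : CommGroup (CycGroup m) := inferInstanceAs (CommGroup (rootsOfUnity m ℂ))

instance [NeZero m] : Fintype (CycGroup m) := Fintype.ofFinite (rootsOfUnity m ℂ)

/-- The root of unity by which an element of `Γ` acts on `ℂ`. -/
def toUnit (m : ℕ) : CycGroup m →* ℂˣ := (rootsOfUnity m ℂ).subtype

/-- The action `(γ f)(x) = f(γ⁻¹ x)` of `Γ` on rational functions. -/
instance : MulSemiringAction (CycGroup m) (RatFunc ℂ) where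
  smul γ f := ratScale (toUnit m γ)⁻¹ f
  one_smul f := by
    change ratScale (toUnit m 1)⁻¹ f = f
    rw [map_one, inv_one, ratScale_one]
  mul_smul γ γ' f := by
    change ratScale (toUnit m (γ * γ'))⁻¹ f =
      ratScale (toUnit m γ)⁻¹ (ratScale (toUnit m γ')⁻¹ f)
    rw [map_mul, mul_inv, ratScale_mul]
  smul_zero γ := map_zero (ratScale (toUnit m γ)⁻¹)
  smul_add γ := map_add (ratScale (toUnit m γ)⁻¹)
  smul_one γ := map_one (ratScale (toUnit m γ)⁻¹)
  smul_mul γ := map_mul (ratScale (toUnit m γ)⁻¹)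

theorem smul_def (γ : CycGroup m) (f : RatFunc ℂ) : γ • f = ratScale (toUnit m γ)⁻¹ f := rfl

end CycGroup

open CycGroup

/-- The crossed product `ℂ(x) * Γ`. -/
abbrev CrossedRat (m : ℕ) : Type := SkewMonoidAlgebra (RatFunc ℂ) (CycGroup m)

namespace CrossedRat

variable (m : ℕ)

/-- The inclusion `ℂ(x) ⊂ ℂ(x) * Γ`. -/
def ofRat : RatFunc ℂ →+* CrossedRat m := SkewMonoidAlgebra.singleOneRingHom

theorem ofRat_apply (f : RatFunc ℂ) : ofRat m f = SkewMonoidAlgebra.single 1 f := rfl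

/-- For a character `ψ` of `Γ`, the automorphism `a γ ↦ ψ(γ) a γ`. -/
def twist (ψ : CycGroup m →* ℂˣ) : CrossedRat m →+* CrossedRat m :=
  SkewMonoidAlgebra.liftNCRingHom (ofRat m)
    { toFun := fun γ => SkewMonoidAlgebra.single γ (RatFunc.C (ψ γ : ℂ))
      map_one' := by simp
      map_mul' := fun γ γ' => by
        rw [SkewMonoidAlgebra.single_mul_single, smul_def]
        have h := ratScale_div (toUnit m γ)⁻¹ (Polynomial.C (ψ γ' : ℂ)) 1
        simp only [RatFunc.algebraMap_C, map_one, div_one, Polynomial.C_comp,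
          Polynomial.one_comp] at h
        rw [h, ← map_mul, map_mul, Units.val_mul] }
    (by
      intro f γ
      simp only [ofRat_apply, MonoidHom.coe_mk, OneHom.coe_mk,
        SkewMonoidAlgebra.single_mul_single, one_mul, mul_one, one_smul]
      rw [mul_comm])

theorem twist_single (ψ : CycGroup m →* ℂˣ) (γ : CycGroup m) (f : RatFunc ℂ) :
    twist m ψ (SkewMonoidAlgebra.single γ f) =
      SkewMonoidAlgebra.single γ (f * RatFunc.C (ψ γ : ℂ)) := by
  change SkewMonoidAlgebra.liftNC _ _ (SkewMonoidAlgebra.single γ f) = _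
  rw [SkewMonoidAlgebra.liftNC_single]
  change ofRat m f * SkewMonoidAlgebra.single γ (RatFunc.C (ψ γ : ℂ)) = _
  rw [ofRat_apply, SkewMonoidAlgebra.single_mul_single, one_mul, one_smul]

theorem twist_twist (ψ φ : CycGroup m →* ℂˣ) (h : ψ * φ = 1) (f : CrossedRat m) :
    twist m ψ (twist m φ f) = f := by
  have : ((twist m ψ).comp (twist m φ) : CrossedRat m →+ CrossedRat m) =
      AddMonoidHom.id (CrossedRat m) := by
    refine SkewMonoidAlgebra.addHom_ext fun γ a => ?_
    have h' : (φ γ : ℂ) * (ψ γ : ℂ) = 1 := by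
      have := congrArg Units.val (DFunLike.congr_fun h γ)
      rw [mul_comm]
      simpa using this
    change twist m ψ (twist m φ (SkewMonoidAlgebra.single γ a)) = SkewMonoidAlgebra.single γ a
    rw [twist_single, twist_single, mul_assoc, ← map_mul, h', map_one, mul_one]
  exact DFunLike.congr_fun this f

/-- The automorphism `θ⁻¹`, where `θ(∑ a_i(x) s^i) = ∑ a_i(x) μ^i s^i`. -/
def thetaInv : CrossedRat m ≃+* CrossedRat m :=
  RingEquiv.ofRingHom (twist m (toUnit m)⁻¹) (twist m (toUnit m))
    (RingHom.ext fun f => twist_twist m _ _ (inv_mul_cancel (toUnit m)) f)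
    (RingHom.ext fun f => twist_twist m _ _ (mul_inv_cancel (toUnit m)) f)

theorem thetaInv_single (γ : CycGroup m) (f : RatFunc ℂ) :
    thetaInv m (SkewMonoidAlgebra.single γ f) =
      SkewMonoidAlgebra.single γ (f * RatFunc.C (((toUnit m γ)⁻¹ : ℂˣ) : ℂ)) :=
  twist_single m _ γ f

/-- The coefficientwise derivative `∑ a_i(x) s^i ↦ ∑ a_i'(x) s^i`. -/
def deriv : CrossedRat m →+ CrossedRat m :=
  SkewMonoidAlgebra.liftNC (((ofRat m : RatFunc ℂ →+* CrossedRat m) :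
    RatFunc ℂ →+ CrossedRat m).comp ratDeriv) (SkewMonoidAlgebra.of (RatFunc ℂ) (CycGroup m))

theorem deriv_single (γ : CycGroup m) (f : RatFunc ℂ) :
    deriv m (SkewMonoidAlgebra.single γ f) = SkewMonoidAlgebra.single γ (ratDeriv f) := by
  rw [deriv, SkewMonoidAlgebra.liftNC_single]
  change ofRat m (ratDeriv f) * SkewMonoidAlgebra.of (RatFunc ℂ) (CycGroup m) γ = _
  rw [ofRat_apply, SkewMonoidAlgebra.of_apply, SkewMonoidAlgebra.single_mul_single]
  simp

theorem ext_mul (F G : CrossedRat m → CrossedRat m → CrossedRat m)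
    (hF1 : ∀ f f' g, F (f + f') g = F f g + F f' g) (hF2 : ∀ f g g', F f (g + g') = F f g + F f g')
    (hG1 : ∀ f f' g, G (f + f') g = G f g + G f' g) (hG2 : ∀ f g g', G f (g + g') = G f g + G f g')
    (h : ∀ γ a γ' a', F (SkewMonoidAlgebra.single γ a) (SkewMonoidAlgebra.single γ' a') =
      G (SkewMonoidAlgebra.single γ a) (SkewMonoidAlgebra.single γ' a')) (f g : CrossedRat m) :
    F f g = G f g := by
  have h1 : ∀ γ a, AddMonoidHom.mk' _ (hF2 (SkewMonoidAlgebra.single γ a)) =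
      AddMonoidHom.mk' _ (hG2 (SkewMonoidAlgebra.single γ a)) := fun γ a =>
    SkewMonoidAlgebra.addHom_ext fun γ' a' => h γ a γ' a'
  have h2 : AddMonoidHom.mk' (fun f => F f g) (fun f f' => hF1 f f' g) =
      AddMonoidHom.mk' (fun f => G f g) (fun f f' => hG1 f f' g) :=
    SkewMonoidAlgebra.addHom_ext fun γ a => DFunLike.congr_fun (h1 γ a) g
  exact DFunLike.congr_fun h2 f

theorem deriv_mul (f g : CrossedRat m) :
    deriv m (f * g) = thetaInv m f * deriv m g + deriv m f * g := by
  refine ext_mul m (fun f g => deriv m (f * g))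
    (fun f g => thetaInv m f * deriv m g + deriv m f * g) ?_ ?_ ?_ ?_ ?_ f g
  · intro f f' g; simp only [add_mul, map_add]
  · intro f f' g; simp only [mul_add, map_add]
  · intro f f' g; simp only [add_mul, map_add]; abel
  · intro f f' g; simp only [mul_add, map_add]; abel
  · intro γ a γ' a'
    simp only [SkewMonoidAlgebra.single_mul_single, deriv_single, thetaInv_single]
    rw [← SkewMonoidAlgebra.single_add, ratDeriv_mul, smul_def, smul_def, ratDeriv_scale, mul_assoc]

theorem ofRat_inv_X_mul (f : CrossedRat m) :
    ofRat m RatFunc.X⁻¹ * f = thetaInv m f * ofRat m RatFunc.X⁻¹ := by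
  have : (AddMonoidHom.mulLeft (ofRat m RatFunc.X⁻¹) : CrossedRat m →+ CrossedRat m) =
      (AddMonoidHom.mulRight (ofRat m RatFunc.X⁻¹)).comp
        (thetaInv m : CrossedRat m →+ CrossedRat m) := by
    refine SkewMonoidAlgebra.addHom_ext fun γ a => ?_
    change ofRat m RatFunc.X⁻¹ * SkewMonoidAlgebra.single γ a =
      thetaInv m (SkewMonoidAlgebra.single γ a) * ofRat m RatFunc.X⁻¹
    rw [thetaInv_single, ofRat_apply, SkewMonoidAlgebra.single_mul_single,
      SkewMonoidAlgebra.single_mul_single, one_mul, mul_one, one_smul, smul_def, map_inv₀,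
      ratScale_X, mul_inv]
    have hc : RatFunc.C (((toUnit m γ)⁻¹ : ℂˣ) : ℂ) ≠ 0 := by
      rw [Ne, map_eq_zero]
      exact Units.ne_zero _
    rw [mul_assoc, mul_inv_cancel_left₀ hc, mul_comm]
  exact DFunLike.congr_fun this f

theorem ratScale_C (c : ℂˣ) (a : ℂ) : ratScale c (RatFunc.C a) = RatFunc.C a := by
  have h := ratScale_div c (Polynomial.C a) 1
  simpa only [RatFunc.algebraMap_C, map_one, div_one, Polynomial.C_comp,
    Polynomial.one_comp] using h

theorem ofRat_C_mul (τ : ℂ) (f : CrossedRat m) :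
    thetaInv m f * ofRat m (RatFunc.C τ) = ofRat m (RatFunc.C τ) * thetaInv m f := by
  have : (AddMonoidHom.mulRight (ofRat m (RatFunc.C τ)) : CrossedRat m →+ CrossedRat m) =
      AddMonoidHom.mulLeft (ofRat m (RatFunc.C τ)) := by
    refine SkewMonoidAlgebra.addHom_ext fun γ a => ?_
    change SkewMonoidAlgebra.single γ a * ofRat m (RatFunc.C τ) =
      ofRat m (RatFunc.C τ) * SkewMonoidAlgebra.single γ a
    rw [ofRat_apply, SkewMonoidAlgebra.single_mul_single, SkewMonoidAlgebra.single_mul_single,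
      smul_def, ratScale_C, one_mul, mul_one, one_smul, mul_comm]
  exact DFunLike.congr_fun this (thetaInv m f)

variable [NeZero m]

/-- The idempotent `ε_i = (1/m) ∑_r μ^{-ir} s^r` of `ℂΓ`. -/
def idem (i : ZMod m) : CrossedRat m :=
  ∑ γ : CycGroup m, SkewMonoidAlgebra.single γ
    (RatFunc.C ((m : ℂ)⁻¹ * (((toUnit m γ)⁻¹ ^ i.val : ℂˣ) : ℂ)))

/-- The element `∑ m k_i ε_i` of `ℂΓ`. -/
def dunklElt (k : ZMod m → ℂ) : CrossedRat m :=
  ∑ i : ZMod m, ofRat m (RatFunc.C ((m : ℂ) * k i)) * idem m i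

variable (τ : ℂ) (k : ZMod m → ℂ)

/-- The map `D(f) = τ ∂(f) - x⁻¹ [∑ m k_i ε_i, f]`. Writing `∑ m k_i ε_i = ∑ c_γ γ`, this is
`τ ∂(f) - ∑_{γ ≠ e} c_γ x⁻¹ (γ f - f γ)`, because the term with `γ = e` is zero. -/
def dunklD : CrossedRat m →+ CrossedRat m :=
  AddMonoidHom.mk' (fun f => ofRat m (RatFunc.C τ) * deriv m f -
    ofRat m RatFunc.X⁻¹ * (dunklElt m k * f - f * dunklElt m k)) (by
      intro f g
      simp only [map_add, mul_add, add_mul, mul_sub]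
      abel)

theorem dunklD_apply (f : CrossedRat m) :
    dunklD m τ k f = ofRat m (RatFunc.C τ) * deriv m f -
      ofRat m RatFunc.X⁻¹ * (dunklElt m k * f - f * dunklElt m k) := rfl

theorem dunklD_leibniz (f g : CrossedRat m) :
    dunklD m τ k (f * g) = thetaInv m f * dunklD m τ k g + dunklD m τ k f * g := by
  have h1 := ofRat_inv_X_mul m f
  have h2 := ofRat_C_mul m τ f
  simp only [dunklD_apply, deriv_mul, mul_add, mul_sub, sub_mul]
  rw [← mul_assoc (thetaInv m f), ← mul_assoc (thetaInv m f) (ofRat m RatFunc.X⁻¹),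
    ← mul_assoc (thetaInv m f) (ofRat m RatFunc.X⁻¹), ← h1, h2]
  simp only [mul_assoc]
  abel

/-- The data of the rule `y f = θ⁻¹(f) y + D(f)`. -/
def dunklDatum : OreDatum (CrossedRat m) where
  σ := thetaInv m
  δ := dunklD m τ k
  leibniz := dunklD_leibniz m τ k

end CrossedRat

open CrossedRat

/-- The ring `𝒫` of formal series `∑_{j ≥ 0} f_j y^{N-j}`, `f_j ∈ ℂ(x) * Γ`, where `y` is the Dunkl
operator `τ d/dx - x⁻¹ ∑ m k_i ε_i`. -/
abbrev DunklPsd (m : ℕ) [NeZero m] (τ : ℂ) (k : ZMod m → ℂ) : Type := Psd (dunklDatum m τ k)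

namespace DunklPsd

variable (m : ℕ) [NeZero m] (τ : ℂ) (k : ZMod m → ℂ)

/-- The inclusion `ℂ(x) * Γ ⊂ 𝒫`. -/
def ofCrossed : CrossedRat m →+* DunklPsd m τ k := Psd.const (dunklDatum m τ k)

/-- The inclusion `ℂ ⊂ 𝒫`. -/
def ofComplex : ℂ →+* DunklPsd m τ k :=
  (ofCrossed m τ k).comp ((ofRat m).comp (RatFunc.C : ℂ →+* RatFunc ℂ))

/-- The coordinate `x ∈ 𝒫`. -/
def x : DunklPsd m τ k := ofCrossed m τ k (ofRat m RatFunc.X)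

/-- The Dunkl operator `y ∈ 𝒫`. -/
def y : DunklPsd m τ k := Psd.y (dunklDatum m τ k)

/-- The idempotent `ε_i ∈ 𝒫`. -/
def eps (i : ZMod m) : DunklPsd m τ k := ofCrossed m τ k (idem m i)

/-- `Mat(d, ℂ) ⊗ 𝒫`. -/
abbrev Mat (d : ℕ) : Type := Matrix (Fin d) (Fin d) (DunklPsd m τ k)

variable {m τ k} {d : ℕ}

/-- The positive part of a matrix over `𝒫`, entry by entry. -/
def matPos (A : Mat m τ k d) : Mat m τ k d := A.map Psd.pos

end DunklPsd

/-! ### Dependence on a complex parameter -/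

/-- The family `A` of complex matrices is differentiable at `t`, with derivative `A'`. -/
def HasMatDerivAt {ι κ : Type*} (A : ℂ → Matrix ι κ ℂ) (A' : Matrix ι κ ℂ) (t : ℂ) : Prop :=
  ∀ a b, HasDerivAt (fun s => A s a b) (A' a b) t

/-- The family `f` of rational functions of `x` is differentiable at `t`, with derivative `f'`: near
`t` it is a quotient `p / q` of polynomials in `x` of bounded degree, whose coefficients are
differentiable at `t` as functions of the parameter, with `q ≠ 0` at `t`, and `f'` is given by the
quotient rule. -/
def HasRatDerivAt (f : ℂ → RatFunc ℂ) (f' : RatFunc ℂ) (t : ℂ) : Prop :=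
  ∃ (N : ℕ) (p q : ℂ → Polynomial ℂ) (p' q' : Polynomial ℂ),
    (∀ s, (p s).natDegree ≤ N ∧ (q s).natDegree ≤ N) ∧
    (∀ n, HasDerivAt (fun s => (p s).coeff n) (p'.coeff n) t) ∧
    (∀ n, HasDerivAt (fun s => (q s).coeff n) (q'.coeff n) t) ∧
    q t ≠ 0 ∧
    (∀ᶠ s in 𝓝 t, f s = algebraMap _ (RatFunc ℂ) (p s) / algebraMap _ (RatFunc ℂ) (q s)) ∧
    f' = algebraMap _ (RatFunc ℂ) (p' * q t - p t * q') / algebraMap _ (RatFunc ℂ) (q t ^ 2)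

/-- The family `A` of matrices over `𝒫` is differentiable at `t`, with derivative `A'`: every
coefficient `f_{n,γ} ∈ ℂ(x)` of every entry `∑ f_{n,γ} γ y^n` is. -/
def HasPsdDerivAt {m : ℕ} [NeZero m] {τ : ℂ} {k : ZMod m → ℂ} {d : ℕ}
    (A : ℂ → DunklPsd.Mat m τ k d) (A' : DunklPsd.Mat m τ k d) (t : ℂ) : Prop :=
  ∀ a b n γ, HasRatDerivAt (fun s => ((A s a b).coeff n).coeff γ) (((A' a b).coeff n).coeff γ) t

/-! ### Representations of the framed cyclic quiver -/

/-- The index set of the standard basis of `V = ⨁_i V_i`, `V_i = ℂ^{α_i}`. -/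
abbrev VIdx {m : ℕ} (α : ZMod m → ℕ) : Type := Σ i : ZMod m, Fin (α i)

/-- The projection `e_i` of `V` onto `V_i`. -/
def vproj {m : ℕ} (α : ZMod m → ℕ) (i : ZMod m) : Matrix (VIdx α) (VIdx α) ℂ :=
  Matrix.diagonal fun a => if a.1 = i then 1 else 0

/-- A representation, of dimension `(1, α)`, of the opposite of the double of the cyclic quiver with
`d` arrows from each vertex to the framing vertex: maps `X_i : V_i → V_{i+1}`,
`Y_i : V_{i+1} → V_i`, `v_i : ℂ^d → V_i`, `w_i : V_i → ℂ^d`, given by their sums `X`, `Y`, `v`, `w`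
over `i`. -/
structure FramedRep (m : ℕ) [NeZero m] (α : ZMod m → ℕ) (d : ℕ) where
  X : Matrix (VIdx α) (VIdx α) ℂ
  Y : Matrix (VIdx α) (VIdx α) ℂ
  v : Matrix (VIdx α) (Fin d) ℂ
  w : Matrix (Fin d) (VIdx α) ℂ
  X_graded : ∀ i, vproj α (i + 1) * X = X * vproj α i
  Y_graded : ∀ i, vproj α i * Y = Y * vproj α (i + 1)

/-- The diagonal matrix unit `E_β`. -/
def diagUnit {d : ℕ} (β : Fin d) : Matrix (Fin d) (Fin d) ℂ := Matrix.single β β 1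

namespace FramedRep

variable {m : ℕ} [NeZero m] {α : ZMod m → ℕ} {d : ℕ}

/-- The map `v_i`, with values in `V`. -/
def vAt (q : FramedRep m α d) (i : ZMod m) : Matrix (VIdx α) (Fin d) ℂ := vproj α i * q.v

/-- The map `w_i`, extended by zero to `V`. -/
def wAt (q : FramedRep m α d) (i : ZMod m) : Matrix (Fin d) (VIdx α) ℂ := q.w * vproj α i

/-- The set of representatives of points of the spherical Calogero-Moser space: the
relations of the deformed preprojective algebra with parameter `lam` hold, and only the vertex `0`
is framed. -/
def sphericalCM (lam : ZMod m → ℂ) : Set (FramedRep m α d) :=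
  {q | q.Y * q.X - q.X * q.Y - ∑ i, q.vAt i * q.wAt i = ∑ i, lam i • vproj α i ∧
    ∀ i, i ≠ 0 → q.vAt i = 0 ∧ q.wAt i = 0}

/-- The curve `q` of representations satisfies at `t` the equations of the flow with the Hamiltonian
`-∑_i tr (E_β w_i Y^r v_{i+r})`. -/
def FlowAt (r : ℕ) (β : Fin d) (q : ℂ → FramedRep m α d) (t : ℂ) : Prop :=
  HasMatDerivAt (fun s => (q s).X)
    (-∑ l : ZMod m, ∑ a ∈ Finset.range r, (q t).Y ^ a * (q t).vAt l * diagUnit β *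
      (q t).wAt (l - r) * (q t).Y ^ (r - a - 1)) t ∧
  HasMatDerivAt (fun s => (q s).Y) 0 t ∧
  (∀ i, HasMatDerivAt (fun s => (q s).wAt i)
    (diagUnit β * (q t).wAt (i - r) * (q t).Y ^ r) t) ∧
  ∀ j, HasMatDerivAt (fun s => (q s).vAt j)
    (-((q t).Y ^ r * (q t).vAt (j + r) * diagUnit β)) t

end FramedRep

/-! ### The dressing operator and the hierarchy -/

section Dressing

variable {m : ℕ} [NeZero m] (τ : ℂ) (k : ZMod m → ℂ) {α : ZMod m → ℕ} {d : ℕ}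

/-- The parameters `λ_i = m (k_{i-1} - k_i) - τ`, so that `x y - y x = ∑ λ_i ε_i`. -/
def dunklLambda (i : ZMod m) : ℂ := m * (k (i - 1) - k i) - τ

open DunklPsd in
/-- The matrix `X - x` over `𝒫`. -/
def hatX (q : FramedRep m α d) : Matrix (VIdx α) (VIdx α) (DunklPsd m τ k) :=
  q.X.map (ofComplex m τ k) - Matrix.scalar (VIdx α) (x m τ k)

open DunklPsd in
/-- The matrix `Y - y` over `𝒫`. -/
def hatY (q : FramedRep m α d) : Matrix (VIdx α) (VIdx α) (DunklPsd m τ k) :=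
  q.Y.map (ofComplex m τ k) - Matrix.scalar (VIdx α) (y m τ k)

open DunklPsd in
/-- `M = 1 - ε_0 w_0 (X - x)⁻¹ (Y - y)⁻¹ v_0 ε_0`. -/
def dressM (q : FramedRep m α d) : Mat m τ k d :=
  1 - Matrix.scalar (Fin d) (eps m τ k 0) * (q.wAt 0).map (ofComplex m τ k) *
    Ring.inverse (hatX τ k q) * Ring.inverse (hatY τ k q) * (q.vAt 0).map (ofComplex m τ k) *
    Matrix.scalar (Fin d) (eps m τ k 0)

open DunklPsd in
/-- `L = M y M⁻¹`. -/
def laxL (q : FramedRep m α d) : Mat m τ k d :=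
  dressM τ k q * Matrix.scalar (Fin d) (y m τ k) * Ring.inverse (dressM τ k q)

open DunklPsd in
/-- `R_β = M E_β M⁻¹`. -/
def laxR (q : FramedRep m α d) (β : Fin d) : Mat m τ k d :=
  dressM τ k q * Matrix.single β β 1 * Ring.inverse (dressM τ k q)

variable {τ k}

open DunklPsd in
/-- `L` and `R_1, …, R_d` form an admissible tuple of unknowns of the multicomponent spherical
sub-hierarchy. -/
structure IsSphericalLaxTuple (L : Mat m τ k d) (R : Fin d → Mat m τ k d) : Prop where
  /-- `L = y + ∑_{l ≥ 0} f_l y^{-l}` -/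
  L_form : ∀ a b, (L a b).coeff 1 = (if a = b then 1 else 0) ∧ ∀ n, 1 < n → (L a b).coeff n = 0
  /-- `R_β = E_β + ∑_{l ≥ 1} r_{lβ} y^{-l}` -/
  R_form : ∀ β a b, (R β a b).coeff 0 = (if a = β ∧ b = β then 1 else 0) ∧
    ∀ n, 0 < n → (R β a b).coeff n = 0
  comm : ∀ β, L * R β = R β * L
  orth : ∀ β β', R β * R β' = if β = β' then R β else 0
  sum_eq : ∑ β, R β = 1
  /-- The coefficient at `e ∈ Γ` of each diagonal entry of `f_0` is zero. -/
  normalized : ∀ a, ((L a a).coeff 0).coeff 1 = 0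
  L_symm : ∀ i, Matrix.scalar (Fin d) (eps m τ k i) * L =
    L * Matrix.scalar (Fin d) (eps m τ k (i - 1))
  R_symm : ∀ β i, Matrix.scalar (Fin d) (eps m τ k i) * R β =
    R β * Matrix.scalar (Fin d) (eps m τ k i)

open DunklPsd in
/-- The equations `∂L/∂t = [(L^r R_β)₊, L]` and `∂R_γ/∂t = [(L^r R_β)₊, R_γ]` at the value `t` of a
parameter. -/
def LaxEqAt (r : ℕ) (β : Fin d) (L : ℂ → Mat m τ k d) (R : ℂ → Fin d → Mat m τ k d) (t : ℂ) :
    Prop :=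
  HasPsdDerivAt L (matPos (L t ^ r * R t β) * L t - L t * matPos (L t ^ r * R t β)) t ∧
  ∀ γ, HasPsdDerivAt (fun s => R s γ)
    (matPos (L t ^ r * R t β) * R t γ - R t γ * matPos (L t ^ r * R t β)) t

/-- The values of the times `t_{mj,β}`, `j ≥ 0`, `β = 1, …, d`, all but finitely many of them
zero; the value at `(j, β)` is `t_{mj,β}`. -/
abbrev SphericalTimes (d : ℕ) : Type := (ℕ × Fin d) →₀ ℂ

/-- `q` satisfies, in all times, the flows with the numbers `m j`, `j ≥ 0`. -/
def SolvesFlows (q : SphericalTimes d → FramedRep m α d) : Prop :=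
  ∀ t j β, FramedRep.FlowAt (m * j) β (fun s => q (t + Finsupp.single (j, β) s)) 0

open DunklPsd in
/-- `L` and `R` are a solution of the multicomponent spherical sub-hierarchy
`∂L/∂t_{mj,β} = [(L^{mj} R_β)₊, L]`, `∂R_γ/∂t_{mj,β} = [(L^{mj} R_β)₊, R_γ]`. -/
def SolvesSphericalHierarchy (L : SphericalTimes d → Mat m τ k d)
    (R : SphericalTimes d → Fin d → Mat m τ k d) : Prop :=
  (∀ t, IsSphericalLaxTuple (L t) (R t)) ∧
  ∀ t j β, LaxEqAt (m * j) β (fun s => L (t + Finsupp.single (j, β) s))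
    (fun s => R (t + Finsupp.single (j, β) s)) 0

end Dressing

end

/-!
For `q ∈ 𝒞^sph` write `X̂ = X - x`, `Ŷ = Y - y`, `v = v_0 ε_0`, `w = ε_0 w_0`, so that
`M = 1 - w X̂⁻¹ Ŷ⁻¹ v`. The relations `[x, y] = ∑ λ_i ε_i` in `𝒫` and
`[Y, X] = v_0 w_0 + ∑ λ_i e_i` in `End V` have the same parameters. On the image of the idempotent
`∑ e_i ε_i` the terms with `λ` cancel, and there `[Ŷ, X̂] = v w` (`hat_commutator_mul`). Both `X̂`
and `Ŷ` shift the idempotents `∑ e_i ε_{i+c}` by one step, in opposite directions, so the columns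
of `X̂⁻¹ Ŷ⁻¹ v` and `Ŷ⁻¹ X̂⁻¹ v` lie in this image, and the commutator identity gives
`M⁻¹ = 1 + w Ŷ⁻¹ X̂⁻¹ v` (`dress_mul_inv`, `inv_mul_dress`). Since `Ŷ⁻¹` has degree `-1` in `y`,
the form of `L` and `R_β` is read off from these formulas (`isSphericalLaxTuple`). For the
normalization one uses that the coefficients of `y⁻¹` in `w X̂⁻¹ Ŷ⁻¹ v` and `w Ŷ⁻¹ X̂⁻¹ v` agree,
and that `θ` fixes the component at `e ∈ Γ`.

Let `r = m j`. Along the `(r, β)`-flow, `∂M = D M - M E_β y^r` with an explicit `D` that contains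
no inverse of `Ŷ` (`dress_flow`, an identity for rectangular matrices over a ring): every
occurrence of `Y^r X̂⁻¹ Ŷ⁻¹ v` is rewritten by means of the quotient `(Y^r - y^r) / (Y - y)` and
of `Ŷ X̂⁻¹ Ŷ⁻¹ v = X̂⁻¹ v M`. Hence `L^r R_β = M E_β y^r M⁻¹ = D - ∂M M⁻¹`, where `D` has no
negative and `∂M M⁻¹` only negative powers of `y`. Therefore `(L^r R_β)₊ = D = L^r R_β + ∂M M⁻¹`,
and, as `L` and `R_γ` commute with `L^r R_β` and are conjugates by `M` of constants, their
derivatives `[∂M M⁻¹, ·]` are the commutators with `(L^r R_β)₊` (`laxEqAt_of_flowAt`). The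
calculus needed for derivatives of `M` in the sense of `HasPsdDerivAt` is that of `HasBddDerivAt`.

The flows are integrated explicitly (`exists_solvesFlows`): `Y` is constant, `v` and `w` evolve by
exponentials of `∑_j t_{mj,β} Y^{mj}`, and the integral that gives `X` comes from the nilpotent
component of the same exponential for a square-zero extension of `Y`. Conversely, along any
solution of a flow `Y` is constant, so the components of `v` and `w` away from the vertex `0`
satisfy linear equations with constant coefficients and stay zero, after which the moment map is
seen to be conserved (`mem_sphericalCM_of_flowAt`). Any value of the times is reached from `0` by
finitely many such steps.
-/

noncomputable section

open CycGroup CrossedRat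

/-! ### Idempotents of the cyclic group -/

namespace CrossedRat

variable {m : ℕ}

theorem toUnit_pow (γ : CycGroup m) : toUnit m γ ^ m = 1 := γ.2

theorem thetaInv_ofRat (f : RatFunc ℂ) : thetaInv m (ofRat m f) = ofRat m f := by
  rw [ofRat_apply, thetaInv_single]
  simp

theorem ofRat_C_comm (a : ℂ) (f : CrossedRat m) :
    ofRat m (RatFunc.C a) * f = f * ofRat m (RatFunc.C a) := by
  have := ofRat_C_mul m a ((thetaInv m).symm f)
  rw [RingEquiv.apply_symm_apply] at this
  exact this.symm

theorem coeff_twist (ψ : CycGroup m →* ℂˣ) (f : CrossedRat m) (γ : CycGroup m) :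
    (twist m ψ f).coeff γ = f.coeff γ * RatFunc.C (ψ γ : ℂ) := by
  induction f using SkewMonoidAlgebra.induction_on' with
  | single η a =>
    rw [twist_single, SkewMonoidAlgebra.coeff_single, SkewMonoidAlgebra.coeff_single]
    by_cases h : γ = η
    · subst h
      simp
    · rw [Finsupp.single_eq_of_ne h, Finsupp.single_eq_of_ne h, zero_mul]
  | add f g hf hg => simp only [map_add, SkewMonoidAlgebra.coeff_add, Finsupp.add_apply, hf, hg,
      add_mul]

theorem coeff_deriv (f : CrossedRat m) (γ : CycGroup m) :
    (deriv m f).coeff γ = ratDeriv (f.coeff γ) := by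
  induction f using SkewMonoidAlgebra.induction_on' with
  | single η a =>
    rw [deriv_single, SkewMonoidAlgebra.coeff_single, SkewMonoidAlgebra.coeff_single]
    by_cases h : γ = η
    · subst h
      simp
    · rw [Finsupp.single_eq_of_ne h, Finsupp.single_eq_of_ne h, map_zero]
  | add f g hf hg => simp only [map_add, SkewMonoidAlgebra.coeff_add, Finsupp.add_apply, hf, hg]

/-- The `i`-th character `s^r ↦ μ^{-ir}` of `Γ`. -/
def cycChar (i : ZMod m) (γ : CycGroup m) : ℂ := (((toUnit m γ)⁻¹ ^ i.val : ℂˣ) : ℂ)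

theorem idem_eq [NeZero m] (i : ZMod m) : idem m i = ∑ γ : CycGroup m,
    SkewMonoidAlgebra.single γ (RatFunc.C ((m : ℂ)⁻¹ * cycChar i γ)) := rfl

theorem cycChar_zero (γ : CycGroup m) : cycChar 0 γ = 1 := by simp [cycChar]

theorem cycChar_apply_one (i : ZMod m) : cycChar i (1 : CycGroup m) = 1 := by simp [cycChar]

theorem inv_toUnit_pow_mod (γ : CycGroup m) (n : ℕ) :
    (toUnit m γ)⁻¹ ^ (n % m) = (toUnit m γ)⁻¹ ^ n := by
  conv_rhs => rw [← Nat.mod_add_div n m, pow_add, pow_mul, inv_pow _ m, toUnit_pow, inv_one,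
    one_pow, mul_one]

theorem cycChar_add [NeZero m] (i j : ZMod m) (γ : CycGroup m) :
    cycChar (i + j) γ = cycChar i γ * cycChar j γ := by
  rw [cycChar, ZMod.val_add, inv_toUnit_pow_mod, pow_add, Units.val_mul]
  rfl

theorem cycChar_mul (i : ZMod m) (γ γ' : CycGroup m) :
    cycChar i (γ * γ') = cycChar i γ * cycChar i γ' := by
  simp only [cycChar, map_mul, mul_inv, mul_pow, Units.val_mul]

theorem cycChar_one [NeZero m] (γ : CycGroup m) : cycChar 1 γ = (((toUnit m γ)⁻¹ : ℂˣ) : ℂ) := by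
  rw [cycChar, ZMod.val_one_eq_one_mod, inv_toUnit_pow_mod, pow_one]

theorem sum_single {ι : Type*} (s : Finset ι) (γ : CycGroup m) (f : ι → RatFunc ℂ) :
    ∑ i ∈ s, (SkewMonoidAlgebra.single γ (f i) : CrossedRat m) =
      SkewMonoidAlgebra.single γ (∑ i ∈ s, f i) :=
  (map_sum (SkewMonoidAlgebra.singleAddHom γ) f s).symm

theorem single_C_mul_single_C (γ γ' : CycGroup m) (a b : ℂ) :
    (SkewMonoidAlgebra.single γ (RatFunc.C a) * SkewMonoidAlgebra.single γ' (RatFunc.C b) :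
      CrossedRat m) = SkewMonoidAlgebra.single (γ * γ') (RatFunc.C (a * b)) := by
  rw [SkewMonoidAlgebra.single_mul_single, smul_def, ratScale_C, map_mul]

variable [NeZero m]

theorem coeff_crossed_mul (f g : CrossedRat m) (γ : CycGroup m) :
    (f * g).coeff γ =
      ∑ η : CycGroup m, f.coeff η * ratScale (toUnit m η)⁻¹ (g.coeff (η⁻¹ * γ)) := by
  rw [SkewMonoidAlgebra.coeff_mul_left, SkewMonoidAlgebra.sum_def, Finsupp.sum_fintype]
  · rfl
  · intro η
    rw [zero_mul]

theorem sum_cycChar_eq_zero {γ : CycGroup m} (hγ : γ ≠ 1) : ∑ i : ZMod m, cycChar i γ = 0 := by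
  have h : ∑ i : ZMod m, cycChar (1 + i) γ = ∑ i : ZMod m, cycChar i γ :=
    Equiv.sum_comp (Equiv.addLeft (1 : ZMod m)) fun i => cycChar i γ
  simp only [cycChar_add, ← Finset.mul_sum] at h
  by_contra hS
  have h1 := mul_right_cancel₀ hS (h.trans (one_mul _).symm)
  rw [cycChar_one, Units.val_eq_one, inv_eq_one] at h1
  exact hγ (Subtype.ext h1)

/-- Orthogonality of the characters of `Γ`; the character `i ≠ 0` is not trivial at a
primitive root of unity. -/
theorem sum_cycChar_group {i : ZMod m} (hi : i ≠ 0) : ∑ γ : CycGroup m, cycChar i γ = 0 := by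
  have hm : m ≠ 0 := NeZero.ne m
  have hζ := Complex.isPrimitiveRoot_exp m hm
  obtain ⟨ζ, hζ'⟩ := hζ.isUnit hm
  rw [← hζ', IsPrimitiveRoot.coe_units_iff] at hζ
  let γ₀ : CycGroup m := ⟨ζ, hζ.pow_eq_one⟩
  have h : ∑ γ : CycGroup m, cycChar i (γ₀ * γ) = ∑ γ : CycGroup m, cycChar i γ :=
    Equiv.sum_comp (Equiv.mulLeft γ₀) fun γ => cycChar i γ
  simp only [cycChar_mul, ← Finset.mul_sum] at h
  by_contra hS
  have h1 := mul_right_cancel₀ hS (h.trans (one_mul _).symm)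
  rw [cycChar, Units.val_eq_one, inv_pow, inv_eq_one] at h1
  have h2 := (hζ.pow_eq_one_iff_dvd _).1 h1
  exact hi ((ZMod.val_eq_zero i).1 (Nat.eq_zero_of_dvd_of_lt h2 (ZMod.val_lt i)))

theorem card_cycGroup : Fintype.card (CycGroup m) = m := by
  rw [← Nat.card_eq_fintype_card]
  exact Complex.card_rootsOfUnity m

theorem cast_m_ne_zero : (m : ℂ) ≠ 0 := Nat.cast_ne_zero.2 (NeZero.ne m)

theorem idem_mul_idem (i j : ZMod m) : idem m i * idem m j = if i = j then idem m i else 0 := by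
  have h : idem m i * idem m j = ∑ η : CycGroup m, SkewMonoidAlgebra.single η (RatFunc.C
      ((m : ℂ)⁻¹ * cycChar j η * ((m : ℂ)⁻¹ * ∑ γ : CycGroup m, cycChar (i - j) γ))) := by
    simp only [idem_eq, Finset.sum_mul_sum, single_C_mul_single_C]
    have h1 : ∀ γ : CycGroup m, ∑ γ' : CycGroup m, (SkewMonoidAlgebra.single (γ * γ')
        (RatFunc.C ((m : ℂ)⁻¹ * cycChar i γ * ((m : ℂ)⁻¹ * cycChar j γ'))) : CrossedRat m) =
        ∑ η : CycGroup m, SkewMonoidAlgebra.single η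
          (RatFunc.C ((m : ℂ)⁻¹ * cycChar j η * ((m : ℂ)⁻¹ * cycChar (i - j) γ))) := by
      intro γ
      rw [← Equiv.sum_comp (Equiv.mulLeft γ) fun η => (SkewMonoidAlgebra.single η
        (RatFunc.C ((m : ℂ)⁻¹ * cycChar j η * ((m : ℂ)⁻¹ * cycChar (i - j) γ))) : CrossedRat m)]
      refine Finset.sum_congr rfl fun γ' _ => ?_
      have h2 : cycChar i γ = cycChar (i - j) γ * cycChar j γ := by
        rw [← cycChar_add, sub_add_cancel]
      rw [Equiv.coe_mulLeft, cycChar_mul, h2]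
      congr 2
      ring
    rw [Finset.sum_congr rfl fun γ _ => h1 γ, Finset.sum_comm]
    refine Finset.sum_congr rfl fun η _ => ?_
    rw [sum_single, Finset.mul_sum, Finset.mul_sum, map_sum]
  rw [h]
  split_ifs with hij
  · subst hij
    simp only [sub_self, cycChar_zero, Finset.sum_const, Finset.card_univ, card_cycGroup,
      nsmul_eq_mul, mul_one, inv_mul_cancel₀ cast_m_ne_zero]
    rfl
  · simp [sum_cycChar_group (sub_ne_zero.2 hij)]

theorem sum_idem : ∑ i : ZMod m, idem m i = 1 := by
  simp only [idem_eq]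
  rw [Finset.sum_comm, Finset.sum_eq_single 1]
  · rw [sum_single, ← map_sum, ← Finset.mul_sum]
    simp [cycChar_apply_one, ZMod.card]
  · intro γ _ hγ
    rw [sum_single, ← map_sum, ← Finset.mul_sum, sum_cycChar_eq_zero hγ]
    simp
  · simp

theorem idem_mul_X (i : ZMod m) :
    idem m i * ofRat m RatFunc.X = ofRat m RatFunc.X * idem m (i + 1) := by
  simp only [idem_eq, Finset.sum_mul, Finset.mul_sum]
  refine Finset.sum_congr rfl fun γ _ => ?_
  rw [ofRat_apply, SkewMonoidAlgebra.single_mul_single, SkewMonoidAlgebra.single_mul_single,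
    smul_def, ratScale_X, one_smul, mul_one, one_mul, cycChar_add, cycChar_one, ← mul_assoc,
    ← map_mul, mul_comm RatFunc.X, mul_assoc]

theorem thetaInv_idem (i : ZMod m) : thetaInv m (idem m i) = idem m (i + 1) := by
  simp only [idem_eq, map_sum, thetaInv_single]
  refine Finset.sum_congr rfl fun γ _ => ?_
  rw [cycChar_add, cycChar_one, ← map_mul, mul_assoc]

theorem ratDeriv_C (a : ℂ) : ratDeriv (RatFunc.C a) = 0 := by
  have := ratDeriv_div (Polynomial.C a) 1 one_ne_zero
  simpa using this

theorem ratDeriv_X : ratDeriv RatFunc.X = 1 := by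
  have := ratDeriv_div Polynomial.X 1 one_ne_zero
  simpa using this

variable (τ : ℂ) (k : ZMod m → ℂ)

theorem dunklElt_comm_idem (i : ZMod m) : dunklElt m k * idem m i = idem m i * dunklElt m k := by
  simp only [dunklElt, Finset.sum_mul, Finset.mul_sum]
  refine Finset.sum_congr rfl fun j _ => ?_
  rw [mul_assoc, idem_mul_idem, ← mul_assoc, ← ofRat_C_comm, mul_assoc, idem_mul_idem]
  by_cases h : j = i
  · subst h; rfl
  · rw [if_neg h, if_neg (Ne.symm h)]

theorem dunklD_idem (i : ZMod m) : dunklD m τ k (idem m i) = 0 := by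
  rw [dunklD_apply, dunklElt_comm_idem, sub_self, mul_zero, sub_zero]
  have : deriv m (idem m i) = 0 := by
    simp only [idem_eq, map_sum, deriv_single, ratDeriv_C]
    simp
  rw [this, mul_zero]

theorem dunklD_ofRat_C (a : ℂ) : dunklD m τ k (ofRat m (RatFunc.C a)) = 0 := by
  rw [dunklD_apply, ofRat_C_comm a, sub_self, ofRat_apply, ofRat_apply, deriv_single, ratDeriv_C]
  simp

/-- The relation `[x, y] = ∑ λ_i ε_i`, in the form of the value `D(x)`. -/
theorem dunklD_X : dunklD m τ k (ofRat m RatFunc.X) =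
    -∑ i : ZMod m, ofRat m (RatFunc.C (dunklLambda τ k i)) * idem m i := by
  have hX : ofRat m RatFunc.X⁻¹ * ofRat m RatFunc.X = 1 := by
    rw [← map_mul, inv_mul_cancel₀ RatFunc.X_ne_zero, map_one]
  have h1 : deriv m (ofRat m RatFunc.X) = 1 := by
    rw [ofRat_apply, deriv_single, ratDeriv_X]; rfl
  have h2 : dunklElt m k * ofRat m RatFunc.X = ofRat m RatFunc.X *
      ∑ i : ZMod m, ofRat m (RatFunc.C ((m : ℂ) * k (i - 1))) * idem m i := by
    simp only [dunklElt, Finset.sum_mul, Finset.mul_sum]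
    rw [← Equiv.sum_comp (Equiv.addRight (1 : ZMod m)) (fun i => ofRat m RatFunc.X *
      (ofRat m (RatFunc.C ((m : ℂ) * k (i - 1))) * idem m i))]
    refine Finset.sum_congr rfl fun i _ => ?_
    rw [mul_assoc, idem_mul_X, ← mul_assoc, ofRat_C_comm, mul_assoc]
    simp
  have h3 : ofRat m (RatFunc.C τ) = ∑ i : ZMod m, ofRat m (RatFunc.C τ) * idem m i := by
    rw [← Finset.mul_sum, sum_idem, mul_one]
  rw [dunklD_apply, h1, h2, mul_one, mul_sub, ← mul_assoc, ← mul_assoc, hX,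
    one_mul, one_mul, h3, dunklElt, ← Finset.sum_sub_distrib, ← Finset.sum_sub_distrib,
    ← Finset.sum_neg_distrib]
  refine Finset.sum_congr rfl fun i _ => ?_
  rw [← sub_mul, ← sub_mul, ← neg_mul (ofRat m _), ← map_sub, ← map_sub, ← map_sub, ← map_sub,
    ← map_neg, ← map_neg, dunklLambda]
  congr 3
  ring

end CrossedRat

/-! ### Powers of `y` in the ring of formal series -/

namespace Psd

variable {R : Type*} [Ring R] {O : OreDatum R}

theorem coeff_const (f : R) (n : ℤ) : (const O f).coeff n = if n = 0 then f else 0 := rfl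

theorem coeff_const_mul (f : R) (S : Psd O) (n : ℤ) :
    (const O f * S).coeff n = f * S.coeff n := by
  rw [coeff_mul, finsum_eq_single _ 0 fun i hi => by simp [coeff_const, hi], ypow_zero,
    coeff_const, if_pos rfl]

theorem ypow_add (i j : ℤ) (S : Psd O) : ypow (i + j) S = ypow i (ypow j S) := by
  simp only [ypow, zpow_add, Units.val_mul]
  rfl

theorem coeff_mul_single_one (S : Psd O) (i n : ℤ) :
    (S * single i 1).coeff n = S.coeff (n - i) := by
  rw [coeff_mul, finsum_eq_single _ (n - i) fun j hj => by
    rw [← ypow_one i, ← ypow_add, ypow_one, coeff_single, if_neg (by omega), mul_zero],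
    ← ypow_one i, ← ypow_add, ypow_one, coeff_single, if_pos (by omega), mul_one]

theorem coeff_mul_y (S : Psd O) (n : ℤ) : (S * y O).coeff n = S.coeff (n - 1) :=
  coeff_mul_single_one S 1 n

theorem coeff_sum {ι : Type*} (s : Finset ι) (f : ι → Psd O) (n : ℤ) :
    (∑ i ∈ s, f i).coeff n = ∑ i ∈ s, (f i).coeff n :=
  map_sum (AddMonoidHom.mk' (fun S : Psd O => S.coeff n) fun S T => coeff_add S T n) f s

/-- The series with only nonnegative powers of `y`. -/
def nonneg (O : OreDatum R) : Subring (Psd O) where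
  carrier := {S | ∀ n, n < 0 → S.coeff n = 0}
  zero_mem' _ _ := rfl
  one_mem' n hn := by rw [one_def, coeff_single, if_neg (by omega)]
  add_mem' {S T} hS hT n hn := by rw [coeff_add, hS n hn, hT n hn, add_zero]
  neg_mem' {S} hS n hn := by rw [coeff_neg, hS n hn, neg_zero]
  mul_mem' {S T} hS hT n hn := by
    have h : ∀ i : ℕ, ∀ n, n < 0 → (ypow (i : ℤ) T).coeff n = 0 := by
      intro i
      induction i with
      | zero => intro n hn; rw [Nat.cast_zero, ypow_zero]; exact hT n hn
      | succ i ih =>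
        intro n hn
        rw [Nat.cast_succ, ypow_add_one, coeff_mulY, ih n hn, ih (n - 1) (by omega)]
        simp
    rw [coeff_mul]
    refine finsum_eq_zero_of_forall_eq_zero fun i => ?_
    rcases lt_or_ge i 0 with hi | hi
    · rw [hS i hi, zero_mul]
    · lift i to ℕ using hi
      rw [h i n hn, mul_zero]

theorem const_mem_nonneg (f : R) : const O f ∈ nonneg O :=
  fun n hn => by rw [coeff_const, if_neg (by omega)]

theorem y_mem_nonneg : y O ∈ nonneg O :=
  fun n hn => by rw [y, coeff_single, if_neg (by omega)]

theorem pos_of_nonneg {S : Psd O} (hS : S ∈ nonneg O) : pos S = S := by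
  ext n
  change (if 0 ≤ n then S.coeff n else 0) = S.coeff n
  split_ifs with h
  · rfl
  · exact (hS n (by omega)).symm

theorem pos_sub (S T : Psd O) : pos (S - T) = pos S - pos T := by
  ext n
  change (if 0 ≤ n then (S - T).coeff n else 0) =
    (if 0 ≤ n then S.coeff n else 0) - (if 0 ≤ n then T.coeff n else 0)
  split_ifs <;> simp

/-- The matrices over the ring of formal series whose entries contain no power of `y` above
`y^N`. -/
def DegLE {ι κ : Type*} (N : ℤ) (A : Matrix ι κ (Psd O)) : Prop :=
  ∀ a b n, N < n → (A a b).coeff n = 0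

/-- The matrices whose entries contain no negative powers of `y`. -/
def MatNonneg {ι κ : Type*} (A : Matrix ι κ (Psd O)) : Prop := ∀ a b, A a b ∈ nonneg O

section Matrices

variable {ι κ η : Type*} {N K : ℤ}

theorem DegLE.mono {A : Matrix ι κ (Psd O)} (h : DegLE N A) (hNK : N ≤ K) : DegLE K A :=
  fun a b n hn => h a b n (by omega)

theorem DegLE.add {A B : Matrix ι κ (Psd O)} (hA : DegLE N A) (hB : DegLE N B) :
    DegLE N (A + B) := fun a b n hn => by
  rw [Matrix.add_apply, coeff_add, hA a b n hn, hB a b n hn, add_zero]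

theorem DegLE.neg {A : Matrix ι κ (Psd O)} (hA : DegLE N A) : DegLE N (-A) := fun a b n hn => by
  rw [Matrix.neg_apply, coeff_neg, hA a b n hn, neg_zero]

theorem DegLE.sub {A B : Matrix ι κ (Psd O)} (hA : DegLE N A) (hB : DegLE N B) :
    DegLE N (A - B) := fun a b n hn => by
  rw [Matrix.sub_apply, coeff_sub, hA a b n hn, hB a b n hn, sub_zero]

theorem DegLE.mul [Fintype κ] {A : Matrix ι κ (Psd O)} {B : Matrix κ η (Psd O)}
    (hA : DegLE N A) (hB : DegLE K B) : DegLE (N + K) (A * B) := fun a b n hn => by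
  rw [Matrix.mul_apply, coeff_sum]
  exact Finset.sum_eq_zero fun c _ =>
    coeff_mul_bound _ _ (hA a c) (hB c b) n (by omega)

theorem degLE_scalar [DecidableEq ι] [Fintype ι] {S : Psd O} (hS : ∀ n, N < n → S.coeff n = 0) :
    DegLE N (Matrix.scalar ι S) := fun a b n hn => by
  rw [Matrix.scalar_apply, Matrix.diagonal_apply]
  split_ifs
  · exact hS n hn
  · rfl

theorem degLE_one [DecidableEq ι] : DegLE 0 (1 : Matrix ι ι (Psd O)) := fun a b n hn => by
  rw [Matrix.one_apply]
  split_ifs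
  · rw [one_def, coeff_single, if_neg (by omega)]
  · rfl

theorem MatNonneg.add {A B : Matrix ι κ (Psd O)} (hA : MatNonneg A) (hB : MatNonneg B) :
    MatNonneg (A + B) := fun a b => add_mem (hA a b) (hB a b)

theorem MatNonneg.sub {A B : Matrix ι κ (Psd O)} (hA : MatNonneg A) (hB : MatNonneg B) :
    MatNonneg (A - B) := fun a b => sub_mem (hA a b) (hB a b)

theorem MatNonneg.mul [Fintype κ] {A : Matrix ι κ (Psd O)} {B : Matrix κ η (Psd O)}
    (hA : MatNonneg A) (hB : MatNonneg B) : MatNonneg (A * B) := fun a b => by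
  rw [Matrix.mul_apply]
  exact sum_mem fun c _ => mul_mem (hA a c) (hB c b)

theorem MatNonneg.sum {σ : Type*} {s : Finset σ} {A : σ → Matrix ι κ (Psd O)}
    (hA : ∀ i ∈ s, MatNonneg (A i)) : MatNonneg (∑ i ∈ s, A i) := fun a b => by
  rw [Matrix.sum_apply]
  exact sum_mem fun i hi => hA i hi a b

theorem matNonneg_one [DecidableEq ι] : MatNonneg (1 : Matrix ι ι (Psd O)) := fun a b => by
  rw [Matrix.one_apply]
  split_ifs
  · exact one_mem _
  · exact zero_mem _

theorem MatNonneg.pow [Fintype ι] [DecidableEq ι] {A : Matrix ι ι (Psd O)} (hA : MatNonneg A)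
    (n : ℕ) : MatNonneg (A ^ n) := by
  induction n with
  | zero => rw [pow_zero]; exact matNonneg_one
  | succ n ih => rw [pow_succ]; exact ih.mul hA

theorem matNonneg_scalar [DecidableEq ι] [Fintype ι] {S : Psd O} (hS : S ∈ nonneg O) :
    MatNonneg (Matrix.scalar ι S) := fun a b => by
  rw [Matrix.scalar_apply, Matrix.diagonal_apply]
  split_ifs
  · exact hS
  · exact zero_mem _

/-- The positive part of `D - N` is `D`, if `D` has no negative and `N` only negative powers. -/
theorem map_pos_sub {D N : Matrix ι κ (Psd O)} (hD : MatNonneg D) (hN : DegLE (-1) N) :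
    (D - N).map pos = D := by
  ext1 a b
  have h : pos (N a b) = 0 := by
    ext n
    change (if 0 ≤ n then (N a b).coeff n else 0) = 0
    split_ifs with h
    · exact hN a b n (by omega)
    · rfl
  rw [Matrix.map_apply, Matrix.sub_apply, pos_sub, pos_of_nonneg (hD a b), h, sub_zero]

end Matrices

end Psd

/-! ### Commutation relations of `x`, `y` and the idempotents -/

namespace DunklPsd

variable {m : ℕ} [NeZero m] {τ : ℂ} {k : ZMod m → ℂ}

theorem ofComplex_apply (c : ℂ) :
    ofComplex m τ k c = ofCrossed m τ k (ofRat m (RatFunc.C c)) := rfl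

theorem y_mul_ofCrossed (f : CrossedRat m) : y m τ k * ofCrossed m τ k f =
    ofCrossed m τ k (thetaInv m f) * y m τ k + ofCrossed m τ k (dunklD m τ k f) :=
  Psd.y_mul_const f

theorem y_mul_eps (i : ZMod m) : y m τ k * eps m τ k i = eps m τ k (i + 1) * y m τ k := by
  rw [eps, y_mul_ofCrossed, thetaInv_idem, dunklD_idem, map_zero, add_zero]
  rfl

theorem y_pow_mul_eps (n : ℕ) (i : ZMod m) :
    y m τ k ^ n * eps m τ k i = eps m τ k (i + n) * y m τ k ^ n := by
  induction n with
  | zero => simp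
  | succ n ih =>
    rw [pow_succ', mul_assoc, ih, ← mul_assoc, y_mul_eps, mul_assoc, Nat.cast_succ, add_assoc]

theorem eps_mul_eps (i j : ZMod m) :
    eps m τ k i * eps m τ k j = if i = j then eps m τ k i else 0 := by
  rw [eps, eps, ← map_mul, idem_mul_idem]
  split_ifs <;> simp

theorem eps_mul_x (i : ZMod m) : eps m τ k i * x m τ k = x m τ k * eps m τ k (i + 1) := by
  rw [eps, x, ← map_mul, idem_mul_X, map_mul]
  rfl

theorem y_mul_x : y m τ k * x m τ k = x m τ k * y m τ k -
    ∑ i, ofComplex m τ k (dunklLambda τ k i) * eps m τ k i := by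
  rw [x, y_mul_ofCrossed, thetaInv_ofRat, dunklD_X, map_neg, map_sum, sub_eq_add_neg]
  simp only [map_mul]
  rfl

end DunklPsd

/-! ### The dressing identities for rectangular matrices over a ring -/

section Dressing

variable {P n d : Type*} [Ring P] [Fintype n] [DecidableEq n] [Fintype d] [DecidableEq d]
  {X Xi Y Yi : Matrix n n P} {v : Matrix n d P} {w : Matrix d n P}

/-- If `[Y, X]` acts on `Y⁻¹ X⁻¹ v` as the product `v w`, then `1 + w Y⁻¹ X⁻¹ v` is a right inverse
of `1 - w X⁻¹ Y⁻¹ v`. -/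
theorem dress_mul_inv (hX : X * Xi = 1) (hX' : Xi * X = 1) (hY : Y * Yi = 1) (hY' : Yi * Y = 1)
    (h : (Y * X - X * Y) * (Yi * (Xi * v)) = v * (w * (Yi * (Xi * v)))) :
    (1 - w * (Xi * (Yi * v))) * (1 + w * (Yi * (Xi * v))) = 1 := by
  have h1 : Xi * (Yi * (v * (w * (Yi * (Xi * v))))) = Yi * (Xi * v) - Xi * (Yi * v) := by
    rw [← h]
    simp only [Matrix.sub_mul, Matrix.mul_sub, ← Matrix.mul_assoc]
    congr 2
    · rw [Matrix.mul_assoc Xi Yi Y, hY', Matrix.mul_one, hX', Matrix.one_mul]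
    · rw [Matrix.mul_assoc _ Y Yi, hY, Matrix.mul_one, Matrix.mul_assoc _ X Xi, hX, Matrix.mul_one]
  have h2 : w * (Xi * (Yi * v)) * (w * (Yi * (Xi * v))) =
      w * (Yi * (Xi * v)) - w * (Xi * (Yi * v)) := by
    simp only [Matrix.mul_assoc]
    rw [h1, Matrix.mul_sub]
  rw [sub_mul, one_mul, mul_add, mul_one, h2]
  abel

/-- The identity `dress_mul_inv` with `X` and `Y` exchanged and `w` replaced by `-w`. -/
theorem inv_mul_dress (hX : X * Xi = 1) (hX' : Xi * X = 1) (hY : Y * Yi = 1) (hY' : Yi * Y = 1)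
    (h : (Y * X - X * Y) * (Xi * (Yi * v)) = v * (w * (Xi * (Yi * v)))) :
    (1 + w * (Yi * (Xi * v))) * (1 - w * (Xi * (Yi * v))) = 1 := by
  have := dress_mul_inv (w := -w) hY hY' hX hX' (v := v) (by
    rw [← neg_sub, Matrix.neg_mul, h, Matrix.neg_mul, Matrix.mul_neg])
  simpa [Matrix.neg_mul, sub_eq_add_neg] using this

/-- The commutation of `Y` past `X⁻¹ Y⁻¹ v` produces the dressing operator. -/
theorem mul_inv_inv_mul (hX' : Xi * X = 1) (hY : Y * Yi = 1)
    (h : (Y * X - X * Y) * (Xi * (Yi * v)) = v * (w * (Xi * (Yi * v)))) (hX : X * Xi = 1) :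
    Y * (Xi * (Yi * v)) = Xi * (v * (1 - w * (Xi * (Yi * v)))) := by
  have h1 : Xi * (v * (w * (Xi * (Yi * v)))) = Xi * v - Y * (Xi * (Yi * v)) := by
    rw [← h]
    simp only [Matrix.sub_mul, Matrix.mul_sub, ← Matrix.mul_assoc]
    rw [Matrix.mul_assoc _ X Xi, hX, Matrix.mul_one, Matrix.mul_assoc Xi Y Yi, hY, Matrix.mul_one,
      hX', Matrix.one_mul]
  rw [Matrix.mul_sub, Matrix.mul_one, Matrix.mul_sub, h1]
  abel

end Dressing

/-! ### Inverses of `X - x` and `Y - y` -/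

namespace DunklPsd

variable {m : ℕ} [NeZero m] {τ : ℂ} {k : ZMod m → ℂ}

theorem mulY_single_ofRat_C (i : ℤ) (c : ℂ) :
    Psd.mulY (Psd.single i (ofRat m (RatFunc.C c)) : DunklPsd m τ k) =
      Psd.single (i + 1) (ofRat m (RatFunc.C c)) := by
  ext n
  rw [Psd.coeff_mulY, Psd.coeff_single, Psd.coeff_single, Psd.coeff_single]
  have h1 : (dunklDatum m τ k).δ (ofRat m (RatFunc.C c)) = 0 := dunklD_ofRat_C τ k c
  have h2 : (dunklDatum m τ k).σ (ofRat m (RatFunc.C c)) = ofRat m (RatFunc.C c) :=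
    thetaInv_ofRat _
  by_cases h : n = i + 1
  · simp [h, h2]
  · rw [if_neg h, if_neg (by omega)]
    split_ifs <;> simp [h1]

theorem ypow_ofComplex (i : ℤ) (c : ℂ) :
    Psd.ypow i (ofComplex m τ k c) = Psd.single i (ofRat m (RatFunc.C c)) := by
  induction i using Int.induction_on with
  | zero => rw [Psd.ypow_zero]; rfl
  | succ i ih => rw [Psd.ypow_add_one, ih, mulY_single_ofRat_C]
  | pred i ih =>
    have h := Psd.mulInvY_mulY
      (Psd.single (-(i : ℤ) - 1) (ofRat m (RatFunc.C c)) : DunklPsd m τ k)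
    rw [mulY_single_ofRat_C, sub_add_cancel] at h
    rw [Psd.ypow_sub_one, ih, h]

theorem coeff_mul_ofComplex (S : DunklPsd m τ k) (c : ℂ) (n : ℤ) :
    (S * ofComplex m τ k c).coeff n = S.coeff n * ofRat m (RatFunc.C c) := by
  rw [Psd.coeff_mul, finsum_eq_single _ n fun i hi => by
    rw [ypow_ofComplex, Psd.coeff_single, if_neg hi.symm, mul_zero], ypow_ofComplex,
    Psd.coeff_single, if_pos rfl]

/-- The complex numbers are central. -/
theorem ofComplex_comm (c : ℂ) (S : DunklPsd m τ k) :
    ofComplex m τ k c * S = S * ofComplex m τ k c := by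
  ext1 n
  rw [coeff_mul_ofComplex, ofComplex_apply, ofCrossed, Psd.coeff_const_mul, ofRat_C_comm]

theorem scalar_mul_apply {R ι κ : Type*} [Semiring R] [Fintype ι] [DecidableEq ι] (S : R)
    (A : Matrix ι κ R) (a : ι) (b : κ) : (Matrix.scalar ι S * A) a b = S * A a b := by
  rw [Matrix.scalar_apply, Matrix.diagonal_mul]

theorem mul_scalar_apply {R ι κ : Type*} [Semiring R] [Fintype κ] [DecidableEq κ] (S : R)
    (A : Matrix ι κ R) (a : ι) (b : κ) : (A * Matrix.scalar κ S) a b = A a b * S := by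
  rw [Matrix.scalar_apply, Matrix.mul_diagonal]

section

variable {ι κ : Type*} [Fintype ι] [DecidableEq ι] [Fintype κ] [DecidableEq κ]

theorem scalar_mul_map (S : DunklPsd m τ k) (A : Matrix ι κ ℂ) :
    Matrix.scalar ι S * A.map (ofComplex m τ k) = A.map (ofComplex m τ k) * Matrix.scalar κ S := by
  ext1 a b
  rw [scalar_mul_apply, mul_scalar_apply, Matrix.map_apply, ofComplex_comm]

end

end DunklPsd

open DunklPsd

section HatInverses

variable {m : ℕ} [NeZero m] {τ : ℂ} {k : ZMod m → ℂ} {α : ZMod m → ℕ} {d : ℕ}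

/-- The matrix `X - x` over the field of rational functions. -/
def ratX (q : FramedRep m α d) : Matrix (VIdx α) (VIdx α) (RatFunc ℂ) :=
  q.X.map RatFunc.C - Matrix.scalar (VIdx α) RatFunc.X

/-- Up to sign, the determinant of `X - x` is the characteristic polynomial of `X`. -/
theorem det_ratX_ne_zero (q : FramedRep m α d) : (ratX q).det ≠ 0 := by
  have h : ratX q = -(Matrix.charmatrix q.X).map (algebraMap (Polynomial ℂ) (RatFunc ℂ)) := by
    ext1 a b
    rw [ratX, Matrix.sub_apply, Matrix.neg_apply, Matrix.map_apply, Matrix.map_apply,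
      Matrix.charmatrix_apply, map_sub, RatFunc.algebraMap_C, neg_sub, Matrix.scalar_apply,
      Matrix.diagonal_apply, Matrix.diagonal_apply]
    split_ifs <;> simp
  rw [h, Matrix.det_neg, ← RingHom.mapMatrix_apply, ← RingHom.map_det]
  exact mul_ne_zero (pow_ne_zero _ (neg_ne_zero.2 one_ne_zero))
    (ratMap_ne_zero (Matrix.charpoly_monic q.X).ne_zero)

variable (τ k) in
/-- The inclusion `ℂ(x) ⊂ 𝒫`. -/
def ratEmb : RatFunc ℂ →+* DunklPsd m τ k := (ofCrossed m τ k).comp (ofRat m)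

theorem hatX_eq_map (q : FramedRep m α d) : hatX τ k q = (ratX q).map (ratEmb τ k) := by
  ext1 a b
  rw [hatX, ratX, Matrix.sub_apply, Matrix.map_apply, Matrix.map_apply, Matrix.sub_apply, map_sub,
    Matrix.map_apply, Matrix.scalar_apply, Matrix.scalar_apply, Matrix.diagonal_apply,
    Matrix.diagonal_apply]
  split_ifs
  · rfl
  · rw [map_zero]; rfl

variable (τ k) in
/-- The matrix `(X - x)⁻¹`, with entries in `ℂ(x)`. -/
def hatXInv (q : FramedRep m α d) : Matrix (VIdx α) (VIdx α) (DunklPsd m τ k) :=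
  (ratX q)⁻¹.map (ratEmb τ k)

theorem hatX_mul_inv (q : FramedRep m α d) : hatX τ k q * hatXInv τ k q = 1 := by
  rw [hatX_eq_map, hatXInv, ← Matrix.map_mul,
    Matrix.mul_nonsing_inv _ (isUnit_iff_ne_zero.2 (det_ratX_ne_zero q)),
    Matrix.map_one _ (map_zero _) (map_one _)]

theorem hatXInv_mul (q : FramedRep m α d) : hatXInv τ k q * hatX τ k q = 1 := by
  rw [hatX_eq_map, hatXInv, ← Matrix.map_mul,
    Matrix.nonsing_inv_mul _ (isUnit_iff_ne_zero.2 (det_ratX_ne_zero q)),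
    Matrix.map_one _ (map_zero _) (map_one _)]

variable (τ k) in
/-- The matrix `(Y - y)⁻¹ = -∑_{n ≥ 0} Y^n y^{-n-1}`. -/
def hatYInv (q : FramedRep m α d) : Matrix (VIdx α) (VIdx α) (DunklPsd m τ k) := fun a b =>
  ⟨fun n => if n < 0 then ofRat m (RatFunc.C (-(q.Y ^ (-n - 1).toNat) a b)) else 0, 0,
    fun n hn => if_neg (by omega)⟩

theorem coeff_hatYInv (q : FramedRep m α d) (a b : VIdx α) (n : ℤ) :
    (hatYInv τ k q a b).coeff n =
      if n < 0 then ofRat m (RatFunc.C (-(q.Y ^ (-n - 1).toNat) a b)) else 0 := rfl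

theorem coeff_y_mul_hatYInv (q : FramedRep m α d) (a b : VIdx α) (n : ℤ) :
    (y m τ k * hatYInv τ k q a b).coeff n = (hatYInv τ k q a b).coeff (n - 1) := by
  have h1 : ∀ c, (dunklDatum m τ k).δ (ofRat m (RatFunc.C c)) = 0 := dunklD_ofRat_C τ k
  have h2 : ∀ c, (dunklDatum m τ k).σ (ofRat m (RatFunc.C c)) = ofRat m (RatFunc.C c) :=
    fun c => thetaInv_ofRat _
  rw [y, Psd.y_mul, Psd.coeff_mulY, coeff_hatYInv, coeff_hatYInv]
  split_ifs <;> simp only [h1, h2, map_zero, add_zero]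

theorem hatYInv_comm (q : FramedRep m α d) : hatYInv τ k q * hatY τ k q =
    hatY τ k q * hatYInv τ k q := by
  rw [hatY, Matrix.mul_sub, Matrix.sub_mul]
  congr 1
  · ext a b n : 2
    rw [Matrix.mul_apply, Matrix.mul_apply, Psd.coeff_sum, Psd.coeff_sum]
    simp only [Matrix.map_apply, ofComplex_comm _ (hatYInv τ k q _ _), coeff_mul_ofComplex,
      coeff_hatYInv]
    by_cases hn : n < 0
    · simp only [if_pos hn, ← map_mul, ← map_sum, neg_mul, Finset.sum_neg_distrib]
      rw [← Matrix.mul_apply, ← pow_succ, pow_succ', Matrix.mul_apply]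
      simp only [mul_comm]
    · simp only [if_neg hn, zero_mul]
  · ext a b n : 2
    rw [scalar_mul_apply, mul_scalar_apply, coeff_y_mul_hatYInv]
    exact Psd.coeff_mul_y (hatYInv τ k q a b) n

theorem hatYInv_mul (q : FramedRep m α d) : hatYInv τ k q * hatY τ k q = 1 := by
  ext a b n : 2
  rw [hatY, Matrix.mul_sub, Matrix.sub_apply, mul_scalar_apply, Psd.coeff_sub, y,
    Psd.coeff_mul_y, Matrix.mul_apply, Psd.coeff_sum]
  simp only [Matrix.map_apply, coeff_mul_ofComplex, coeff_hatYInv]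
  have h1 : ((1 : Matrix (VIdx α) (VIdx α) (DunklPsd m τ k)) a b).coeff n =
      if n = 0 then ofRat m (RatFunc.C ((1 : Matrix (VIdx α) (VIdx α) ℂ) a b)) else 0 := by
    rw [Matrix.one_apply, Matrix.one_apply]
    split_ifs <;> simp [Psd.one_def, Psd.coeff_single, *]
  rw [h1]
  rcases lt_trichotomy n 0 with hn | hn | hn
  · simp only [if_pos hn, ← map_mul, ← map_sum, neg_mul, Finset.sum_neg_distrib]
    rw [← Matrix.mul_apply, ← pow_succ, if_pos (by omega), if_neg hn.ne,
      show (-(n - 1) - 1).toNat = (-n - 1).toNat + 1 by omega, sub_self]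
  · subst hn
    simp
  · simp only [if_neg hn.le.not_gt, zero_mul, Finset.sum_const_zero]
    rw [if_neg (by omega), if_neg hn.ne', sub_zero]

theorem hatY_mul_inv (q : FramedRep m α d) : hatY τ k q * hatYInv τ k q = 1 := by
  rw [← hatYInv_comm, hatYInv_mul]

theorem isUnit_hatX (q : FramedRep m α d) : IsUnit (hatX τ k q) :=
  ⟨⟨_, _, hatX_mul_inv q, hatXInv_mul q⟩, rfl⟩

theorem isUnit_hatY (q : FramedRep m α d) : IsUnit (hatY τ k q) :=
  ⟨⟨_, _, hatY_mul_inv q, hatYInv_mul q⟩, rfl⟩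

theorem inverse_eq_of_mul_eq_one {R : Type*} [Ring R] {a b : R} (h : a * b = 1) (h' : b * a = 1) :
    Ring.inverse a = b :=
  Ring.inverse_unit ⟨a, b, h, h'⟩

theorem inverse_hatX (q : FramedRep m α d) : Ring.inverse (hatX τ k q) = hatXInv τ k q :=
  inverse_eq_of_mul_eq_one (hatX_mul_inv q) (hatXInv_mul q)

theorem inverse_hatY (q : FramedRep m α d) : Ring.inverse (hatY τ k q) = hatYInv τ k q :=
  inverse_eq_of_mul_eq_one (hatY_mul_inv q) (hatYInv_mul q)

end HatInverses

/-! ### The dressing operator and its inverse -/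

section DressInverse

variable {m : ℕ} [NeZero m] {τ : ℂ} {k : ZMod m → ℂ} {α : ZMod m → ℕ} {d : ℕ}

theorem vproj_mul_vproj (i j : ZMod m) :
    vproj α i * vproj α j = if i = j then vproj α i else 0 := by
  rw [vproj, vproj, Matrix.diagonal_mul_diagonal]
  by_cases h : i = j
  · subst h
    simp
  · rw [if_neg h, ← Matrix.diagonal_zero]
    congr 1
    ext a
    by_cases h1 : a.1 = i
    · rw [if_neg fun h2 => h (h1.symm.trans h2), mul_zero]
    · rw [if_neg h1, zero_mul]

theorem sum_vproj : ∑ i, vproj α i = 1 := by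
  ext a b
  rw [Matrix.sum_apply]
  simp [vproj, Matrix.diagonal_apply, Matrix.one_apply]

variable (τ k) in
/-- The matrix `v_0 ε_0`. -/
def epsV (q : FramedRep m α d) : Matrix (VIdx α) (Fin d) (DunklPsd m τ k) :=
  (q.vAt 0).map (ofComplex m τ k) * Matrix.scalar (Fin d) (eps m τ k 0)

variable (τ k) in
/-- The matrix `ε_0 w_0`. -/
def epsW (q : FramedRep m α d) : Matrix (Fin d) (VIdx α) (DunklPsd m τ k) :=
  Matrix.scalar (Fin d) (eps m τ k 0) * (q.wAt 0).map (ofComplex m τ k)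

variable (m τ k α) in
/-- The idempotents `∑_i e_i ε_{i+c}`. -/
def diagIdem (c : ZMod m) : Matrix (VIdx α) (VIdx α) (DunklPsd m τ k) :=
  ∑ i, (vproj α i).map (ofComplex m τ k) * Matrix.scalar (VIdx α) (eps m τ k (i + c))

theorem map_mul_ofComplex {ι κ η : Type*} [Fintype κ] (A : Matrix ι κ ℂ) (B : Matrix κ η ℂ) :
    (A * B).map (ofComplex m τ k) = A.map (ofComplex m τ k) * B.map (ofComplex m τ k) :=
  Matrix.map_mul

theorem map_vproj_mul_diagIdem (i c : ZMod m) :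
    (vproj α i).map (ofComplex m τ k) * diagIdem m τ k α c =
      (vproj α i).map (ofComplex m τ k) * Matrix.scalar (VIdx α) (eps m τ k (i + c)) := by
  rw [diagIdem, Finset.mul_sum, Finset.sum_eq_single i]
  · rw [← mul_assoc, ← map_mul_ofComplex, vproj_mul_vproj, if_pos rfl]
  · intro j _ hj
    rw [← mul_assoc, ← map_mul_ofComplex, vproj_mul_vproj, if_neg hj.symm, Matrix.map_zero _
      (map_zero _), zero_mul]
  · simp

theorem mapX_mul_diagIdem (q : FramedRep m α d) (c : ZMod m) :
    q.X.map (ofComplex m τ k) * diagIdem m τ k α c =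
      diagIdem m τ k α (c - 1) * q.X.map (ofComplex m τ k) := by
  rw [diagIdem, diagIdem, Finset.mul_sum, Finset.sum_mul,
    ← Equiv.sum_comp (Equiv.addRight (1 : ZMod m)) fun i => (vproj α i).map (ofComplex m τ k) *
      Matrix.scalar (VIdx α) (eps m τ k (i + (c - 1))) * q.X.map (ofComplex m τ k)]
  refine Finset.sum_congr rfl fun i _ => ?_
  rw [Equiv.coe_addRight, ← mul_assoc, ← map_mul_ofComplex, ← q.X_graded, mul_assoc,
    scalar_mul_map, ← mul_assoc, ← map_mul_ofComplex]
  congr 3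
  ring

theorem mapY_mul_diagIdem (q : FramedRep m α d) (c : ZMod m) :
    q.Y.map (ofComplex m τ k) * diagIdem m τ k α c =
      diagIdem m τ k α (c + 1) * q.Y.map (ofComplex m τ k) := by
  rw [diagIdem, diagIdem, Finset.mul_sum, Finset.sum_mul,
    ← Equiv.sum_comp (Equiv.addRight (1 : ZMod m)) fun i => q.Y.map (ofComplex m τ k) *
      ((vproj α i).map (ofComplex m τ k) * Matrix.scalar (VIdx α) (eps m τ k (i + c)))]
  refine Finset.sum_congr rfl fun i _ => ?_
  rw [Equiv.coe_addRight, ← mul_assoc, ← map_mul_ofComplex, ← q.Y_graded, mul_assoc,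
    scalar_mul_map, ← mul_assoc, ← map_mul_ofComplex]
  congr 3
  ring

theorem scalar_x_mul_diagIdem (c : ZMod m) :
    Matrix.scalar (VIdx α) (x m τ k) * diagIdem m τ k α c =
      diagIdem m τ k α (c - 1) * Matrix.scalar (VIdx α) (x m τ k) := by
  rw [diagIdem, diagIdem, Finset.mul_sum, Finset.sum_mul]
  refine Finset.sum_congr rfl fun i _ => ?_
  rw [← mul_assoc, scalar_mul_map, mul_assoc, mul_assoc, ← map_mul, ← map_mul, eps_mul_x]
  congr 4
  ring

theorem scalar_y_mul_diagIdem (c : ZMod m) :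
    Matrix.scalar (VIdx α) (y m τ k) * diagIdem m τ k α c =
      diagIdem m τ k α (c + 1) * Matrix.scalar (VIdx α) (y m τ k) := by
  rw [diagIdem, diagIdem, Finset.mul_sum, Finset.sum_mul]
  refine Finset.sum_congr rfl fun i _ => ?_
  rw [← mul_assoc, scalar_mul_map, mul_assoc, mul_assoc, ← map_mul, ← map_mul, y_mul_eps,
    add_assoc]

theorem hatX_mul_diagIdem (q : FramedRep m α d) (c : ZMod m) :
    hatX τ k q * diagIdem m τ k α c = diagIdem m τ k α (c - 1) * hatX τ k q := by
  rw [hatX, sub_mul, mul_sub, mapX_mul_diagIdem, scalar_x_mul_diagIdem]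

theorem hatY_mul_diagIdem (q : FramedRep m α d) (c : ZMod m) :
    hatY τ k q * diagIdem m τ k α c = diagIdem m τ k α (c + 1) * hatY τ k q := by
  rw [hatY, sub_mul, mul_sub, mapY_mul_diagIdem, scalar_y_mul_diagIdem]

theorem diagIdem_mul_hatXInv (q : FramedRep m α d) (c : ZMod m) :
    diagIdem m τ k α c * hatXInv τ k q = hatXInv τ k q * diagIdem m τ k α (c - 1) := by
  rw [← one_mul (diagIdem m τ k α c), ← hatXInv_mul q, mul_assoc (hatXInv τ k q),
    hatX_mul_diagIdem, mul_assoc, mul_assoc, hatX_mul_inv, mul_one]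

theorem diagIdem_mul_hatYInv (q : FramedRep m α d) (c : ZMod m) :
    diagIdem m τ k α c * hatYInv τ k q = hatYInv τ k q * diagIdem m τ k α (c + 1) := by
  rw [← one_mul (diagIdem m τ k α c), ← hatYInv_mul q, mul_assoc (hatYInv τ k q),
    hatY_mul_diagIdem, mul_assoc, mul_assoc, hatY_mul_inv, mul_one]

theorem vproj_mul_vAt (q : FramedRep m α d) : vproj α 0 * q.vAt 0 = q.vAt 0 := by
  rw [FramedRep.vAt, ← Matrix.mul_assoc, vproj_mul_vproj, if_pos rfl]

theorem wAt_mul_vproj (q : FramedRep m α d) : q.wAt 0 * vproj α 0 = q.wAt 0 := by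
  rw [FramedRep.wAt, Matrix.mul_assoc, vproj_mul_vproj, if_pos rfl]

theorem diagIdem_comm_map_vproj (i c : ZMod m) :
    diagIdem m τ k α c * (vproj α i).map (ofComplex m τ k) =
      (vproj α i).map (ofComplex m τ k) * diagIdem m τ k α c := by
  rw [diagIdem, Finset.mul_sum, Finset.sum_mul]
  refine Finset.sum_congr rfl fun j _ => ?_
  rw [mul_assoc, scalar_mul_map, ← mul_assoc, ← mul_assoc, ← map_mul_ofComplex,
    ← map_mul_ofComplex, vproj_mul_vproj, vproj_mul_vproj]
  by_cases h : i = j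
  · subst h; rfl
  · rw [if_neg h, if_neg (Ne.symm h)]

theorem diagIdem_mul_map_vAt (q : FramedRep m α d) (c : ZMod m) :
    diagIdem m τ k α c * (q.vAt 0).map (ofComplex m τ k) =
      (q.vAt 0).map (ofComplex m τ k) * Matrix.scalar (Fin d) (eps m τ k c) := by
  rw [← vproj_mul_vAt, map_mul_ofComplex, ← Matrix.mul_assoc, diagIdem_comm_map_vproj,
    map_vproj_mul_diagIdem, Matrix.mul_assoc, scalar_mul_map, ← Matrix.mul_assoc, zero_add]

theorem map_wAt_mul_diagIdem (q : FramedRep m α d) (c : ZMod m) :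
    (q.wAt 0).map (ofComplex m τ k) * diagIdem m τ k α c =
      Matrix.scalar (Fin d) (eps m τ k c) * (q.wAt 0).map (ofComplex m τ k) := by
  rw [← wAt_mul_vproj, map_mul_ofComplex, Matrix.mul_assoc, map_vproj_mul_diagIdem,
    ← Matrix.mul_assoc, ← map_mul_ofComplex, scalar_mul_map, zero_add]

theorem diagIdem_mul_epsV (q : FramedRep m α d) : diagIdem m τ k α 0 * epsV τ k q = epsV τ k q := by
  rw [epsV, ← Matrix.mul_assoc, diagIdem_mul_map_vAt, Matrix.mul_assoc, ← map_mul, eps_mul_eps,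
    if_pos rfl]

theorem epsV_mul_epsW (q : FramedRep m α d) : epsV τ k q * epsW τ k q =
    ((q.vAt 0) * (q.wAt 0)).map (ofComplex m τ k) * diagIdem m τ k α 0 := by
  rw [map_mul_ofComplex, Matrix.mul_assoc, map_wAt_mul_diagIdem, epsV, epsW, Matrix.mul_assoc,
    ← Matrix.mul_assoc (Matrix.scalar (Fin d) _), ← map_mul, eps_mul_eps, if_pos rfl]

theorem map_smul_ofComplex {ι κ : Type*} [Fintype ι] [DecidableEq ι] (c : ℂ) (A : Matrix ι κ ℂ) :
    (c • A).map (ofComplex m τ k) =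
      Matrix.scalar ι (ofComplex m τ k c) * A.map (ofComplex m τ k) := by
  ext1 a b
  rw [scalar_mul_apply, Matrix.map_apply, Matrix.map_apply, Matrix.smul_apply, smul_eq_mul,
    map_mul]

theorem map_sum_ofComplex {σ ι κ : Type*} (s : Finset σ) (A : σ → Matrix ι κ ℂ) :
    (∑ i ∈ s, A i).map (ofComplex m τ k) = ∑ i ∈ s, (A i).map (ofComplex m τ k) := by
  ext1 a b
  simp only [Matrix.map_apply, Matrix.sum_apply, map_sum]

theorem map_sub_ofComplex {ι κ : Type*} (A B : Matrix ι κ ℂ) :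
    (A - B).map (ofComplex m τ k) = A.map (ofComplex m τ k) - B.map (ofComplex m τ k) := by
  ext1 a b
  simp only [Matrix.map_apply, Matrix.sub_apply, map_sub]

theorem map_add_ofComplex {ι κ : Type*} (A B : Matrix ι κ ℂ) :
    (A + B).map (ofComplex m τ k) = A.map (ofComplex m τ k) + B.map (ofComplex m τ k) := by
  ext1 a b
  simp only [Matrix.map_apply, Matrix.add_apply, map_add]

theorem hat_commutator_eq (q : FramedRep m α d) :
    hatY τ k q * hatX τ k q - hatX τ k q * hatY τ k q =
      (q.Y * q.X - q.X * q.Y).map (ofComplex m τ k) -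
        ∑ i, Matrix.scalar (VIdx α) (ofComplex m τ k (dunklLambda τ k i) * eps m τ k i) := by
  have h : Matrix.scalar (VIdx α) (y m τ k) * Matrix.scalar (VIdx α) (x m τ k) =
      Matrix.scalar (VIdx α) (x m τ k) * Matrix.scalar (VIdx α) (y m τ k) -
        ∑ i, Matrix.scalar (VIdx α) (ofComplex m τ k (dunklLambda τ k i) * eps m τ k i) := by
    rw [← map_mul, y_mul_x, map_sub, map_mul, map_sum]
  rw [hatX, hatY, map_sub_ofComplex, map_mul_ofComplex, map_mul_ofComplex]
  simp only [mul_sub, sub_mul, scalar_mul_map, h]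
  abel

theorem sum_vAt_mul_wAt {q : FramedRep m α d} (hv : ∀ i, i ≠ 0 → q.vAt i = 0) :
    ∑ i, q.vAt i * q.wAt i = q.vAt 0 * q.wAt 0 :=
  Finset.sum_eq_single 0 (fun i _ hi => by rw [hv i hi, Matrix.zero_mul]) (by simp)

/-- On the image of `∑ e_i ε_i` the two preprojective relations combine to
`[Y - y, X - x] = v_0 ε_0 w_0`. -/
theorem hat_commutator_mul_diagIdem {q : FramedRep m α d}
    (hq : q ∈ FramedRep.sphericalCM (dunklLambda τ k)) :
    (hatY τ k q * hatX τ k q - hatX τ k q * hatY τ k q) * diagIdem m τ k α 0 =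
      epsV τ k q * epsW τ k q := by
  have h1 := sum_vAt_mul_wAt fun i hi => (hq.2 i hi).1
  have h2 : q.Y * q.X - q.X * q.Y = q.vAt 0 * q.wAt 0 + ∑ i, dunklLambda τ k i • vproj α i := by
    rw [← hq.1, h1]
    abel
  rw [hat_commutator_eq, h2, map_add_ofComplex, map_sum_ofComplex, epsV_mul_epsW, sub_mul, add_mul,
    add_sub_assoc, add_eq_left, sub_eq_zero, Finset.sum_mul, diagIdem, Finset.sum_mul]
  simp only [Finset.mul_sum]
  rw [Finset.sum_comm]
  conv_rhs => rw [Finset.sum_comm]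
  refine Finset.sum_congr rfl fun j _ => ?_
  rw [Finset.sum_eq_single j, Finset.sum_eq_single j]
  · rw [← mul_assoc (Matrix.scalar _ _), scalar_mul_map, mul_assoc, ← map_mul, mul_assoc, add_zero,
      eps_mul_eps, if_pos rfl, map_smul_ofComplex, mul_assoc, ← mul_assoc (Matrix.map _ _),
      ← map_mul_ofComplex, vproj_mul_vproj, if_pos rfl, ← mul_assoc, scalar_mul_map, mul_assoc,
      ← map_mul]
  · intro i _ hi
    rw [← mul_assoc (Matrix.scalar _ _), scalar_mul_map, mul_assoc, ← map_mul, mul_assoc, add_zero,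
      eps_mul_eps, if_neg hi, mul_zero, map_zero, mul_zero]
  · simp
  · intro i _ hi
    rw [← mul_assoc, ← map_mul_ofComplex, smul_mul_assoc, vproj_mul_vproj, if_neg hi, smul_zero,
      Matrix.map_zero _ (map_zero _), zero_mul]
  · simp

/-- The inverses of `X - x` and `Y - y` shift the idempotents `∑ e_i ε_{i+c}` in opposite
directions, so that their product preserves the image of `∑ e_i ε_i`. -/
theorem diagIdem_mul_hatXInv_hatYInv (q : FramedRep m α d) :
    diagIdem m τ k α 0 * (hatXInv τ k q * (hatYInv τ k q * epsV τ k q)) =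
      hatXInv τ k q * (hatYInv τ k q * epsV τ k q) := by
  rw [← Matrix.mul_assoc, diagIdem_mul_hatXInv, Matrix.mul_assoc,
    ← Matrix.mul_assoc (diagIdem _ _ _ _ _), diagIdem_mul_hatYInv, Matrix.mul_assoc, sub_add_cancel,
    diagIdem_mul_epsV]

theorem diagIdem_mul_hatYInv_hatXInv (q : FramedRep m α d) :
    diagIdem m τ k α 0 * (hatYInv τ k q * (hatXInv τ k q * epsV τ k q)) =
      hatYInv τ k q * (hatXInv τ k q * epsV τ k q) := by
  rw [← Matrix.mul_assoc, diagIdem_mul_hatYInv, Matrix.mul_assoc,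
    ← Matrix.mul_assoc (diagIdem _ _ _ _ _), diagIdem_mul_hatXInv, Matrix.mul_assoc,
    add_sub_cancel_right, diagIdem_mul_epsV]

theorem hat_commutator_mul {q : FramedRep m α d}
    (hq : q ∈ FramedRep.sphericalCM (dunklLambda τ k))
    {Z : Matrix (VIdx α) (Fin d) (DunklPsd m τ k)}
    (hZ : diagIdem m τ k α 0 * Z = Z) :
    (hatY τ k q * hatX τ k q - hatX τ k q * hatY τ k q) * Z = epsV τ k q * (epsW τ k q * Z) := by
  conv_lhs => rw [← hZ]
  rw [← Matrix.mul_assoc, hat_commutator_mul_diagIdem hq, Matrix.mul_assoc]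

variable (τ k) in
/-- The operator `ε_0 w_0 (X - x)⁻¹ (Y - y)⁻¹ v_0 ε_0`. -/
def dressA (q : FramedRep m α d) : Mat m τ k d :=
  epsW τ k q * (hatXInv τ k q * (hatYInv τ k q * epsV τ k q))

variable (τ k) in
/-- The operator `ε_0 w_0 (Y - y)⁻¹ (X - x)⁻¹ v_0 ε_0`. -/
def dressB (q : FramedRep m α d) : Mat m τ k d :=
  epsW τ k q * (hatYInv τ k q * (hatXInv τ k q * epsV τ k q))

theorem dressM_eq (q : FramedRep m α d) : dressM τ k q = 1 - dressA τ k q := by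
  rw [dressM, inverse_hatX, inverse_hatY, dressA, epsW, epsV]
  simp only [Matrix.mul_assoc]

theorem dressM_mul_inv {q : FramedRep m α d} (hq : q ∈ FramedRep.sphericalCM (dunklLambda τ k)) :
    dressM τ k q * (1 + dressB τ k q) = 1 := by
  rw [dressM_eq]
  exact dress_mul_inv (hatX_mul_inv q) (hatXInv_mul q) (hatY_mul_inv q) (hatYInv_mul q)
    (hat_commutator_mul hq (diagIdem_mul_hatYInv_hatXInv q))

theorem inv_mul_dressM {q : FramedRep m α d} (hq : q ∈ FramedRep.sphericalCM (dunklLambda τ k)) :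
    (1 + dressB τ k q) * dressM τ k q = 1 := by
  rw [dressM_eq]
  exact inv_mul_dress (hatX_mul_inv q) (hatXInv_mul q) (hatY_mul_inv q) (hatYInv_mul q)
    (hat_commutator_mul hq (diagIdem_mul_hatXInv_hatYInv q))

theorem inverse_dressM {q : FramedRep m α d} (hq : q ∈ FramedRep.sphericalCM (dunklLambda τ k)) :
    Ring.inverse (dressM τ k q) = 1 + dressB τ k q :=
  inverse_eq_of_mul_eq_one (dressM_mul_inv hq) (inv_mul_dressM hq)

theorem laxL_eq {q : FramedRep m α d} (hq : q ∈ FramedRep.sphericalCM (dunklLambda τ k)) :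
    laxL τ k q = dressM τ k q * Matrix.scalar (Fin d) (y m τ k) * (1 + dressB τ k q) := by
  rw [laxL, inverse_dressM hq]

theorem laxR_eq {q : FramedRep m α d} (hq : q ∈ FramedRep.sphericalCM (dunklLambda τ k))
    (β : Fin d) : laxR τ k q β = dressM τ k q * Matrix.single β β 1 * (1 + dressB τ k q) := by
  rw [laxR, inverse_dressM hq]

end DressInverse

/-! ### The form, relations and symmetry of the Lax operators -/

section LaxTuple

open Psd

variable {m : ℕ}

theorem coeff_coeff_thetaInv_one (f : CrossedRat m) :
    (thetaInv m f).coeff 1 = f.coeff 1 :=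
  (coeff_twist _ f 1).trans (by simp)

variable [NeZero m] {τ : ℂ} {k : ZMod m → ℂ} {α : ZMod m → ℕ} {d : ℕ}

theorem degLE_map_ofComplex {ι κ : Type*} (A : Matrix ι κ ℂ) :
    DegLE 0 (A.map (ofComplex m τ k)) := fun a b n hn => by
  rw [Matrix.map_apply, ofComplex_apply, ofCrossed, coeff_const, if_neg (by omega)]

theorem degLE_scalar_eps {ι : Type*} [Fintype ι] [DecidableEq ι] (i : ZMod m) :
    DegLE 0 (Matrix.scalar ι (eps m τ k i)) :=
  degLE_scalar fun n hn => by rw [eps, ofCrossed, coeff_const, if_neg (by omega)]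

theorem degLE_scalar_y {ι : Type*} [Fintype ι] [DecidableEq ι] :
    DegLE 1 (Matrix.scalar ι (y m τ k)) :=
  degLE_scalar fun n hn => by rw [DunklPsd.y, Psd.y, coeff_single, if_neg (by omega)]

theorem degLE_epsV (q : FramedRep m α d) : DegLE 0 (epsV τ k q) :=
  (degLE_map_ofComplex _).mul (degLE_scalar_eps 0)

theorem degLE_epsW (q : FramedRep m α d) : DegLE 0 (epsW τ k q) :=
  (degLE_scalar_eps 0).mul (degLE_map_ofComplex _)

theorem degLE_hatXInv (q : FramedRep m α d) : DegLE 0 (hatXInv τ k q) := fun a b n hn => by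
  rw [hatXInv, Matrix.map_apply, ratEmb, RingHom.comp_apply, ofCrossed, coeff_const,
    if_neg (by omega)]

theorem degLE_hatYInv (q : FramedRep m α d) : DegLE (-1) (hatYInv τ k q) := fun a b n hn => by
  rw [coeff_hatYInv, if_neg (by omega)]

theorem degLE_dressA (q : FramedRep m α d) : DegLE (-1) (dressA τ k q) :=
  (degLE_epsW q).mul ((degLE_hatXInv q).mul ((degLE_hatYInv q).mul (degLE_epsV q)))

theorem degLE_dressB (q : FramedRep m α d) : DegLE (-1) (dressB τ k q) :=
  (degLE_epsW q).mul ((degLE_hatYInv q).mul ((degLE_hatXInv q).mul (degLE_epsV q)))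

theorem dressB_sub_dressA {q : FramedRep m α d}
    (hq : q ∈ FramedRep.sphericalCM (dunklLambda τ k)) :
    dressB τ k q - dressA τ k q = dressA τ k q * dressB τ k q := by
  have h := dressM_mul_inv hq
  rw [dressM_eq, sub_mul, one_mul, mul_add, mul_one] at h
  rw [← sub_eq_zero] at h ⊢
  rw [← h]
  abel

theorem laxL_expand {q : FramedRep m α d} (hq : q ∈ FramedRep.sphericalCM (dunklLambda τ k)) :
    laxL τ k q = Matrix.scalar (Fin d) (y m τ k) +
      (Matrix.scalar (Fin d) (y m τ k) * dressB τ k q -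
        dressA τ k q * Matrix.scalar (Fin d) (y m τ k)) -
      dressA τ k q * (Matrix.scalar (Fin d) (y m τ k) * dressB τ k q) := by
  rw [laxL_eq hq, dressM_eq]
  noncomm_ring

theorem laxR_expand {q : FramedRep m α d} (hq : q ∈ FramedRep.sphericalCM (dunklLambda τ k))
    (β : Fin d) : laxR τ k q β = Matrix.single β β 1 +
      (Matrix.single β β 1 * dressB τ k q - dressA τ k q * Matrix.single β β 1 -
        dressA τ k q * (Matrix.single β β 1 * dressB τ k q)) := by
  rw [laxR_eq hq, dressM_eq]
  noncomm_ring

theorem degLE_single_one (β : Fin d) :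
    DegLE 0 (Matrix.single β β 1 : Mat m τ k d) := fun a b n hn => by
  rw [Matrix.single_apply]
  split_ifs
  · rw [one_def, coeff_single, if_neg (by omega)]
  · rfl

theorem coeff_scalar_y {ι : Type*} [Fintype ι] [DecidableEq ι] (a b : ι) (n : ℤ) :
    (Matrix.scalar ι (y m τ k) a b).coeff n = if a = b ∧ n = 1 then 1 else 0 := by
  rw [Matrix.scalar_apply, Matrix.diagonal_apply]
  by_cases h : a = b
  · simp [h, DunklPsd.y, Psd.y, coeff_single]
  · simp [h]

theorem scalar_eps_mul_dressA (q : FramedRep m α d) (i : ZMod m) :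
    Matrix.scalar (Fin d) (eps m τ k i) * dressA τ k q =
      dressA τ k q * Matrix.scalar (Fin d) (eps m τ k i) := by
  simp only [dressA, epsW, epsV, Matrix.mul_assoc]
  rw [← Matrix.mul_assoc, ← map_mul, ← map_mul, eps_mul_eps, eps_mul_eps]
  by_cases h : i = 0
  · subst h
    simp
  · simp [h, Ne.symm h]

theorem scalar_eps_mul_dressB (q : FramedRep m α d) (i : ZMod m) :
    Matrix.scalar (Fin d) (eps m τ k i) * dressB τ k q =
      dressB τ k q * Matrix.scalar (Fin d) (eps m τ k i) := by
  simp only [dressB, epsW, epsV, Matrix.mul_assoc]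
  rw [← Matrix.mul_assoc, ← map_mul, ← map_mul, eps_mul_eps, eps_mul_eps]
  by_cases h : i = 0
  · subst h
    simp
  · simp [h, Ne.symm h]

theorem scalar_eps_mul_y (i : ZMod m) :
    Matrix.scalar (Fin d) (eps m τ k i) * Matrix.scalar (Fin d) (y m τ k) =
      Matrix.scalar (Fin d) (y m τ k) * Matrix.scalar (Fin d) (eps m τ k (i - 1)) := by
  rw [← map_mul, ← map_mul, y_mul_eps, sub_add_cancel]

theorem scalar_comm_single (S : DunklPsd m τ k) (β : Fin d) :
    Matrix.scalar (Fin d) S * Matrix.single β β 1 =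
      Matrix.single β β 1 * Matrix.scalar (Fin d) S := by
  ext1 a b
  rw [scalar_mul_apply, mul_scalar_apply, Matrix.single_apply]
  split_ifs <;> simp

theorem isSphericalLaxTuple {q : FramedRep m α d}
    (hq : q ∈ FramedRep.sphericalCM (dunklLambda τ k)) :
    IsSphericalLaxTuple (laxL τ k q) (laxR τ k q) := by
  have hMN := dressM_mul_inv hq
  have hNM := inv_mul_dressM hq
  have hAd := degLE_dressA (τ := τ) (k := k) q
  have hBd := degLE_dressB (τ := τ) (k := k) q
  have hAs := scalar_eps_mul_dressA (τ := τ) (k := k) q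
  have hBs := scalar_eps_mul_dressB (τ := τ) (k := k) q
  have hMs : ∀ i, Matrix.scalar (Fin d) (eps m τ k i) * dressM τ k q =
      dressM τ k q * Matrix.scalar (Fin d) (eps m τ k i) := fun i => by
    rw [dressM_eq, mul_sub, sub_mul, hAs, mul_one, one_mul]
  have hNs : ∀ i, Matrix.scalar (Fin d) (eps m τ k i) * (1 + dressB τ k q) =
      (1 + dressB τ k q) * Matrix.scalar (Fin d) (eps m τ k i) := fun i => by
    rw [mul_add, add_mul, hBs, mul_one, one_mul]
  have hyB := (degLE_scalar_y (m := m) (τ := τ) (k := k) (ι := Fin d)).mul hBd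
  have hAy := hAd.mul (degLE_scalar_y (m := m) (τ := τ) (k := k) (ι := Fin d))
  have hAyB := hAd.mul hyB
  have hRd : ∀ β, DegLE (-1) (Matrix.single β β 1 * dressB τ k q -
      dressA τ k q * Matrix.single β β 1 -
        dressA τ k q * (Matrix.single β β 1 * dressB τ k q)) := fun β =>
    (((degLE_single_one β).mul hBd).sub (hAd.mul (degLE_single_one β))).sub
      ((hAd.mul ((degLE_single_one β).mul hBd)).mono (by norm_num))
  refine ⟨fun a b => ?_, fun β a b => ?_, fun β => ?_, fun β β' => ?_, ?_, fun a => ?_,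
    fun i => ?_, fun β i => ?_⟩
  · have h : ∀ n, 0 < n → (laxL τ k q a b).coeff n =
        (Matrix.scalar (Fin d) (y m τ k) a b).coeff n := fun n hn => by
      rw [laxL_expand hq, Matrix.sub_apply, Matrix.add_apply, Psd.coeff_sub, Psd.coeff_add,
        (hyB.sub hAy) a b n (by omega), hAyB a b n (by omega), add_zero, sub_zero]
    constructor
    · rw [h 1 one_pos, coeff_scalar_y]
      simp
    · intro n hn
      rw [h n (by omega), coeff_scalar_y, if_neg (by omega)]
  · have h : ∀ n, -1 < n → (laxR τ k q β a b).coeff n =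
        ((Matrix.single β β 1 : Mat m τ k d) a b).coeff n := fun n hn => by
      rw [laxR_expand hq, Matrix.add_apply, Psd.coeff_add, hRd β a b n hn, add_zero]
    constructor
    · rw [h 0 (by norm_num), Matrix.single_apply]
      by_cases h' : a = β ∧ b = β
      · rw [if_pos h', if_pos ⟨h'.1.symm, h'.2.symm⟩]
        rfl
      · rw [if_neg h', if_neg fun h'' => h' ⟨h''.1.symm, h''.2.symm⟩]
        rfl
    · intro n hn
      rw [h n (by omega)]
      exact degLE_single_one β a b n hn
  · rw [laxL_eq hq, laxR_eq hq]
    calc _ = dressM τ k q * Matrix.scalar (Fin d) (y m τ k) * ((1 + dressB τ k q) *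
          dressM τ k q) * Matrix.single β β 1 * (1 + dressB τ k q) := by simp only [mul_assoc]
      _ = dressM τ k q * Matrix.single β β 1 * ((1 + dressB τ k q) *
          dressM τ k q) * Matrix.scalar (Fin d) (y m τ k) * (1 + dressB τ k q) := by
        rw [hNM, mul_one, mul_one, mul_assoc (dressM τ k q), scalar_comm_single,
          ← mul_assoc (dressM τ k q)]
      _ = _ := by simp only [mul_assoc]
  · rw [laxR_eq hq, laxR_eq hq]
    calc _ = dressM τ k q * Matrix.single β β 1 * ((1 + dressB τ k q) *
          dressM τ k q) * Matrix.single β' β' 1 * (1 + dressB τ k q) := by simp only [mul_assoc]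
      _ = _ := by
        rw [hNM, mul_one, mul_assoc (dressM τ k q)]
        split_ifs with h
        · subst h
          rw [Matrix.single_mul_single_same, one_mul]
        · rw [Matrix.single_mul_single_of_ne _ _ _ _ h, mul_zero, zero_mul]
  · simp only [laxR_eq hq]
    rw [← Finset.sum_mul, ← Finset.mul_sum, Matrix.sum_single_one, mul_one, hMN]
    -- In degree `0` only `y B - A y` contributes to `L`; since `B - A = A B` has degree at most
    -- `-2`, its coefficient is `θ⁻¹ f - f` for one `f`, and `θ` fixes the component at `e`.
  · have hAB : ∀ n, -2 < n → (dressB τ k q a a).coeff n = (dressA τ k q a a).coeff n := by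
      intro n hn
      rw [← sub_eq_zero, ← Psd.coeff_sub, ← Matrix.sub_apply, dressB_sub_dressA hq]
      exact hAd.mul hBd a a n hn
    rw [laxL_expand hq, Matrix.sub_apply, Matrix.add_apply, Matrix.sub_apply, Psd.coeff_sub,
      Psd.coeff_add, Psd.coeff_sub, hAyB a a 0 (by norm_num), scalar_mul_apply, mul_scalar_apply,
      coeff_scalar_y, if_neg (by norm_num), DunklPsd.y, Psd.coeff_mul_y, Psd.y_mul, Psd.coeff_mulY,
      hBd a a 0 (by norm_num), map_zero, hAB _ (by norm_num), sub_zero, add_zero, zero_add,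
      SkewMonoidAlgebra.coeff_sub]
    change (thetaInv m _).coeff 1 - _ = 0
    rw [coeff_coeff_thetaInv_one, sub_self]
  · rw [laxL_eq hq, ← mul_assoc, ← mul_assoc, hMs, mul_assoc (dressM τ k q), scalar_eps_mul_y,
      mul_assoc, mul_assoc, hNs]
    simp only [mul_assoc]
  · rw [laxR_eq hq, ← mul_assoc, ← mul_assoc, hMs, mul_assoc (dressM τ k q), scalar_comm_single,
      mul_assoc, mul_assoc, hNs]
    simp only [mul_assoc]

end LaxTuple

/-! ### Differentiation of rational functions with respect to a parameter -/

section RatCalculus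

open Polynomial

/-- The family `p` of polynomials of bounded degree is coefficientwise differentiable at `t`, with
derivative `p'`. -/
def HasPolyDerivAt (p : ℂ → ℂ[X]) (p' : ℂ[X]) (t : ℂ) : Prop :=
  (∃ N : ℕ, ∀ s, (p s).natDegree ≤ N) ∧
    ∀ n, HasDerivAt (fun s => (p s).coeff n) (p'.coeff n) t

namespace HasPolyDerivAt

variable {p q : ℂ → ℂ[X]} {p' q' : ℂ[X]} {t : ℂ}

theorem const (p : ℂ[X]) : HasPolyDerivAt (fun _ => p) 0 t :=
  ⟨⟨_, fun _ => le_rfl⟩, fun n => by simpa using hasDerivAt_const t (p.coeff n)⟩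

theorem C {c : ℂ → ℂ} {c' : ℂ} (h : HasDerivAt c c' t) :
    HasPolyDerivAt (fun s => C (c s)) (Polynomial.C c') t := by
  refine ⟨⟨0, fun s => by simp⟩, fun n => ?_⟩
  simp only [coeff_C]
  split_ifs
  · exact h
  · exact hasDerivAt_const t 0

theorem add (hp : HasPolyDerivAt p p' t) (hq : HasPolyDerivAt q q' t) :
    HasPolyDerivAt (fun s => p s + q s) (p' + q') t := by
  obtain ⟨N, hN⟩ := hp.1
  obtain ⟨K, hK⟩ := hq.1
  refine ⟨⟨max N K, fun s => (natDegree_add_le _ _).trans (max_le_max (hN s) (hK s))⟩,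
    fun n => ?_⟩
  simpa only [coeff_add] using (hp.2 n).fun_add (hq.2 n)

theorem neg (hp : HasPolyDerivAt p p' t) : HasPolyDerivAt (fun s => -p s) (-p') t := by
  obtain ⟨N, hN⟩ := hp.1
  refine ⟨⟨N, fun s => by rw [natDegree_neg]; exact hN s⟩, fun n => ?_⟩
  simpa only [coeff_neg] using (hp.2 n).fun_neg

theorem sub (hp : HasPolyDerivAt p p' t) (hq : HasPolyDerivAt q q' t) :
    HasPolyDerivAt (fun s => p s - q s) (p' - q') t := by
  simpa only [sub_eq_add_neg] using hp.add hq.neg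

theorem mul (hp : HasPolyDerivAt p p' t) (hq : HasPolyDerivAt q q' t) :
    HasPolyDerivAt (fun s => p s * q s) (p' * q t + p t * q') t := by
  obtain ⟨N, hN⟩ := hp.1
  obtain ⟨K, hK⟩ := hq.1
  refine ⟨⟨N + K, fun s => natDegree_mul_le.trans (add_le_add (hN s) (hK s))⟩, fun n => ?_⟩
  simp only [coeff_add, coeff_mul, ← Finset.sum_add_distrib]
  exact HasDerivAt.fun_sum fun i _ => (hp.2 i.1).mul (hq.2 i.2)

theorem derivative (hp : HasPolyDerivAt p p' t) :
    HasPolyDerivAt (fun s => Polynomial.derivative (p s)) (Polynomial.derivative p') t := by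
  obtain ⟨N, hN⟩ := hp.1
  refine ⟨⟨N, fun s => (natDegree_derivative_le _).trans ((Nat.sub_le _ _).trans (hN s))⟩,
    fun n => ?_⟩
  simp only [coeff_derivative]
  exact (hp.2 (n + 1)).mul_const _

theorem comp_C_mul_X (hp : HasPolyDerivAt p p' t) (c : ℂ) :
    HasPolyDerivAt (fun s => (p s).comp (Polynomial.C c * X)) (p'.comp (Polynomial.C c * X)) t := by
  obtain ⟨N, hN⟩ := hp.1
  refine ⟨⟨N * 1, fun s => natDegree_comp_le.trans (mul_le_mul (hN s)
    ((natDegree_C_mul_le c X).trans natDegree_X_le) (Nat.zero_le _) (Nat.zero_le _))⟩, fun n => ?_⟩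
  simp only [comp_C_mul_X_coeff]
  exact (hp.2 n).mul_const _

theorem eventually_ne (hp : HasPolyDerivAt p p' t) (h : p t ≠ 0) : ∀ᶠ s in 𝓝 t, p s ≠ 0 := by
  obtain ⟨n, hn⟩ : ∃ n, (p t).coeff n ≠ 0 := by
    by_contra! h'
    exact h (Polynomial.ext h')
  filter_upwards [(hp.2 n).continuousAt.eventually_ne hn] with s hs h0
  rw [h0] at hs
  exact hs (coeff_zero n)

theorem unique {r : ℂ → ℂ[X]} {r' : ℂ[X]} (hp : HasPolyDerivAt p p' t)
    (hr : HasPolyDerivAt r r' t) (h : ∀ᶠ s in 𝓝 t, p s = r s) : p' = r' := by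
  ext n
  refine ((hp.2 n).congr_of_eventuallyEq ?_).unique (hr.2 n)
  filter_upwards [h] with s hs
  rw [hs]

end HasPolyDerivAt

theorem hasRatDerivAt_iff {f : ℂ → RatFunc ℂ} {f' : RatFunc ℂ} {t : ℂ} :
    HasRatDerivAt f f' t ↔ ∃ (p q : ℂ → ℂ[X]) (p' q' : ℂ[X]), HasPolyDerivAt p p' t ∧
      HasPolyDerivAt q q' t ∧ q t ≠ 0 ∧
      (∀ᶠ s in 𝓝 t, f s = algebraMap _ (RatFunc ℂ) (p s) / algebraMap _ (RatFunc ℂ) (q s)) ∧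
      f' = algebraMap _ (RatFunc ℂ) (p' * q t - p t * q') /
        algebraMap _ (RatFunc ℂ) (q t ^ 2) := by
  constructor
  · rintro ⟨N, p, q, p', q', hN, hp, hq, h0, h, h'⟩
    exact ⟨p, q, p', q', ⟨⟨N, fun s => (hN s).1⟩, hp⟩, ⟨⟨N, fun s => (hN s).2⟩, hq⟩, h0, h, h'⟩
  · rintro ⟨p, q, p', q', ⟨⟨N, hN⟩, hp⟩, ⟨⟨K, hK⟩, hq⟩, h0, h, h'⟩
    exact ⟨max N K, p, q, p', q', fun s => ⟨(hN s).trans (le_max_left _ _),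
      (hK s).trans (le_max_right _ _)⟩, hp, hq, h0, h, h'⟩

namespace HasRatDerivAt

variable {f g : ℂ → RatFunc ℂ} {f' g' : RatFunc ℂ} {t : ℂ}

theorem congr (hf : HasRatDerivAt f f' t) (h : ∀ᶠ s in 𝓝 t, g s = f s) :
    HasRatDerivAt g f' t := by
  obtain ⟨N, p, q, p', q', hN, hp, hq, h0, h1, h'⟩ := hf
  exact ⟨N, p, q, p', q', hN, hp, hq, h0, by
    filter_upwards [h, h1] with s hs hs'
    rw [hs, hs'], h'⟩

/-- The derivative does not depend on the representation as a quotient of polynomials. -/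
theorem unique (hf : HasRatDerivAt f f' t) (hg : HasRatDerivAt g g' t)
    (h : ∀ᶠ s in 𝓝 t, f s = g s) : f' = g' := by
  obtain ⟨p, q, p', q', hp, hq, hq0, hf1, rfl⟩ := hasRatDerivAt_iff.1 hf
  obtain ⟨r, u, r', u', hr, hu, hu0, hg1, rfl⟩ := hasRatDerivAt_iff.1 hg
  have h1 : ∀ᶠ s in 𝓝 t, p s * u s = r s * q s := by
    filter_upwards [h, hf1, hg1, hq.eventually_ne hq0, hu.eventually_ne hu0] with s h1 h2 h3 h4 h5
    rw [h2, h3, div_eq_div_iff (ratMap_ne_zero h4) (ratMap_ne_zero h5), ← map_mul, ← map_mul] at h1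
    exact RatFunc.algebraMap_injective ℂ h1
  exact quot_rule_aux _ _ _ _ _ _ _ _ _ (ratMap_ne_zero hq0) (ratMap_ne_zero hu0)
    h1.self_of_nhds ((hp.mul hu).unique (hr.mul hq) h1)

theorem const (f : RatFunc ℂ) : HasRatDerivAt (fun _ => f) 0 t :=
  hasRatDerivAt_iff.2 ⟨_, _, _, _, .const f.num, .const f.denom, RatFunc.denom_ne_zero f,
    .of_forall fun _ => (RatFunc.num_div_denom f).symm, by simp⟩

theorem C {c : ℂ → ℂ} {c' : ℂ} (h : HasDerivAt c c' t) :
    HasRatDerivAt (fun s => RatFunc.C (c s)) (RatFunc.C c') t :=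
  hasRatDerivAt_iff.2 ⟨_, _, _, _, .C h, .const 1, one_ne_zero,
    .of_forall fun _ => by simp, by simp⟩

theorem add (hf : HasRatDerivAt f f' t) (hg : HasRatDerivAt g g' t) :
    HasRatDerivAt (fun s => f s + g s) (f' + g') t := by
  obtain ⟨p, q, p', q', hp, hq, hq0, hf1, rfl⟩ := hasRatDerivAt_iff.1 hf
  obtain ⟨r, u, r', u', hr, hu, hu0, hg1, rfl⟩ := hasRatDerivAt_iff.1 hg
  refine hasRatDerivAt_iff.2 ⟨_, _, _, _, (hp.mul hu).add (hq.mul hr), hq.mul hu,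
    mul_ne_zero hq0 hu0, ?_,
    (quot_rule_add _ _ _ _ _ _ _ _ _ (ratMap_ne_zero hq0) (ratMap_ne_zero hu0)).symm⟩
  filter_upwards [hf1, hg1, hq.eventually_ne hq0, hu.eventually_ne hu0] with s h1 h2 h3 h4
  rw [h1, h2, div_add_div _ _ (ratMap_ne_zero h3) (ratMap_ne_zero h4)]
  simp only [map_add, map_mul]

theorem mul (hf : HasRatDerivAt f f' t) (hg : HasRatDerivAt g g' t) :
    HasRatDerivAt (fun s => f s * g s) (f' * g t + f t * g') t := by
  obtain ⟨p, q, p', q', hp, hq, hq0, hf1, rfl⟩ := hasRatDerivAt_iff.1 hf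
  obtain ⟨r, u, r', u', hr, hu, hu0, hg1, rfl⟩ := hasRatDerivAt_iff.1 hg
  refine hasRatDerivAt_iff.2 ⟨_, _, _, _, hp.mul hr, hq.mul hu, mul_ne_zero hq0 hu0, ?_, ?_⟩
  · filter_upwards [hf1, hg1] with s h1 h2
    rw [h1, h2, div_mul_div_comm, ← map_mul, ← map_mul]
  · rw [hf1.self_of_nhds, hg1.self_of_nhds,
      quot_rule_mul _ _ _ _ _ _ _ _ _ (ratMap_ne_zero hq0) (ratMap_ne_zero hu0), add_comm]

theorem neg (hf : HasRatDerivAt f f' t) : HasRatDerivAt (fun s => -f s) (-f') t := by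
  simpa using (const (t := t) (-1)).mul hf

theorem sub (hf : HasRatDerivAt f f' t) (hg : HasRatDerivAt g g' t) :
    HasRatDerivAt (fun s => f s - g s) (f' - g') t := by
  simpa only [sub_eq_add_neg] using hf.add hg.neg

theorem sum {ι : Type*} (s : Finset ι) {F : ι → ℂ → RatFunc ℂ} {F' : ι → RatFunc ℂ}
    (h : ∀ i ∈ s, HasRatDerivAt (F i) (F' i) t) :
    HasRatDerivAt (fun u => ∑ i ∈ s, F i u) (∑ i ∈ s, F' i) t := by
  classical
  induction s using Finset.induction_on with
  | empty => simpa using const (t := t) 0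
  | insert a s ha ih =>
    simp only [Finset.sum_insert ha]
    exact (h a (Finset.mem_insert_self a s)).add
      (ih fun i hi => h i (Finset.mem_insert_of_mem hi))

theorem exists_prod {ι : Type*} (s : Finset ι) {F : ι → ℂ → RatFunc ℂ}
    (h : ∀ i ∈ s, ∃ f', HasRatDerivAt (F i) f' t) :
    ∃ f', HasRatDerivAt (fun u => ∏ i ∈ s, F i u) f' t := by
  classical
  induction s using Finset.induction_on with
  | empty => exact ⟨0, by simpa using const (t := t) 1⟩
  | insert a s ha ih =>
    obtain ⟨f', hf⟩ := h a (Finset.mem_insert_self a s)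
    obtain ⟨g', hg⟩ := ih fun i hi => h i (Finset.mem_insert_of_mem hi)
    simp only [Finset.prod_insert ha]
    exact ⟨_, hf.mul hg⟩

theorem exists_inv (hf : HasRatDerivAt f f' t) (h0 : f t ≠ 0) :
    ∃ g', HasRatDerivAt (fun s => (f s)⁻¹) g' t := by
  obtain ⟨p, q, p', q', hp, hq, hq0, hf1, rfl⟩ := hasRatDerivAt_iff.1 hf
  have hp0 : p t ≠ 0 := by
    rintro h
    rw [hf1.self_of_nhds, h, map_zero, zero_div] at h0
    exact h0 rfl
  refine ⟨_, hasRatDerivAt_iff.2 ⟨_, _, _, _, hq, hp, hp0, ?_, rfl⟩⟩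
  filter_upwards [hf1] with s h1
  rw [h1, inv_div]

theorem exists_det {ι : Type*} [Fintype ι] [DecidableEq ι] {A : ℂ → Matrix ι ι (RatFunc ℂ)}
    (h : ∀ a b, ∃ f', HasRatDerivAt (fun s => A s a b) f' t) :
    ∃ f', HasRatDerivAt (fun s => (A s).det) f' t := by
  simp only [Matrix.det_apply']
  choose F hF using fun σ : Equiv.Perm ι =>
    exists_prod (t := t) Finset.univ (F := fun i s => A s (σ i) i) fun i _ => h (σ i) i
  exact ⟨_, sum _ fun σ _ => (const _).mul (hF σ)⟩

/-- By Cramer's rule, the inverse of a differentiable family of matrices is differentiable. -/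
theorem exists_matrix_inv {ι : Type*} [Fintype ι] [DecidableEq ι]
    {A : ℂ → Matrix ι ι (RatFunc ℂ)} (h : ∀ a b, ∃ f', HasRatDerivAt (fun s => A s a b) f' t)
    (h0 : (A t).det ≠ 0) (a b : ι) : ∃ f', HasRatDerivAt (fun s => (A s)⁻¹ a b) f' t := by
  obtain ⟨D, hD⟩ := exists_det h
  obtain ⟨D', hD'⟩ := hD.exists_inv h0
  have hadj : ∃ f', HasRatDerivAt (fun s => (A s).adjugate a b) f' t := by
    simp only [Matrix.adjugate_apply]
    refine exists_det fun i j => ?_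
    by_cases hi : i = b
    · subst hi
      simp only [Matrix.updateRow_self]
      exact ⟨0, const _⟩
    · simp only [Matrix.updateRow_ne hi]
      exact h i j
  obtain ⟨f', hf'⟩ := hadj
  simp only [Matrix.inv_def, Ring.inverse_eq_inv', Matrix.smul_apply, smul_eq_mul]
  exact ⟨_, hD'.mul hf'⟩

theorem scale (hf : HasRatDerivAt f f' t) (c : ℂˣ) :
    HasRatDerivAt (fun s => ratScale c (f s)) (ratScale c f') t := by
  obtain ⟨p, q, p', q', hp, hq, hq0, hf1, rfl⟩ := hasRatDerivAt_iff.1 hf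
  have h0 : (q t).comp (Polynomial.C (c : ℂ) * X) ≠ 0 := by
    intro h
    have h1 := ratScale_div c (q t) 1
    rw [h, map_zero, zero_div, map_one, div_one, map_eq_zero] at h1
    exact ratMap_ne_zero hq0 h1
  refine hasRatDerivAt_iff.2 ⟨_, _, _, _, hp.comp_C_mul_X c, hq.comp_C_mul_X c, h0, ?_, ?_⟩
  · filter_upwards [hf1] with s h1
    rw [h1, ratScale_div]
  · rw [ratScale_div]
    simp only [sub_comp, mul_comp, pow_comp]

theorem ratDeriv (hf : HasRatDerivAt f f' t) :
    HasRatDerivAt (fun s => _root_.ratDeriv (f s)) (_root_.ratDeriv f') t := by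
  obtain ⟨p, q, p', q', hp, hq, hq0, hf1, rfl⟩ := hasRatDerivAt_iff.1 hf
  refine hasRatDerivAt_iff.2 ⟨_, _, _, _, (hp.derivative.mul hq).sub (hp.mul hq.derivative),
    hq.mul hq, mul_ne_zero hq0 hq0, ?_, ?_⟩
  · filter_upwards [hf1, hq.eventually_ne hq0] with s h1 h2
    rw [h1, ratDeriv_div _ _ h2, pow_two]
  · have h2 : q t ^ 2 ≠ 0 := pow_ne_zero 2 hq0
    have h3 := ratDeriv_div (p' * q t - p t * q') (q t ^ 2) h2
    refine h3.trans (congrArg₂ (· / ·) (congrArg _ ?_) (congrArg _ ?_))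
    · simp only [derivative_sub, derivative_mul, pow_two]
      ring
    · ring

end HasRatDerivAt

end RatCalculus

/-! ### Differentiation in the crossed product and in the ring of formal series -/

section CrossedCalculus

variable {m : ℕ} {t : ℂ}

/-- The family `f` in `ℂ(x) * Γ` is coefficientwise differentiable at `t`, with derivative `f'`. -/
def HasCrossedDerivAt (f : ℂ → CrossedRat m) (f' : CrossedRat m) (t : ℂ) : Prop :=
  ∀ γ, HasRatDerivAt (fun s => (f s).coeff γ) (f'.coeff γ) t

namespace HasCrossedDerivAt

variable {f g : ℂ → CrossedRat m} {f' g' : CrossedRat m}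

theorem unique (hf : HasCrossedDerivAt f f' t) (hg : HasCrossedDerivAt g g' t)
    (h : ∀ᶠ s in 𝓝 t, f s = g s) : f' = g' := by
  refine SkewMonoidAlgebra.ext fun γ => (hf γ).unique (hg γ) ?_
  filter_upwards [h] with s hs
  rw [hs]

theorem const (f : CrossedRat m) : HasCrossedDerivAt (fun _ => f) 0 t :=
  fun _ => .const _

theorem add (hf : HasCrossedDerivAt f f' t) (hg : HasCrossedDerivAt g g' t) :
    HasCrossedDerivAt (fun s => f s + g s) (f' + g') t := fun γ => by
  simpa only [SkewMonoidAlgebra.coeff_add, Finsupp.add_apply] using (hf γ).add (hg γ)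

theorem sub (hf : HasCrossedDerivAt f f' t) (hg : HasCrossedDerivAt g g' t) :
    HasCrossedDerivAt (fun s => f s - g s) (f' - g') t := fun γ => by
  simpa only [SkewMonoidAlgebra.coeff_sub, Finsupp.sub_apply] using (hf γ).sub (hg γ)

theorem neg (hf : HasCrossedDerivAt f f' t) : HasCrossedDerivAt (fun s => -f s) (-f') t := by
  simpa only [zero_sub] using (const (t := t) 0).sub hf

theorem sum {ι : Type*} (s : Finset ι) {F : ι → ℂ → CrossedRat m} {F' : ι → CrossedRat m}
    (h : ∀ i ∈ s, HasCrossedDerivAt (F i) (F' i) t) :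
    HasCrossedDerivAt (fun u => ∑ i ∈ s, F i u) (∑ i ∈ s, F' i) t := by
  classical
  induction s using Finset.induction_on with
  | empty => simpa using const (t := t) 0
  | insert a s ha ih =>
    simp only [Finset.sum_insert ha]
    exact (h a (Finset.mem_insert_self a s)).add
      (ih fun i hi => h i (Finset.mem_insert_of_mem hi))

theorem ofRat {f : ℂ → RatFunc ℂ} {f' : RatFunc ℂ} (hf : HasRatDerivAt f f' t) :
    HasCrossedDerivAt (fun s => ofRat m (f s)) (CrossedRat.ofRat m f') t := fun γ => by
  simp only [ofRat_apply, SkewMonoidAlgebra.coeff_single]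
  by_cases h : γ = 1
  · subst h
    simpa only [Finsupp.single_eq_same] using hf
  · simpa only [Finsupp.single_eq_of_ne h] using HasRatDerivAt.const (t := t) 0

theorem twist (hf : HasCrossedDerivAt f f' t) (ψ : CycGroup m →* ℂˣ) :
    HasCrossedDerivAt (fun s => CrossedRat.twist m ψ (f s)) (CrossedRat.twist m ψ f') t :=
  fun γ => by
  simpa [coeff_twist] using (hf γ).mul (.const (RatFunc.C (ψ γ : ℂ)))

theorem deriv (hf : HasCrossedDerivAt f f' t) :
    HasCrossedDerivAt (fun s => CrossedRat.deriv m (f s)) (CrossedRat.deriv m f') t := fun γ => by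
  simpa only [coeff_deriv] using (hf γ).ratDeriv

theorem mul [NeZero m] (hf : HasCrossedDerivAt f f' t) (hg : HasCrossedDerivAt g g' t) :
    HasCrossedDerivAt (fun s => f s * g s) (f' * g t + f t * g') t := fun γ => by
  simp only [SkewMonoidAlgebra.coeff_add, Finsupp.add_apply, coeff_crossed_mul,
    ← Finset.sum_add_distrib]
  exact .sum _ fun η _ => (hf η).mul ((hg (η⁻¹ * γ)).scale _)

theorem dunklD [NeZero m] (hf : HasCrossedDerivAt f f' t) (τ : ℂ) (k : ZMod m → ℂ) :
    HasCrossedDerivAt (fun s => CrossedRat.dunklD m τ k (f s)) (CrossedRat.dunklD m τ k f') t := by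
  simp only [dunklD_apply]
  have hK := const (t := t) (dunklElt m k)
  simpa using ((const (t := t) (CrossedRat.ofRat m (RatFunc.C τ))).mul hf.deriv).sub
    ((const (t := t) (CrossedRat.ofRat m RatFunc.X⁻¹)).mul ((hK.mul hf).sub (hf.mul hK)))

end HasCrossedDerivAt

end CrossedCalculus

section PsdCalculus

open Psd

variable {m : ℕ} [NeZero m] {τ : ℂ} {k : ZMod m → ℂ} {t : ℂ}

/-- The family `S` in `𝒫` is coefficientwise differentiable at `t`, with derivative `S'`, and the
powers of `y` that occur are bounded above uniformly in the parameter. The bound makes every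
coefficient of a product a finite sum with a fixed number of terms. -/
def HasBddDerivAt (S : ℂ → DunklPsd m τ k) (S' : DunklPsd m τ k) (t : ℂ) : Prop :=
  (∃ N : ℤ, ∀ n, N < n → (∀ s, (S s).coeff n = 0) ∧ S'.coeff n = 0) ∧
    ∀ n, HasCrossedDerivAt (fun s => (S s).coeff n) (S'.coeff n) t

namespace HasBddDerivAt

variable {S T : ℂ → DunklPsd m τ k} {S' T' : DunklPsd m τ k}

theorem unique (hS : HasBddDerivAt S S' t) (hT : HasBddDerivAt T T' t)
    (h : ∀ᶠ s in 𝓝 t, S s = T s) : S' = T' := by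
  refine Psd.ext fun n => (hS.2 n).unique (hT.2 n) ?_
  filter_upwards [h] with s hs
  rw [hs]

theorem const (S : DunklPsd m τ k) : HasBddDerivAt (fun _ => S) 0 t := by
  obtain ⟨N, hN⟩ := S.exists_bound
  exact ⟨⟨N, fun n hn => ⟨fun _ => hN n hn, rfl⟩⟩, fun n => .const _⟩

theorem add (hS : HasBddDerivAt S S' t) (hT : HasBddDerivAt T T' t) :
    HasBddDerivAt (fun s => S s + T s) (S' + T') t := by
  obtain ⟨⟨N, hN⟩, hS⟩ := hS
  obtain ⟨⟨K, hK⟩, hT⟩ := hT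
  refine ⟨⟨max N K, fun n hn => ⟨fun s => ?_, ?_⟩⟩, fun n => (hS n).add (hT n)⟩
  · rw [coeff_add, (hN n (by omega)).1, (hK n (by omega)).1, add_zero]
  · rw [coeff_add, (hN n (by omega)).2, (hK n (by omega)).2, add_zero]

theorem neg (hS : HasBddDerivAt S S' t) : HasBddDerivAt (fun s => -S s) (-S') t := by
  obtain ⟨⟨N, hN⟩, hS⟩ := hS
  refine ⟨⟨N, fun n hn => ⟨fun s => ?_, ?_⟩⟩, fun n => (hS n).neg⟩
  · rw [coeff_neg, (hN n hn).1, neg_zero]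
  · rw [coeff_neg, (hN n hn).2, neg_zero]

theorem sum {ι : Type*} (s : Finset ι) {F : ι → ℂ → DunklPsd m τ k} {F' : ι → DunklPsd m τ k}
    (h : ∀ i ∈ s, HasBddDerivAt (F i) (F' i) t) :
    HasBddDerivAt (fun u => ∑ i ∈ s, F i u) (∑ i ∈ s, F' i) t := by
  classical
  induction s using Finset.induction_on with
  | empty => simpa using const (t := t) 0
  | insert a s ha ih =>
    simp only [Finset.sum_insert ha]
    exact (h a (Finset.mem_insert_self a s)).add
      (ih fun i hi => h i (Finset.mem_insert_of_mem hi))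

theorem kap_iter {f : ℂ → CrossedRat m} {f' : CrossedRat m} (hf : HasCrossedDerivAt f f' t)
    (p : ℕ) : HasCrossedDerivAt (fun s => (kap (dunklDatum m τ k))^[p] (f s))
      ((kap (dunklDatum m τ k))^[p] f') t := by
  induction p generalizing f f' with
  | zero => exact hf
  | succ p ih =>
    simp only [Function.iterate_succ_apply, kap_apply]
    exact ih ((hf.dunklD τ k).twist (toUnit m)).neg

theorem mulY (hS : HasBddDerivAt S S' t) :
    HasBddDerivAt (fun s => Psd.mulY (S s)) (Psd.mulY S') t := by
  obtain ⟨⟨N, hN⟩, hS⟩ := hS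
  refine ⟨⟨N + 1, fun n hn => ⟨fun s => ?_, ?_⟩⟩, fun n => ?_⟩
  · rw [coeff_mulY, (hN n (by omega)).1, (hN (n - 1) (by omega)).1, map_zero, map_zero, add_zero]
  · rw [coeff_mulY, (hN n (by omega)).2, (hN (n - 1) (by omega)).2, map_zero, map_zero, add_zero]
  · exact ((hS (n - 1)).twist (toUnit m)⁻¹).add ((hS n).dunklD τ k)

theorem mulInvY (hS : HasBddDerivAt S S' t) :
    HasBddDerivAt (fun s => Psd.mulInvY (S s)) (Psd.mulInvY S') t := by
  obtain ⟨⟨N, hN⟩, hS⟩ := hS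
  refine ⟨⟨N, fun n hn => ⟨fun s => ?_, ?_⟩⟩, fun n => ?_⟩
  · rw [coeff_mulInvY, invYCoeff_eq_sum _ n 0 fun p _ => (hN _ (by omega)).1 s]
    simp
  · rw [coeff_mulInvY, invYCoeff_eq_sum _ n 0 fun p _ => (hN _ (by omega)).2]
    simp
  · have h1 : ∀ s, (Psd.mulInvY (S s)).coeff n = _ := fun s =>
      invYCoeff_eq_sum (S s) n (N - n).toNat fun p hp => (hN _ (by omega)).1 s
    have h2 : (Psd.mulInvY S').coeff n = _ :=
      invYCoeff_eq_sum S' n (N - n).toNat fun p hp => (hN _ (by omega)).2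
    simp only [h1, h2]
    exact .sum _ fun p _ => kap_iter ((hS _).twist (toUnit m)) p

theorem ypow (hS : HasBddDerivAt S S' t) (i : ℤ) :
    HasBddDerivAt (fun s => Psd.ypow i (S s)) (Psd.ypow i S') t := by
  induction i using Int.induction_on with
  | zero => simpa only [ypow_zero] using hS
  | succ i ih => simpa only [ypow_add_one] using ih.mulY
  | pred i ih => simpa only [ypow_sub_one] using ih.mulInvY

theorem mul (hS : HasBddDerivAt S S' t) (hT : HasBddDerivAt T T' t) :
    HasBddDerivAt (fun s => S s * T s) (S' * T t + S t * T') t := by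
  obtain ⟨⟨N, hN⟩, hS⟩ := hS
  have hT0 := hT
  obtain ⟨⟨K, hK⟩, hT⟩ := hT
  refine ⟨⟨K + N, fun n hn => ⟨fun s => ?_, ?_⟩⟩, fun n => ?_⟩
  · exact coeff_mul_bound _ _ (fun n hn => (hN n hn).1 s) (fun n hn => (hK n hn).1 s) n hn
  · rw [coeff_add, coeff_mul_bound _ _ (fun n hn => (hN n hn).2) (fun n hn => (hK n hn).1 t) n hn,
      coeff_mul_bound _ _ (fun n hn => (hN n hn).1 t) (fun n hn => (hK n hn).2) n hn, add_zero]
  · have h1 : ∀ s, (S s * T s).coeff n = _ := fun s => coeff_mul_eq_sum (S s) (T s)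
      (fun n hn => (hN n hn).1 s) (fun n hn => (hK n hn).1 s) n (n - K) N le_rfl le_rfl
    have h2 : (S' * T t).coeff n = _ := coeff_mul_eq_sum S' (T t)
      (fun n hn => (hN n hn).2) (fun n hn => (hK n hn).1 t) n (n - K) N le_rfl le_rfl
    have h3 : (S t * T').coeff n = _ := coeff_mul_eq_sum (S t) T'
      (fun n hn => (hN n hn).1 t) (fun n hn => (hK n hn).2) n (n - K) N le_rfl le_rfl
    simp only [h1, coeff_add, h2, h3, ← Finset.sum_add_distrib]
    exact .sum _ fun i _ => (hS i).mul ((hT0.ypow i).2 n)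

theorem ofCrossed {f : ℂ → CrossedRat m} {f' : CrossedRat m} (hf : HasCrossedDerivAt f f' t) :
    HasBddDerivAt (fun s => ofCrossed m τ k (f s)) (DunklPsd.ofCrossed m τ k f') t := by
  refine ⟨⟨0, fun n hn => ⟨fun s => ?_, ?_⟩⟩, fun n => ?_⟩
  · rw [DunklPsd.ofCrossed, coeff_const, if_neg (by omega)]
  · rw [DunklPsd.ofCrossed, coeff_const, if_neg (by omega)]
  · simp only [DunklPsd.ofCrossed, coeff_const]
    split_ifs
    · exact hf
    · exact .const 0

theorem ofComplex {c : ℂ → ℂ} {c' : ℂ} (h : HasDerivAt c c' t) :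
    HasBddDerivAt (fun s => ofComplex m τ k (c s)) (DunklPsd.ofComplex m τ k c') t :=
  ofCrossed (.ofRat (.C h))

end HasBddDerivAt

/-- The family `A` of matrices over `𝒫` is differentiable at `t`, with derivative `A'`, entry by
entry in the sense of `HasBddDerivAt`. -/
def HasMatBddDerivAt {ι κ : Type*} (A : ℂ → Matrix ι κ (DunklPsd m τ k))
    (A' : Matrix ι κ (DunklPsd m τ k)) (t : ℂ) : Prop :=
  ∀ a b, HasBddDerivAt (fun s => A s a b) (A' a b) t

namespace HasMatBddDerivAt

variable {ι κ η : Type*} {A : ℂ → Matrix ι κ (DunklPsd m τ k)}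
  {A' : Matrix ι κ (DunklPsd m τ k)}

theorem const (A : Matrix ι κ (DunklPsd m τ k)) : HasMatBddDerivAt (fun _ => A) 0 t :=
  fun _ _ => .const _

theorem add {B : ℂ → Matrix ι κ (DunklPsd m τ k)} {B' : Matrix ι κ (DunklPsd m τ k)}
    (hA : HasMatBddDerivAt A A' t) (hB : HasMatBddDerivAt B B' t) :
    HasMatBddDerivAt (fun s => A s + B s) (A' + B') t :=
  fun a b => (hA a b).add (hB a b)

theorem neg (hA : HasMatBddDerivAt A A' t) : HasMatBddDerivAt (fun s => -A s) (-A') t :=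
  fun a b => (hA a b).neg

theorem sub {B : ℂ → Matrix ι κ (DunklPsd m τ k)} {B' : Matrix ι κ (DunklPsd m τ k)}
    (hA : HasMatBddDerivAt A A' t) (hB : HasMatBddDerivAt B B' t) :
    HasMatBddDerivAt (fun s => A s - B s) (A' - B') t := by
  simpa only [sub_eq_add_neg] using hA.add hB.neg

theorem mul [Fintype κ] {B : ℂ → Matrix κ η (DunklPsd m τ k)}
    {B' : Matrix κ η (DunklPsd m τ k)} (hA : HasMatBddDerivAt A A' t)
    (hB : HasMatBddDerivAt B B' t) :
    HasMatBddDerivAt (fun s => A s * B s) (A' * B t + A t * B') t := fun a b => by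
  simp only [Matrix.mul_apply, Matrix.add_apply, ← Finset.sum_add_distrib]
  exact .sum _ fun c _ => (hA a c).mul (hB c b)

theorem map_ofComplex {A : ℂ → Matrix ι κ ℂ} {A' : Matrix ι κ ℂ} (hA : HasMatDerivAt A A' t) :
    HasMatBddDerivAt (fun s => (A s).map (ofComplex m τ k)) (A'.map (ofComplex m τ k)) t :=
  fun a b => .ofComplex (hA a b)

/-- The derivative of an inverse, once the inverse is known to be differentiable. -/
theorem inv_eq [Fintype ι] [DecidableEq ι] {A B : ℂ → Matrix ι ι (DunklPsd m τ k)}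
    {A' B' : Matrix ι ι (DunklPsd m τ k)} (hA : HasMatBddDerivAt A A' t)
    (hB : HasMatBddDerivAt B B' t) (h : ∀ᶠ s in 𝓝 t, A s * B s = 1) (h' : B t * A t = 1) :
    B' = -(B t * A' * B t) := by
  have h1 : A' * B t + A t * B' = 0 := by
    ext1 a b
    refine ((hA.mul hB) a b).unique ((const (t := t) 1) a b) ?_
    filter_upwards [h] with s hs
    rw [hs]
  have h2 := congrArg (B t * ·) h1
  simp only [mul_add, ← mul_assoc, h', one_mul, mul_zero] at h2
  exact eq_neg_of_add_eq_zero_right h2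

/-- The condition used for matrices over `𝒫` in the hierarchy. -/
theorem hasPsdDerivAt {d : ℕ} {A B : ℂ → Mat m τ k d} {A' : Mat m τ k d}
    (hA : HasMatBddDerivAt A A' t) (h : ∀ᶠ s in 𝓝 t, B s = A s) : HasPsdDerivAt B A' t :=
  fun a b n γ => ((hA a b).2 n γ).congr (by
    filter_upwards [h] with s hs
    rw [hs])

end HasMatBddDerivAt

end PsdCalculus

/-! ### Evolution of the dressing operator -/

section DressFlow

variable {P n d : Type*} [Ring P] [Fintype n] [DecidableEq n] [Fintype d] [DecidableEq d]

/-- The sum `∑_{a + b = r - 1} Y^a y^b`, the quotient `(Y^r - y^r) / (Y - y)`. -/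
def divDiff {R : Type*} [Ring R] (Y y : R) (r : ℕ) : R :=
  ∑ a ∈ Finset.range r, Y ^ a * y ^ (r - 1 - a)

/-- If the dressing operator `M = 1 - w X⁻¹ Y⁻¹ v`, with `Y = Yc - yn`, is differentiated along the
flow, the result is `D M - M (E y^r)`, where the operator `D` is explicit and involves neither
inverses of `Y` nor negative powers of `y`. -/
theorem dress_flow {X Xi Yi Yc yn : Matrix n n P} {v : Matrix n d P} {w : Matrix d n P}
    {yd E : Matrix d d P} {N : ℕ → Matrix n n P} (hX : X * Xi = 1) (hX' : Xi * X = 1)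
    (hY : (Yc - yn) * Yi = 1) (hY' : Yi * (Yc - yn) = 1) (hc : Commute Yc yn)
    (h : ((Yc - yn) * X - X * (Yc - yn)) * (Xi * (Yi * v)) = v * (w * (Xi * (Yi * v))))
    (r : ℕ) (hv : v * (E * yd ^ r) = yn ^ r * (v * E)) (hw : w * yn ^ r = yd ^ r * w)
    (hN : ∀ b, yn ^ b * (v * (E * w)) = N b * yn ^ b) :
    -(E * (w * (Yc ^ r * (Xi * (Yi * v)))) +
        w * (Xi * ∑ a ∈ Finset.range r,
          Yc ^ a * (N (r - 1 - a) * (Yc ^ (r - 1 - a) * (Xi * (Yi * v))))) -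
        w * (Xi * (Yi * (Yc ^ r * (v * E))))) =
      (E * yd ^ r + w * (Xi * (divDiff Yc yn r * (v * E))) -
        E * (w * (divDiff Yc yn r * (Xi * v))) -
        w * (Xi * ∑ a ∈ Finset.range r,
          Yc ^ a * (N (r - 1 - a) * (divDiff Yc yn (r - 1 - a) * (Xi * v))))) *
        (1 - w * (Xi * (Yi * v))) -
      (1 - w * (Xi * (Yi * v))) * (E * yd ^ r) := by
  have hS : ∀ r, divDiff Yc yn r * (Yc - yn) = Yc ^ r - yn ^ r := fun r => hc.geom_sum₂_mul r
  have hS' : divDiff Yc yn r = Yi * Yc ^ r - Yi * yn ^ r := by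
    have : (Yc - yn) * divDiff Yc yn r = Yc ^ r - yn ^ r := hc.mul_geom_sum₂ r
    rw [← Matrix.mul_sub, ← this, ← Matrix.mul_assoc, hY', Matrix.one_mul]
  have hkey : (Yc - yn) * (Xi * (Yi * v)) = Xi * (v * (1 - w * (Xi * (Yi * v)))) :=
    mul_inv_inv_mul hX' hY h hX
  have hSZ : ∀ r, divDiff Yc yn r * (Xi * (v * (1 - w * (Xi * (Yi * v))))) =
      Yc ^ r * (Xi * (Yi * v)) - yn ^ r * (Xi * (Yi * v)) := fun r => by
    rw [← hkey, ← Matrix.mul_assoc, hS, Matrix.sub_mul]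
  have hSN : divDiff Yc yn r * (v * (E * (w * (Xi * (Yi * v))))) = ∑ a ∈ Finset.range r,
      Yc ^ a * (N (r - 1 - a) * (yn ^ (r - 1 - a) * (Xi * (Yi * v)))) := by
    rw [divDiff, Matrix.sum_mul]
    refine Finset.sum_congr rfl fun a _ => ?_
    have := congrArg (· * (Xi * (Yi * v))) (hN (r - 1 - a))
    simp only [Matrix.mul_assoc] at this ⊢
    rw [this]
  have hw' : yd ^ r * (w * (Xi * (Yi * v))) = w * (yn ^ r * (Xi * (Yi * v))) := by
    rw [← Matrix.mul_assoc, ← hw, Matrix.mul_assoc]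
  set Z := Xi * (Yi * v) with hZ
  have e1 : E * yd ^ r * (1 - w * Z) = E * yd ^ r - E * (w * (yn ^ r * Z)) := by
    rw [Matrix.mul_sub, Matrix.mul_one, Matrix.mul_assoc, hw']
  have e2 : w * (Xi * (divDiff Yc yn r * (v * E))) * (1 - w * Z) =
      w * (Xi * (divDiff Yc yn r * (v * E))) - w * (Xi * ∑ a ∈ Finset.range r,
      Yc ^ a * (N (r - 1 - a) * (yn ^ (r - 1 - a) * Z))) := by
    rw [← hSN, Matrix.mul_sub, Matrix.mul_one]
    simp only [Matrix.mul_assoc]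
  have e3 : E * (w * (divDiff Yc yn r * (Xi * v))) * (1 - w * Z) =
      E * (w * (Yc ^ r * Z)) - E * (w * (yn ^ r * Z)) := by
    rw [← Matrix.mul_sub, ← Matrix.mul_sub, ← hSZ]
    simp only [Matrix.mul_assoc]
  have e4 : w * (Xi * ∑ a ∈ Finset.range r,
      Yc ^ a * (N (r - 1 - a) * (divDiff Yc yn (r - 1 - a) * (Xi * v)))) * (1 - w * Z) =
      w * (Xi * ∑ a ∈ Finset.range r, Yc ^ a * (N (r - 1 - a) * (Yc ^ (r - 1 - a) * Z))) -
      w * (Xi * ∑ a ∈ Finset.range r, Yc ^ a * (N (r - 1 - a) * (yn ^ (r - 1 - a) * Z))) := by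
    rw [← Matrix.mul_sub, ← Matrix.mul_sub, ← Finset.sum_sub_distrib, Matrix.mul_assoc,
      Matrix.mul_assoc, Matrix.sum_mul]
    congr 2
    refine Finset.sum_congr rfl fun a _ => ?_
    rw [← Matrix.mul_sub, ← Matrix.mul_sub, ← hSZ]
    simp only [Matrix.mul_assoc]
  have e5 : (1 - w * Z) * (E * yd ^ r) = E * yd ^ r - w * (Xi * (Yi * (yn ^ r * (v * E)))) := by
    rw [Matrix.sub_mul, Matrix.one_mul, ← hv, hZ]
    simp only [Matrix.mul_assoc]
  have e6 : w * (Xi * (divDiff Yc yn r * (v * E))) =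
      w * (Xi * (Yi * (Yc ^ r * (v * E)))) - w * (Xi * (Yi * (yn ^ r * (v * E)))) := by
    rw [hS', Matrix.sub_mul, Matrix.mul_sub, Matrix.mul_sub]
    simp only [Matrix.mul_assoc]
  rw [sub_mul, sub_mul, add_mul, e1, e2, e3, e4, e5, e6]
  abel

end DressFlow

section HatFlow

variable {m : ℕ} [NeZero m] {τ : ℂ} {k : ZMod m → ℂ} {α : ZMod m → ℕ} {d : ℕ} {t : ℂ}

theorem HasMatDerivAt.const {ι κ : Type*} (A : Matrix ι κ ℂ) : HasMatDerivAt (fun _ => A) 0 t :=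
  fun _ _ => hasDerivAt_const _ _

theorem HasMatDerivAt.mul {ι κ η : Type*} [Fintype κ] {A : ℂ → Matrix ι κ ℂ} {A' : Matrix ι κ ℂ}
    {B : ℂ → Matrix κ η ℂ} {B' : Matrix κ η ℂ} (hA : HasMatDerivAt A A' t)
    (hB : HasMatDerivAt B B' t) :
    HasMatDerivAt (fun s => A s * B s) (A' * B t + A t * B') t := fun a b => by
  simp only [Matrix.mul_apply, Matrix.add_apply, ← Finset.sum_add_distrib]
  exact HasDerivAt.fun_sum fun c _ => (hA a c).mul (hB c b)

theorem HasMatDerivAt.pow_zero {ι : Type*} [Fintype ι] [DecidableEq ι] {A : ℂ → Matrix ι ι ℂ}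
    (hA : HasMatDerivAt A 0 t) (p : ℕ) : HasMatDerivAt (fun s => A s ^ p) 0 t := by
  induction p with
  | zero => simpa only [_root_.pow_zero] using HasMatDerivAt.const 1
  | succ p ih => simpa [pow_succ] using ih.mul hA

theorem hasMatBddDerivAt_hatX {q : ℂ → FramedRep m α d} {X' : Matrix (VIdx α) (VIdx α) ℂ}
    (h : HasMatDerivAt (fun s => (q s).X) X' t) :
    HasMatBddDerivAt (fun s => hatX τ k (q s)) (X'.map (ofComplex m τ k)) t := by
  simpa only [hatX, sub_zero] using (HasMatBddDerivAt.map_ofComplex h).sub (.const _)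

theorem hasMatBddDerivAt_hatXInv {q : ℂ → FramedRep m α d} {X' : Matrix (VIdx α) (VIdx α) ℂ}
    (h : HasMatDerivAt (fun s => (q s).X) X' t) :
    HasMatBddDerivAt (fun s => hatXInv τ k (q s))
      (-(hatXInv τ k (q t) * X'.map (ofComplex m τ k) * hatXInv τ k (q t))) t := by
  have h1 : ∀ a b, ∃ f', HasRatDerivAt (fun s => ratX (q s) a b) f' t := fun a b => by
    simp only [ratX, Matrix.sub_apply, Matrix.map_apply]
    exact ⟨_, (HasRatDerivAt.C (h a b)).sub (.const _)⟩
  choose F hF using HasRatDerivAt.exists_matrix_inv h1 (det_ratX_ne_zero (q t))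
  have h2 : HasMatBddDerivAt (fun s => hatXInv τ k (q s)) ((Matrix.of F).map (ratEmb τ k)) t :=
    fun a b => .ofCrossed (.ofRat (hF a b))
  rwa [HasMatBddDerivAt.inv_eq (hasMatBddDerivAt_hatX h) h2
    (.of_forall fun s => hatX_mul_inv (q s)) (hatXInv_mul (q t))] at h2

theorem hasMatBddDerivAt_hatYInv {q : ℂ → FramedRep m α d}
    (h : HasMatDerivAt (fun s => (q s).Y) 0 t) :
    HasMatBddDerivAt (fun s => hatYInv τ k (q s)) 0 t := by
  refine fun a b => ⟨⟨0, fun n hn => ⟨fun s => ?_, rfl⟩⟩, fun n => ?_⟩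
  · rw [coeff_hatYInv, if_neg (by omega)]
  · simp only [coeff_hatYInv]
    split_ifs
    · have := HasCrossedDerivAt.ofRat (m := m) (.C (h.pow_zero (-n - 1).toNat a b).fun_neg)
      simpa using this
    · exact .const 0

theorem hasMatBddDerivAt_epsV {q : ℂ → FramedRep m α d} {v' : Matrix (VIdx α) (Fin d) ℂ}
    (h : HasMatDerivAt (fun s => (q s).vAt 0) v' t) :
    HasMatBddDerivAt (fun s => epsV τ k (q s))
      (v'.map (ofComplex m τ k) * Matrix.scalar (Fin d) (eps m τ k 0)) t := by
  simpa only [epsV, Matrix.mul_zero, add_zero] using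
    (HasMatBddDerivAt.map_ofComplex h).mul (.const (Matrix.scalar (Fin d) (eps m τ k 0)))

theorem hasMatBddDerivAt_epsW {q : ℂ → FramedRep m α d} {w' : Matrix (Fin d) (VIdx α) ℂ}
    (h : HasMatDerivAt (fun s => (q s).wAt 0) w' t) :
    HasMatBddDerivAt (fun s => epsW τ k (q s))
      (Matrix.scalar (Fin d) (eps m τ k 0) * w'.map (ofComplex m τ k)) t := by
  simpa only [epsW, Matrix.zero_mul, zero_add] using
    (HasMatBddDerivAt.const (t := t) (Matrix.scalar (Fin d) (eps m τ k 0))).mul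
    (.map_ofComplex h)

end HatFlow

section LaxFlow

open Psd hiding y

variable {m : ℕ} [NeZero m] {τ : ℂ} {k : ZMod m → ℂ} {α : ZMod m → ℕ} {d : ℕ} {t : ℂ}

/-- The flows with numbers divisible by `m`, at a representation framed only at the vertex `0`. -/
theorem FramedRep.FlowAt.spherical {j : ℕ} {β : Fin d} {q : ℂ → FramedRep m α d}
    (h : FramedRep.FlowAt (m * j) β q t) (hv : ∀ i, i ≠ 0 → (q t).vAt i = 0) :
    HasMatDerivAt (fun s => (q s).X) (-∑ a ∈ Finset.range (m * j), (q t).Y ^ a *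
      ((q t).vAt 0 * (diagUnit β * ((q t).wAt 0 * (q t).Y ^ (m * j - 1 - a))))) t ∧
    HasMatDerivAt (fun s => (q s).Y) 0 t ∧
    HasMatDerivAt (fun s => (q s).wAt 0) (diagUnit β * ((q t).wAt 0 * (q t).Y ^ (m * j))) t ∧
    HasMatDerivAt (fun s => (q s).vAt 0) (-((q t).Y ^ (m * j) * ((q t).vAt 0 * diagUnit β))) t := by
  obtain ⟨hX, hY, hw, hv'⟩ := h
  have h0 : ((m * j : ℕ) : ZMod m) = 0 := by simp
  refine ⟨?_, hY, ?_, ?_⟩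
  · rw [Finset.sum_eq_single 0] at hX
    · simp only [h0, sub_zero, Matrix.mul_assoc, Nat.sub_right_comm (m * j) _ 1] at hX
      exact hX
    · intro l _ hl
      simp [hv l hl]
    · simp
  · simpa only [h0, sub_zero, Matrix.mul_assoc] using hw 0
  · simpa only [h0, add_zero, Matrix.mul_assoc] using hv' 0

theorem map_diagUnit (β : Fin d) :
    (diagUnit β).map (ofComplex m τ k) = Matrix.single β β 1 := by
  ext1 a b
  rw [Matrix.map_apply, diagUnit, Matrix.single_apply, Matrix.single_apply]
  split_ifs <;> simp

theorem map_pow_ofComplex {ι : Type*} [Fintype ι] [DecidableEq ι] (A : Matrix ι ι ℂ) (n : ℕ) :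
    (A ^ n).map (ofComplex m τ k) = A.map (ofComplex m τ k) ^ n :=
  map_pow (ofComplex m τ k).mapMatrix A n

theorem map_neg_ofComplex {ι κ : Type*} (A : Matrix ι κ ℂ) :
    (-A).map (ofComplex m τ k) = -A.map (ofComplex m τ k) := by
  ext1 a b
  simp only [Matrix.map_apply, Matrix.neg_apply, map_neg]

theorem mapY_pow_mul_diagIdem (q : FramedRep m α d) (n : ℕ) (c : ZMod m) :
    q.Y.map (ofComplex m τ k) ^ n * diagIdem m τ k α c =
      diagIdem m τ k α (c + n) * q.Y.map (ofComplex m τ k) ^ n := by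
  induction n with
  | zero => simp
  | succ n ih =>
    rw [pow_succ', mul_assoc, ih, ← mul_assoc, mapY_mul_diagIdem, mul_assoc, Nat.cast_succ,
      add_assoc]

variable (τ k) in
/-- The matrix `v_0 ε_b E_β w_0`. -/
def flowKernel (q : FramedRep m α d) (β : Fin d) (b : ℕ) :
    Matrix (VIdx α) (VIdx α) (DunklPsd m τ k) :=
  (q.vAt 0).map (ofComplex m τ k) * (Matrix.scalar (Fin d) (eps m τ k (b : ZMod m)) *
    ((Matrix.single β β 1 : Mat m τ k d) * (q.wAt 0).map (ofComplex m τ k)))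

variable (τ k) in
/-- The positive part of `L^r R_β`, computed from the representation. -/
def flowOp (q : FramedRep m α d) (r : ℕ) (β : Fin d) : Mat m τ k d :=
  (Matrix.single β β 1 : Mat m τ k d) * Matrix.scalar (Fin d) (y m τ k) ^ r +
    epsW τ k q * (hatXInv τ k q * (divDiff (q.Y.map (ofComplex m τ k))
      (Matrix.scalar (VIdx α) (y m τ k)) r * (epsV τ k q * (Matrix.single β β 1 : Mat m τ k d)))) -
    (Matrix.single β β 1 : Mat m τ k d) * (epsW τ k q * (divDiff (q.Y.map (ofComplex m τ k))
      (Matrix.scalar (VIdx α) (y m τ k)) r * (hatXInv τ k q * epsV τ k q))) -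
    epsW τ k q * (hatXInv τ k q * ∑ a ∈ Finset.range r, q.Y.map (ofComplex m τ k) ^ a *
      (flowKernel τ k q β (r - 1 - a) * (divDiff (q.Y.map (ofComplex m τ k))
        (Matrix.scalar (VIdx α) (y m τ k)) (r - 1 - a) * (hatXInv τ k q * epsV τ k q))))

theorem matNonneg_map_ofComplex {ι κ : Type*} (A : Matrix ι κ ℂ) :
    MatNonneg (A.map (ofComplex m τ k)) := fun _ _ => const_mem_nonneg _

theorem matNonneg_flowOp (q : FramedRep m α d) (r : ℕ) (β : Fin d) :
    MatNonneg (flowOp τ k q r β) := by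
  have hw : MatNonneg (epsW τ k q) :=
    (matNonneg_scalar (const_mem_nonneg _)).mul (matNonneg_map_ofComplex _)
  have hv : MatNonneg (epsV τ k q) :=
    (matNonneg_map_ofComplex _).mul (matNonneg_scalar (const_mem_nonneg _))
  have hX : MatNonneg (hatXInv τ k q) := fun _ _ => const_mem_nonneg _
  have hE : MatNonneg (Matrix.single β β 1 : Mat m τ k d) := by
    rw [← map_diagUnit]
    exact matNonneg_map_ofComplex _
  have hy : ∀ {ι : Type} [Fintype ι] [DecidableEq ι],
      MatNonneg (Matrix.scalar ι (y m τ k)) := fun {ι} _ _ => matNonneg_scalar y_mem_nonneg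
  have hY : MatNonneg (q.Y.map (ofComplex m τ k)) := matNonneg_map_ofComplex _
  have hS : ∀ n, MatNonneg (divDiff (q.Y.map (ofComplex m τ k))
      (Matrix.scalar (VIdx α) (y m τ k)) n) := fun n =>
    .sum fun a _ => (hY.pow a).mul (hy.pow _)
  have hN : ∀ b, MatNonneg (flowKernel τ k q β b) := fun b =>
    (matNonneg_map_ofComplex _).mul ((matNonneg_scalar (const_mem_nonneg _)).mul
      (hE.mul (matNonneg_map_ofComplex _)))
  exact (((hE.mul (hy.pow r)).add (hw.mul (hX.mul ((hS r).mul (hv.mul hE))))).sub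
    (hE.mul (hw.mul ((hS r).mul (hX.mul hv))))).sub
    (hw.mul (hX.mul (.sum fun a _ => (hY.pow a).mul ((hN _).mul ((hS _).mul (hX.mul hv))))))

theorem scalar_y_pow_mul_map {ι κ : Type*} [Fintype ι] [DecidableEq ι] [Fintype κ] [DecidableEq κ]
    (n : ℕ) (A : Matrix ι κ ℂ) : Matrix.scalar ι (y m τ k) ^ n * A.map (ofComplex m τ k) =
      A.map (ofComplex m τ k) * Matrix.scalar κ (y m τ k) ^ n := by
  rw [← map_pow, ← map_pow, scalar_mul_map]

theorem scalar_y_pow_mul_eps {ι : Type*} [Fintype ι] [DecidableEq ι] (n : ℕ) (i : ZMod m) :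
    Matrix.scalar ι (y m τ k) ^ n * Matrix.scalar ι (eps m τ k i) =
      Matrix.scalar ι (eps m τ k (i + n)) * Matrix.scalar ι (y m τ k) ^ n := by
  rw [← map_pow, ← map_mul, y_pow_mul_eps, map_mul]

theorem scalar_y_pow_mul_single (n : ℕ) (β : Fin d) :
    Matrix.scalar (Fin d) (y m τ k) ^ n * Matrix.single β β 1 =
      Matrix.single β β 1 * Matrix.scalar (Fin d) (y m τ k) ^ n := by
  rw [← map_pow, scalar_comm_single]

theorem epsV_mul_single_mul_y_pow (Q : FramedRep m α d) (β : Fin d) {r : ℕ}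
    (hr : (r : ZMod m) = 0) :
    epsV τ k Q * ((Matrix.single β β 1 : Mat m τ k d) * Matrix.scalar (Fin d) (y m τ k) ^ r) =
      Matrix.scalar (VIdx α) (y m τ k) ^ r *
        (epsV τ k Q * (Matrix.single β β 1 : Mat m τ k d)) := by
  rw [epsV, ← Matrix.mul_assoc (Matrix.scalar (VIdx α) _ ^ r), ← Matrix.mul_assoc
    (Matrix.scalar (VIdx α) _ ^ r), scalar_y_pow_mul_map, Matrix.mul_assoc (Matrix.map _ _)
    (Matrix.scalar _ _ ^ r), scalar_y_pow_mul_eps, hr, add_zero, ← scalar_y_pow_mul_single]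
  simp only [Matrix.mul_assoc]

theorem epsW_mul_y_pow (Q : FramedRep m α d) {r : ℕ} (hr : (r : ZMod m) = 0) :
    epsW τ k Q * Matrix.scalar (VIdx α) (y m τ k) ^ r =
      Matrix.scalar (Fin d) (y m τ k) ^ r * epsW τ k Q := by
  rw [epsW, Matrix.mul_assoc, ← scalar_y_pow_mul_map, ← Matrix.mul_assoc, ← Matrix.mul_assoc,
    scalar_y_pow_mul_eps, hr, add_zero]

theorem y_pow_mul_flowKernel (Q : FramedRep m α d) (β : Fin d) (b : ℕ) :
    Matrix.scalar (VIdx α) (y m τ k) ^ b *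
      (epsV τ k Q * ((Matrix.single β β 1 : Mat m τ k d) * epsW τ k Q)) =
        flowKernel τ k Q β b * Matrix.scalar (VIdx α) (y m τ k) ^ b := by
  have h1 : epsV τ k Q * ((Matrix.single β β 1 : Mat m τ k d) * epsW τ k Q) =
      (Q.vAt 0).map (ofComplex m τ k) * (Matrix.scalar (Fin d) (eps m τ k 0) *
        ((Matrix.single β β 1 : Mat m τ k d) * (Q.wAt 0).map (ofComplex m τ k))) := by
    rw [epsV, epsW, ← Matrix.mul_assoc (Matrix.single β β 1), ← scalar_comm_single,
      Matrix.mul_assoc, Matrix.mul_assoc, ← Matrix.mul_assoc (Matrix.scalar _ _)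
      (Matrix.scalar _ _), ← map_mul, eps_mul_eps, if_pos rfl]
  rw [h1, ← Matrix.mul_assoc, scalar_y_pow_mul_map, Matrix.mul_assoc,
    ← Matrix.mul_assoc (_ ^ b), scalar_y_pow_mul_eps, zero_add, flowKernel, Matrix.mul_assoc,
    ← Matrix.mul_assoc (_ ^ b), scalar_y_pow_mul_single, Matrix.mul_assoc,
    scalar_y_pow_mul_map]
  simp only [Matrix.mul_assoc]

/-- On the image of `∑ e_i ε_i`, the operator `w_0 Y^b` may be replaced by `ε_b w_0 Y^b`. -/
theorem map_wAt_mul_pow_mul (Q : FramedRep m α d) (b : ℕ)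
    {Z : Matrix (VIdx α) (Fin d) (DunklPsd m τ k)} (hZ : diagIdem m τ k α 0 * Z = Z) :
    (Q.wAt 0).map (ofComplex m τ k) * (Q.Y.map (ofComplex m τ k) ^ b * Z) =
      Matrix.scalar (Fin d) (eps m τ k (b : ZMod m)) *
        ((Q.wAt 0).map (ofComplex m τ k) * (Q.Y.map (ofComplex m τ k) ^ b * Z)) := by
  conv_lhs => rw [← hZ]
  rw [← Matrix.mul_assoc (_ ^ b), mapY_pow_mul_diagIdem, zero_add, Matrix.mul_assoc,
    ← Matrix.mul_assoc (Matrix.map _ _), map_wAt_mul_diagIdem, Matrix.mul_assoc]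

/-- The velocity of `X` on the image of `∑ e_i ε_i`. -/
theorem map_flowX_mul (Q : FramedRep m α d) (β : Fin d) (r : ℕ)
    {Z : Matrix (VIdx α) (Fin d) (DunklPsd m τ k)} (hZ : diagIdem m τ k α 0 * Z = Z) :
    (-∑ a ∈ Finset.range r, Q.Y ^ a * (Q.vAt 0 * (diagUnit β * (Q.wAt 0 *
      Q.Y ^ (r - 1 - a))))).map (ofComplex m τ k) * Z = -∑ a ∈ Finset.range r,
      Q.Y.map (ofComplex m τ k) ^ a * (flowKernel τ k Q β (r - 1 - a) *
        (Q.Y.map (ofComplex m τ k) ^ (r - 1 - a) * Z)) := by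
  rw [map_neg_ofComplex, map_sum_ofComplex, Matrix.neg_mul, Matrix.sum_mul, neg_inj]
  refine Finset.sum_congr rfl fun a _ => ?_
  simp only [map_mul_ofComplex, map_pow_ofComplex, map_diagUnit, flowKernel, Matrix.mul_assoc]
  conv_lhs => rw [map_wAt_mul_pow_mul Q _ hZ, ← Matrix.mul_assoc (Matrix.single β β 1),
    ← scalar_comm_single, Matrix.mul_assoc]

theorem map_flowV_mul (Q : FramedRep m α d) (β : Fin d) (r : ℕ) :
    (-(Q.Y ^ r * (Q.vAt 0 * diagUnit β))).map (ofComplex m τ k) *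
      Matrix.scalar (Fin d) (eps m τ k 0) =
        -(Q.Y.map (ofComplex m τ k) ^ r * (epsV τ k Q * (Matrix.single β β 1 : Mat m τ k d))) := by
  rw [map_neg_ofComplex, map_mul_ofComplex, map_mul_ofComplex, map_pow_ofComplex, map_diagUnit,
    epsV, Matrix.mul_assoc (Matrix.map _ _) (Matrix.scalar _ _), scalar_comm_single,
    Matrix.neg_mul]
  simp only [Matrix.mul_assoc]

theorem mul_map_flowW (Q : FramedRep m α d) (β : Fin d) (r : ℕ) :
    Matrix.scalar (Fin d) (eps m τ k 0) *
      (diagUnit β * (Q.wAt 0 * Q.Y ^ r)).map (ofComplex m τ k) =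
        (Matrix.single β β 1 : Mat m τ k d) * (epsW τ k Q * Q.Y.map (ofComplex m τ k) ^ r) := by
  rw [map_mul_ofComplex, map_mul_ofComplex, map_pow_ofComplex, map_diagUnit, epsW,
    ← Matrix.mul_assoc, scalar_comm_single]
  simp only [Matrix.mul_assoc]

/-- The value of `∂M`, before the elimination of `(Y - y)⁻¹`. -/
theorem flow_dressM_eq {Q : FramedRep m α d} (hQ : Q ∈ FramedRep.sphericalCM (dunklLambda τ k))
    (β : Fin d) {r : ℕ} (hr : (r : ZMod m) = 0) :
    (0 : Mat m τ k d) - (Matrix.scalar (Fin d) (eps m τ k 0) *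
      (diagUnit β * (Q.wAt 0 * Q.Y ^ r)).map (ofComplex m τ k) *
        (hatXInv τ k Q * (hatYInv τ k Q * epsV τ k Q)) + epsW τ k Q *
      (-(hatXInv τ k Q * (-∑ a ∈ Finset.range r, Q.Y ^ a * (Q.vAt 0 * (diagUnit β * (Q.wAt 0 *
      Q.Y ^ (r - 1 - a))))).map (ofComplex m τ k) * hatXInv τ k Q) * (hatYInv τ k Q * epsV τ k Q) +
      hatXInv τ k Q *
      ((0 : Matrix (VIdx α) (VIdx α) (DunklPsd m τ k)) * epsV τ k Q + hatYInv τ k Q *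
      ((-(Q.Y ^ r * (Q.vAt 0 * diagUnit β))).map (ofComplex m τ k) *
      Matrix.scalar (Fin d) (eps m τ k 0))))) = flowOp τ k Q r β * dressM τ k Q -
      dressM τ k Q * (Matrix.single β β 1 * Matrix.scalar (Fin d) (y m τ k) ^ r) := by
  have hZ := diagIdem_mul_hatXInv_hatYInv (τ := τ) (k := k) Q
  have hflow := dress_flow (hatX_mul_inv Q) (hatXInv_mul Q) (hatY_mul_inv Q) (hatYInv_mul Q)
    (scalar_mul_map _ _).symm (hat_commutator_mul hQ hZ) r (epsV_mul_single_mul_y_pow Q β hr)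
    (epsW_mul_y_pow Q hr) (y_pow_mul_flowKernel Q β)
  rw [dressM_eq, flowOp, dressA, ← hflow, mul_map_flowW, map_flowV_mul, Matrix.neg_mul,
    Matrix.mul_assoc (hatXInv τ k Q * _), Matrix.mul_assoc (hatXInv τ k Q), map_flowX_mul Q β r hZ]
  simp only [Matrix.mul_neg, Matrix.zero_mul, zero_add, neg_neg, Matrix.mul_add, Matrix.mul_assoc,
    sub_eq_add_neg, add_assoc]

/-- Along a flow, `∂M = D M - M E_β y^{mj}`, where `D` has no negative powers of `y`; moreover `∂M`
has only negative powers of `y`. -/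
theorem hasMatBddDerivAt_dressM {j : ℕ} {β : Fin d} {q : ℂ → FramedRep m α d}
    (h : FramedRep.FlowAt (m * j) β q t)
    (hq : q t ∈ FramedRep.sphericalCM (dunklLambda τ k)) :
    HasMatBddDerivAt (fun s => dressM τ k (q s)) (flowOp τ k (q t) (m * j) β * dressM τ k (q t) -
      dressM τ k (q t) * (Matrix.single β β 1 * Matrix.scalar (Fin d) (y m τ k) ^ (m * j))) t ∧
    DegLE (-1) (flowOp τ k (q t) (m * j) β * dressM τ k (q t) -
      dressM τ k (q t) * (Matrix.single β β 1 * Matrix.scalar (Fin d) (y m τ k) ^ (m * j))) := by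
  obtain ⟨hX, hY, hw, hv⟩ := h.spherical fun i hi => (hq.2 i hi).1
  have hM' := flow_dressM_eq hq β (r := m * j) (by simp)
  refine ⟨?_, ?_⟩
  · rw [← hM']
    simp only [dressM_eq]
    exact (HasMatBddDerivAt.const (t := t) (1 : Mat m τ k d)).sub
      ((hasMatBddDerivAt_epsW hw).mul ((hasMatBddDerivAt_hatXInv hX).mul
        ((hasMatBddDerivAt_hatYInv hY).mul (hasMatBddDerivAt_epsV hv))))
  · have hXd := degLE_hatXInv (τ := τ) (k := k) (q t)
    have hYd := degLE_hatYInv (τ := τ) (k := k) (q t)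
    have hVd := degLE_epsV (τ := τ) (k := k) (q t)
    have h0 : DegLE (-1) (0 : Mat m τ k d) := fun _ _ _ _ => rfl
    rw [← hM', Matrix.zero_mul, zero_add]
    exact h0.sub ((((degLE_scalar_eps 0).mul (degLE_map_ofComplex _)).mul
      (hXd.mul (hYd.mul hVd))).add
      ((degLE_epsW (q t)).mul ((((hXd.mul (degLE_map_ofComplex _)).mul hXd).neg.mul
        (hYd.mul hVd)).add (hXd.mul (hYd.mul
          ((degLE_map_ofComplex _).mul (degLE_scalar_eps 0)))))))

theorem exists_hasMatBddDerivAt_dressB {j : ℕ} {β : Fin d} {q : ℂ → FramedRep m α d}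
    (h : FramedRep.FlowAt (m * j) β q t)
    (hq : q t ∈ FramedRep.sphericalCM (dunklLambda τ k)) :
    ∃ B', HasMatBddDerivAt (fun s => 1 + dressB τ k (q s)) B' t := by
  obtain ⟨hX, hY, hw, hv⟩ := h.spherical fun i hi => (hq.2 i hi).1
  exact ⟨_, (HasMatBddDerivAt.const 1).add ((hasMatBddDerivAt_epsW hw).mul
    ((hasMatBddDerivAt_hatYInv hY).mul
      ((hasMatBddDerivAt_hatXInv hX).mul (hasMatBddDerivAt_epsV hv))))⟩

theorem laxL_pow {q : FramedRep m α d} (hq : q ∈ FramedRep.sphericalCM (dunklLambda τ k))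
    (r : ℕ) : laxL τ k q ^ r =
      dressM τ k q * Matrix.scalar (Fin d) (y m τ k) ^ r * (1 + dressB τ k q) := by
  induction r with
  | zero => rw [pow_zero, pow_zero, mul_one, dressM_mul_inv hq]
  | succ r ih =>
    rw [pow_succ, ih, laxL_eq hq]
    calc _ = dressM τ k q * Matrix.scalar (Fin d) (y m τ k) ^ r *
          ((1 + dressB τ k q) * dressM τ k q) * Matrix.scalar (Fin d) (y m τ k) *
            (1 + dressB τ k q) := by simp only [mul_assoc]
      _ = _ := by rw [inv_mul_dressM hq, mul_one, pow_succ, mul_assoc (dressM τ k q)]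

/-- The derivative of a conjugate `M C M⁻¹` of a constant `C` is the commutator with `∂M M⁻¹`. -/
theorem HasMatBddDerivAt.conj {M N : ℂ → Mat m τ k d} {M' N' : Mat m τ k d} (C : Mat m τ k d)
    (hM : HasMatBddDerivAt M M' t) (hN : HasMatBddDerivAt N N' t)
    (h : ∀ᶠ s in 𝓝 t, M s * N s = 1) (h' : N t * M t = 1) :
    HasMatBddDerivAt (fun s => M s * C * N s)
      (M' * N t * (M t * C * N t) - M t * C * N t * (M' * N t)) t := by
  have hN' := hM.inv_eq hN h h'
  have h1 := (hM.mul (const C)).mul hN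
  have h2 : (M' * C + M t * 0) * N t + M t * C * N' =
      M' * N t * (M t * C * N t) - M t * C * N t * (M' * N t) := by
    have h3 : M' * N t * (M t * C * N t) = M' * (N t * M t) * C * N t := by
      simp only [mul_assoc]
    rw [hN', h3, h', mul_zero, add_zero, mul_one, mul_neg, ← sub_eq_add_neg]
    simp only [mul_assoc]
  rwa [h2] at h1

theorem laxEqAt_of_flowAt {j : ℕ} {β : Fin d} {q : ℂ → FramedRep m α d}
    (hq : ∀ᶠ s in 𝓝 t, q s ∈ FramedRep.sphericalCM (dunklLambda τ k))
    (h : FramedRep.FlowAt (m * j) β q t) :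
    LaxEqAt (m * j) β (fun s => laxL τ k (q s)) (fun s => laxR τ k (q s)) t := by
  have hqt := hq.self_of_nhds
  obtain ⟨hM, hdeg⟩ := hasMatBddDerivAt_dressM h hqt
  obtain ⟨B', hN⟩ := exists_hasMatBddDerivAt_dressB h hqt
  have hMN := dressM_mul_inv hqt
  have hNM := inv_mul_dressM hqt
  have hT := isSphericalLaxTuple hqt
  have hMN' : ∀ᶠ s in 𝓝 t, dressM τ k (q s) * (1 + dressB τ k (q s)) = 1 :=
    hq.mono fun s hs => dressM_mul_inv hs
  set M' := flowOp τ k (q t) (m * j) β * dressM τ k (q t) -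
    dressM τ k (q t) * (Matrix.single β β 1 * Matrix.scalar (Fin d) (y m τ k) ^ (m * j)) with hM'
  have hNd : DegLE 0 (1 + dressB τ k (q t)) :=
    degLE_one.add ((degLE_dressB (q t)).mono (by norm_num))
  -- `L^{mj} R_β = M y^{mj} E_β M⁻¹ = D - ∂M M⁻¹`
  have hP : laxL τ k (q t) ^ (m * j) * laxR τ k (q t) β =
      flowOp τ k (q t) (m * j) β - M' * (1 + dressB τ k (q t)) := by
    have h1 : laxL τ k (q t) ^ (m * j) * laxR τ k (q t) β = dressM τ k (q t) *
        Matrix.scalar (Fin d) (y m τ k) ^ (m * j) * ((1 + dressB τ k (q t)) * dressM τ k (q t)) *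
          Matrix.single β β 1 * (1 + dressB τ k (q t)) := by
      rw [laxL_pow hqt, laxR_eq hqt]
      simp only [mul_assoc]
    rw [h1, hNM, mul_one, hM', sub_mul, mul_assoc (flowOp _ _ _ _ _), hMN, mul_one, sub_sub_cancel,
      mul_assoc (dressM τ k (q t)), scalar_y_pow_mul_single]
  have hpos : matPos (laxL τ k (q t) ^ (m * j) * laxR τ k (q t) β) =
      flowOp τ k (q t) (m * j) β := by
    rw [hP]
    exact map_pos_sub (matNonneg_flowOp _ _ _) (hdeg.mul hNd)
  have hD : flowOp τ k (q t) (m * j) β = laxL τ k (q t) ^ (m * j) * laxR τ k (q t) β +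
      M' * (1 + dressB τ k (q t)) := by rw [hP, sub_add_cancel]
  -- `∂M M⁻¹` and `D` differ by `L^{mj} R_β`, which commutes with `L` and all `R_γ`.
  have hcomm : ∀ C, Commute (laxL τ k (q t)) C → Commute (laxR τ k (q t) β) C →
      M' * (1 + dressB τ k (q t)) * C - C * (M' * (1 + dressB τ k (q t))) =
        flowOp τ k (q t) (m * j) β * C - C * flowOp τ k (q t) (m * j) β := by
    intro C h1 h2
    have h3 : Commute (laxL τ k (q t) ^ (m * j) * laxR τ k (q t) β) C :=
      (h1.pow_left _).mul_left h2
    rw [hD, add_mul, mul_add C, h3.eq]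
    abel
  refine ⟨?_, fun γ => ?_⟩
  · rw [hpos, ← hcomm _ (Commute.refl _) (hT.comm β).symm, laxL_eq hqt]
    exact (hM.conj _ hN hMN' hNM).hasPsdDerivAt (hq.mono fun s hs => laxL_eq hs)
  · have hβγ : Commute (laxR τ k (q t) β) (laxR τ k (q t) γ) := by
      rw [Commute, SemiconjBy, hT.orth, hT.orth]
      by_cases hb : β = γ
      · subst hb; rfl
      · rw [if_neg hb, if_neg (Ne.symm hb)]
    rw [hpos, ← hcomm _ (hT.comm γ) hβγ, laxR_eq hqt]
    exact (hM.conj _ hN hMN' hNM).hasPsdDerivAt (hq.mono fun s hs => laxR_eq hs γ)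

end LaxFlow

/-! ### Linear flows with constant coefficients -/

section LinearFlow

open NormedSpace

/-- A solution of a linear equation `u' = Φ u` with constant coefficients is zero if it is zero at
time zero: `exp (-s Φ) u(s)` is constant. -/
theorem eq_zero_of_hasDerivAt_clm {E : Type*} [NormedAddCommGroup E] [NormedSpace ℂ E]
    [CompleteSpace E] {Φ : E →L[ℂ] E} {u : ℂ → E} (hu : ∀ s, HasDerivAt u (Φ (u s)) s)
    (h0 : u 0 = 0) (s : ℂ) : u s = 0 := by
  let := NormedAlgebra.restrictScalars ℚ ℂ (E →L[ℂ] E)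
  have hF : ∀ s, HasDerivAt (fun s => exp (s • (-Φ)) (u s)) 0 s := fun s => by
    have h := (hasDerivAt_exp_smul_const (-Φ) s).clm_apply (hu s)
    have h1 : (exp (s • (-Φ)) * -Φ) (u s) + exp (s • (-Φ)) (Φ (u s)) = 0 := by
      rw [mul_apply_eq_comp, neg_apply, map_neg, neg_add_cancel]
    rwa [h1] at h
  have h1 := is_const_of_deriv_eq_zero (fun s => (hF s).differentiableAt) (fun s => (hF s).deriv)
    s 0
  simp only [h0, map_zero] at h1
  have h2 : exp (s • Φ) * exp (s • (-Φ)) = 1 := by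
    rw [← exp_add_of_commute (((Commute.refl Φ).neg_right.smul_right s).smul_left s), ← smul_add,
      add_neg_cancel, smul_zero, exp_zero]
  rw [← one_apply_eq_self (F := E →L[ℂ] E) (u s), ← h2, mul_apply_eq_comp, h1,
    map_zero]

theorem hasDerivAt_exp_linearCombination {𝔸 σ : Type*} [NormedRing 𝔸] [NormedAlgebra ℂ 𝔸]
    [CompleteSpace 𝔸] {B : σ → 𝔸} (hB : ∀ a b, Commute (B a) (B b)) (t : σ →₀ ℂ) (a : σ) :
    HasDerivAt (fun s => exp (Finsupp.linearCombination ℂ B (t + Finsupp.single a s)))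
      (B a * exp (Finsupp.linearCombination ℂ B t)) 0 := by
  let := NormedAlgebra.restrictScalars ℚ ℂ 𝔸
  have hc : Commute (B a) (Finsupp.linearCombination ℂ B t) := by
    rw [Finsupp.linearCombination_apply]
    exact Commute.sum_right _ _ _ fun b _ => (hB a b).smul_right _
  have h1 : ∀ s : ℂ, exp (Finsupp.linearCombination ℂ B (t + Finsupp.single a s)) =
      exp (s • B a) * exp (Finsupp.linearCombination ℂ B t) := fun s => by
    rw [map_add, Finsupp.linearCombination_single, add_comm,
      exp_add_of_commute (hc.smul_left s)]
  simp only [h1]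
  simpa using (hasDerivAt_exp_smul_const' (B a) (0 : ℂ)).mul_const
    (exp (Finsupp.linearCombination ℂ B t))

end LinearFlow

section MatDeriv

variable {ι κ η : Type*} {t : ℂ} {A B : ℂ → Matrix ι κ ℂ} {A' B' : Matrix ι κ ℂ}

theorem HasMatDerivAt.congr_deriv (hA : HasMatDerivAt A A' t) (h : A' = B') :
    HasMatDerivAt A B' t := h ▸ hA

theorem HasMatDerivAt.sub (hA : HasMatDerivAt A A' t) (hB : HasMatDerivAt B B' t) :
    HasMatDerivAt (fun s => A s - B s) (A' - B') t := fun a b => (hA a b).sub (hB a b)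

theorem HasMatDerivAt.sum {σ : Type*} {I : Finset σ} {A : σ → ℂ → Matrix ι κ ℂ}
    {A' : σ → Matrix ι κ ℂ} (h : ∀ i ∈ I, HasMatDerivAt (A i) (A' i) t) :
    HasMatDerivAt (fun s => ∑ i ∈ I, A i s) (∑ i ∈ I, A' i) t := fun a b => by
  simp only [Matrix.sum_apply]
  exact HasDerivAt.fun_sum fun i hi => h i hi a b

theorem HasMatDerivAt.const_mul [Fintype ι] (hA : HasMatDerivAt A A' t) (C : Matrix η ι ℂ) :
    HasMatDerivAt (fun s => C * A s) (C * A') t := by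
  simpa using (HasMatDerivAt.const C).mul hA

theorem HasMatDerivAt.mul_const [Fintype κ] (hA : HasMatDerivAt A A' t) (C : Matrix κ η ℂ) :
    HasMatDerivAt (fun s => A s * C) (A' * C) t := by
  simpa using hA.mul (HasMatDerivAt.const C)

theorem HasMatDerivAt.eq_const (h : ∀ s, HasMatDerivAt A 0 s) (s : ℂ) : A s = A 0 := by
  ext1 a b
  exact is_const_of_deriv_eq_zero (fun s => (h s a b).differentiableAt) (fun s => (h s a b).deriv)
    s 0

theorem HasMatDerivAt.eq_zero_of_linear [Fintype ι] [Fintype κ] {P : Matrix ι ι ℂ}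
    {Q : Matrix κ κ ℂ} (h : ∀ s, HasMatDerivAt A (P * A s * Q) s) (h0 : A 0 = 0) (s : ℂ) :
    A s = 0 := by
  let Φ : (ι → κ → ℂ) →ₗ[ℂ] (ι → κ → ℂ) :=
    { toFun := fun Z => Matrix.of.symm (P * Matrix.of Z * Q)
      map_add' := fun Z Z' => by
        rw [← Matrix.of_add_of, Matrix.mul_add, Matrix.add_mul]
        rfl
      map_smul' := fun c Z => by
        rw [← Matrix.smul_of, Matrix.mul_smul, Matrix.smul_mul]
        rfl }
  exact eq_zero_of_hasDerivAt_clm (E := ι → κ → ℂ) (Φ := LinearMap.toContinuousLinearMap Φ)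
    (u := A) (fun s => hasDerivAt_pi.2 fun a => hasDerivAt_pi.2 fun b => h s a b) h0 s

end MatDeriv

section Exponentials

open NormedSpace TrivSqZeroExt

variable {𝔸 σ : Type*}

theorem snd_inl_add_inr_pow [Ring 𝔸] (Y N : 𝔸) (r : ℕ) :
    ((inl Y + inr N : TrivSqZeroExt 𝔸 𝔸) ^ r).snd =
      ∑ a ∈ Finset.range r, Y ^ a * N * Y ^ (r - 1 - a) := by
  rw [snd_pow_eq_sum, ← Finset.sum_range_reflect]
  simp only [fst_add, fst_inl, fst_inr, add_zero, snd_add, snd_inl, snd_inr, zero_add,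
    Nat.pred_eq_sub_one, smul_eq_mul, MulOpposite.smul_eq_mul_unop, MulOpposite.unop_op]
  refine (Finset.sum_congr rfl fun a ha => ?_ : ∑ a ∈ Finset.range r,
    Y ^ (r - 1 - a) * N * Y ^ a = _)
  rw [Finset.mem_range] at ha
  congr 2
  omega

/-- Exponentials solving a linear flow: `G = exp h(Y)`, `H = exp (-h(Y))` and, with the square-zero
extension `Z = Y + ε N` of `Y`, `C = H S` for `exp h(Z) = G + ε S`. Here `h(Y)` is the combination
of the powers `Y^{r a}` with the coefficients `c a t_a`. -/
theorem exists_flow_exponentials [NormedRing 𝔸] [NormedAlgebra ℂ 𝔸] [CompleteSpace 𝔸]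
    (Y N : 𝔸) (r : σ → ℕ) (c : σ → ℂ) :
    ∃ G H C : (σ →₀ ℂ) → 𝔸, G 0 = 1 ∧ H 0 = 1 ∧ C 0 = 0 ∧
      (∀ P, (∀ a, Commute P (Y ^ r a)) → ∀ t, Commute P (G t) ∧ Commute P (H t)) ∧
      ∀ t a,
        HasDerivAt (fun s => G (t + Finsupp.single a s)) (c a • (G t * Y ^ r a)) 0 ∧
        HasDerivAt (fun s => H (t + Finsupp.single a s)) (-(c a • (Y ^ r a * H t))) 0 ∧
        HasDerivAt (fun s => C (t + Finsupp.single a s)) (c a • ∑ i ∈ Finset.range (r a),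
          Y ^ i * (H t * N * G t) * Y ^ (r a - 1 - i)) 0 := by
  let Z : TrivSqZeroExt 𝔸 𝔸 := inl Y + inr N
  let := NormedAlgebra.restrictScalars ℚ ℂ 𝔸
  let := NormedAlgebra.restrictScalars ℚ ℂ (TrivSqZeroExt 𝔸 𝔸)
  have hYc : ∀ a b, Commute (c a • Y ^ r a) (c b • Y ^ r b) := fun a b =>
    ((Commute.pow_pow_self Y _ _).smul_left _).smul_right _
  have hZc : ∀ a b, Commute (c a • Z ^ r a) (c b • Z ^ r b) := fun a b =>
    ((Commute.pow_pow_self Z _ _).smul_left _).smul_right _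
  let G : (σ →₀ ℂ) → 𝔸 := fun t =>
    exp (Finsupp.linearCombination ℂ (fun a => c a • Y ^ r a) t)
  let H : (σ →₀ ℂ) → 𝔸 := fun t =>
    exp (Finsupp.linearCombination ℂ (fun a => -(c a • Y ^ r a)) t)
  let U : (σ →₀ ℂ) → TrivSqZeroExt 𝔸 𝔸 := fun t =>
    exp (Finsupp.linearCombination ℂ (fun a => c a • Z ^ r a) t)
  have hfst : ∀ t, (U t).fst = G t := fun t => by
    have h := map_exp (fstHom ℂ 𝔸 𝔸) TrivSqZeroExt.continuous_fst
      (Finsupp.linearCombination ℂ (fun a => c a • Z ^ r a) t)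
    refine h.trans ?_
    rw [Finsupp.linearCombination_apply, map_finsuppSum]
    simp [G, Finsupp.linearCombination_apply, Z]
  have hcomm : ∀ P, (∀ a, Commute P (Y ^ r a)) → ∀ t, Commute P (G t) ∧ Commute P (H t) := by
    refine fun P hP t => ⟨Commute.exp_right ?_, Commute.exp_right ?_⟩ <;>
      rw [Finsupp.linearCombination_apply] <;>
      refine Commute.sum_right _ _ _ fun b _ => Commute.smul_right ?_ _
    · exact (hP b).smul_right _
    · exact ((hP b).smul_right _).neg_right
  have hG : ∀ t a, HasDerivAt (fun s => G (t + Finsupp.single a s))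
      (c a • (G t * Y ^ r a)) 0 := fun t a => by
    have h := hasDerivAt_exp_linearCombination hYc t a
    rw [smul_mul_assoc] at h
    rwa [← ((hcomm (Y ^ r a) (fun b => Commute.pow_pow_self Y _ _) t).1).eq]
  have hH : ∀ t a, HasDerivAt (fun s => H (t + Finsupp.single a s))
      (-(c a • (Y ^ r a * H t))) 0 := fun t a => by
    have h := hasDerivAt_exp_linearCombination
      (fun a b => ((hYc a b).neg_left).neg_right) t a
    rwa [neg_mul, smul_mul_assoc] at h
  let sndL : TrivSqZeroExt 𝔸 𝔸 →L[ℂ] 𝔸 :=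
    { toFun := snd, map_add' := fun _ _ => rfl, map_smul' := fun _ _ => rfl,
      cont := TrivSqZeroExt.continuous_snd }
  have hS : ∀ t a, HasDerivAt (fun s => (U (t + Finsupp.single a s)).snd)
      (c a • (Y ^ r a * (U t).snd + (∑ i ∈ Finset.range (r a),
        Y ^ i * N * Y ^ (r a - 1 - i)) * G t)) 0 := fun t a => by
    have h := sndL.hasFDerivAt.comp_hasDerivAt (0 : ℂ)
      (hasDerivAt_exp_linearCombination hZc t a)
    have h1 : sndL (c a • Z ^ r a * U t) = c a • (Y ^ r a * (U t).snd +
        (∑ i ∈ Finset.range (r a), Y ^ i * N * Y ^ (r a - 1 - i)) * G t) := by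
      rw [← snd_inl_add_inr_pow, ← hfst, smul_mul_assoc, map_smul]
      congr 1
      change (Z ^ r a * U t).snd = _
      rw [snd_mul, fst_pow]
      simp [Z]
    rwa [← h1]
  refine ⟨G, H, fun t => H t * (U t).snd, ?_, ?_, ?_, hcomm, fun t a => ⟨hG t a, hH t a, ?_⟩⟩
  · simp only [G, map_zero, exp_zero]
  · simp only [H, map_zero, exp_zero]
  · simp only [U, map_zero, exp_zero, snd_one, mul_zero]
  · have h := (hH t a).mul (hS t a)
    simp only [Finsupp.single_zero, add_zero] at h
    refine h.congr_deriv ?_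
    -- The contributions of `Y^r S` from `∂H S` and `H ∂S` cancel.
    have hY := hcomm Y (fun b => Commute.pow_right (Commute.refl Y) _) t
    rw [neg_mul, smul_mul_assoc, mul_smul_comm, ← smul_neg, ← smul_add, mul_add, ← mul_assoc (H t),
      (hY.2.pow_left (r a)).eq, mul_assoc (H t) (_ ^ _), neg_add_cancel_left, Finset.sum_mul,
      Finset.mul_sum]
    congr 1
    refine Finset.sum_congr rfl fun i _ => ?_
    rw [mul_assoc (Y ^ i * N), (hY.1.pow_left _).eq]
    simp only [← mul_assoc]
    rw [(hY.2.pow_left i).eq]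

end Exponentials

section MatExponentials

attribute [local instance] Matrix.linftyOpNormedRing Matrix.linftyOpNormedAlgebra

variable {ι σ : Type*} [Fintype ι] [DecidableEq ι]

theorem HasMatDerivAt.of_hasDerivAt {A : ℂ → Matrix ι ι ℂ} {A' : Matrix ι ι ℂ} {t : ℂ}
    (h : HasDerivAt A A' t) : HasMatDerivAt A A' t := fun a b =>
  (LinearMap.toContinuousLinearMap (Matrix.entryLinearMap ℂ ℂ a b :
    Matrix ι ι ℂ →ₗ[ℂ] ℂ)).hasFDerivAt.comp_hasDerivAt t h

theorem exists_matrix_flow_exponentials (Y N : Matrix ι ι ℂ) (r : σ → ℕ) (c : σ → ℂ) :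
    ∃ G H C : (σ →₀ ℂ) → Matrix ι ι ℂ, G 0 = 1 ∧ H 0 = 1 ∧ C 0 = 0 ∧
      (∀ P, (∀ a, Commute P (Y ^ r a)) → ∀ t, Commute P (G t) ∧ Commute P (H t)) ∧
      ∀ t a,
        HasMatDerivAt (fun s => G (t + Finsupp.single a s)) (c a • (G t * Y ^ r a)) 0 ∧
        HasMatDerivAt (fun s => H (t + Finsupp.single a s)) (-(c a • (Y ^ r a * H t))) 0 ∧
        HasMatDerivAt (fun s => C (t + Finsupp.single a s)) (c a • ∑ i ∈ Finset.range (r a),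
          Y ^ i * (H t * N * G t) * Y ^ (r a - 1 - i)) 0 := by
  have : @CompleteSpace (Matrix ι ι ℂ) PseudoMetricSpace.toUniformSpace :=
    FiniteDimensional.complete ℂ _
  obtain ⟨G, H, C, h1, h2, h3, h4, h⟩ := exists_flow_exponentials Y N r c
  exact ⟨G, H, C, h1, h2, h3, h4, fun t a => ⟨.of_hasDerivAt (h t a).1,
    .of_hasDerivAt (h t a).2.1, .of_hasDerivAt (h t a).2.2⟩⟩

end MatExponentials

/-! ### Spherical flows: solutions and conservation laws -/

section SphericalFlows

variable {m : ℕ} [NeZero m] {α : ZMod m → ℕ} {d : ℕ}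

namespace FramedRep

theorem flowAt_of_spherical {j : ℕ} {β : Fin d} {q : ℂ → FramedRep m α d} {t : ℂ}
    (hvw : ∀ s i, i ≠ 0 → (q s).vAt i = 0 ∧ (q s).wAt i = 0)
    (hX : HasMatDerivAt (fun s => (q s).X) (-∑ a ∈ Finset.range (m * j), (q t).Y ^ a *
      ((q t).vAt 0 * (diagUnit β * ((q t).wAt 0 * (q t).Y ^ (m * j - 1 - a))))) t)
    (hY : HasMatDerivAt (fun s => (q s).Y) 0 t)
    (hw : HasMatDerivAt (fun s => (q s).wAt 0)
      (diagUnit β * ((q t).wAt 0 * (q t).Y ^ (m * j))) t)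
    (hv : HasMatDerivAt (fun s => (q s).vAt 0)
      (-((q t).Y ^ (m * j) * ((q t).vAt 0 * diagUnit β))) t) : FlowAt (m * j) β q t := by
  have h0 : ((m * j : ℕ) : ZMod m) = 0 := by simp
  refine ⟨?_, hY, fun i => ?_, fun i => ?_⟩
  · rw [Finset.sum_eq_single 0]
    · simp only [h0, sub_zero, Matrix.mul_assoc, Nat.sub_right_comm (m * j) _ 1]
      exact hX
    · intro l _ hl
      simp [(hvw t l hl).1]
    · simp
  · rw [h0, sub_zero]
    by_cases hi : i = 0
    · subst hi
      simpa only [Matrix.mul_assoc] using hw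
    · simp only [hvw _ i hi]
      simpa using HasMatDerivAt.const (t := t) (0 : Matrix (Fin d) (VIdx α) ℂ)
  · rw [h0, add_zero]
    by_cases hi : i = 0
    · subst hi
      simpa only [Matrix.mul_assoc] using hv
    · simp only [hvw _ i hi]
      simpa using HasMatDerivAt.const (t := t) (0 : Matrix (VIdx α) (Fin d) ℂ)

theorem vproj_mul_pow_Y (q : FramedRep m α d) (i : ZMod m) (n : ℕ) :
    vproj α i * q.Y ^ n = q.Y ^ n * vproj α (i + n) := by
  induction n with
  | zero => simp
  | succ n ih =>
    rw [pow_succ, ← mul_assoc, ih, mul_assoc, q.Y_graded, mul_assoc, Nat.cast_succ, add_assoc]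

/-- The sum `∑ vproj (i + 1) A vproj i`, the part of `A` that maps each `V_i` to `V_{i+1}`. -/
def gradedPart (A : Matrix (VIdx α) (VIdx α) ℂ) : Matrix (VIdx α) (VIdx α) ℂ :=
  ∑ i, vproj α (i + 1) * A * vproj α i

theorem vproj_mul_gradedPart (A : Matrix (VIdx α) (VIdx α) ℂ) (i : ZMod m) :
    vproj α (i + 1) * gradedPart A = gradedPart A * vproj α i := by
  rw [gradedPart, Finset.mul_sum, Finset.sum_mul, Finset.sum_eq_single i, Finset.sum_eq_single i]
  · rw [← mul_assoc, ← mul_assoc, vproj_mul_vproj, if_pos rfl, mul_assoc _ (vproj α i),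
      vproj_mul_vproj, if_pos rfl]
  · intro l _ hl
    rw [mul_assoc, vproj_mul_vproj, if_neg hl, mul_zero]
  · simp
  · intro l _ hl
    rw [← mul_assoc, ← mul_assoc, vproj_mul_vproj, if_neg fun h => hl (add_right_cancel h).symm,
      zero_mul, zero_mul]
  · simp

theorem gradedPart_eq_self {A : Matrix (VIdx α) (VIdx α) ℂ}
    (hA : ∀ i, vproj α (i + 1) * A = A * vproj α i) : gradedPart A = A := by
  rw [gradedPart, Finset.sum_congr rfl fun i _ => by
    rw [hA, mul_assoc, vproj_mul_vproj, if_pos rfl], ← Finset.mul_sum, sum_vproj, mul_one]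

theorem vAt_zero_eq {q : FramedRep m α d} (hq : ∀ i, i ≠ 0 → q.vAt i = 0) : q.vAt 0 = q.v := by
  conv_rhs => rw [← Matrix.one_mul q.v, ← sum_vproj, Matrix.sum_mul]
  exact (Finset.sum_eq_single 0 (fun i _ hi => hq i hi) (by simp)).symm

theorem wAt_zero_eq {q : FramedRep m α d} (hq : ∀ i, i ≠ 0 → q.wAt i = 0) : q.wAt 0 = q.w := by
  conv_rhs => rw [← Matrix.mul_one q.w, ← sum_vproj, Matrix.mul_sum]
  exact (Finset.sum_eq_single 0 (fun i _ hi => hq i hi) (by simp)).symm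

/-- The velocity of `X` under a flow with number `m j` maps each `V_i` to `V_{i+1}`. -/
theorem vproj_mul_flowX (q : FramedRep m α d) {N : Matrix (VIdx α) (VIdx α) ℂ}
    (hN : ∀ i, Commute (vproj α i) N) (j : ℕ) (i : ZMod m) :
    vproj α (i + 1) * ∑ a ∈ Finset.range (m * j), q.Y ^ a * N * q.Y ^ (m * j - 1 - a) =
      (∑ a ∈ Finset.range (m * j), q.Y ^ a * N * q.Y ^ (m * j - 1 - a)) * vproj α i := by
  rw [Finset.mul_sum, Finset.sum_mul]
  refine Finset.sum_congr rfl fun a ha => ?_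
  rw [Finset.mem_range] at ha
  have h : i + 1 + (a : ZMod m) + ((m * j - 1 - a : ℕ) : ZMod m) = i := by
    have h1 : ((1 + a + (m * j - 1 - a) : ℕ) : ZMod m) = 0 := by
      rw [show 1 + a + (m * j - 1 - a) = m * j by omega]
      simp
    push_cast at h1
    linear_combination h1
  rw [← mul_assoc, ← mul_assoc, vproj_mul_pow_Y, mul_assoc (q.Y ^ a), (hN _).eq,
    ← mul_assoc (q.Y ^ a), mul_assoc _ (vproj α _), vproj_mul_pow_Y, h]
  simp only [mul_assoc]

theorem sum_diagUnit : ∑ β : Fin d, diagUnit β = 1 := by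
  ext a b
  rw [Matrix.sum_apply]
  simp [diagUnit, Matrix.single_apply, Matrix.one_apply, ite_and]

theorem diagUnit_mul_diagUnit (β γ : Fin d) :
    diagUnit β * diagUnit γ = if β = γ then diagUnit β else 0 := by
  by_cases h : β = γ
  · subst h; simp [diagUnit]
  · rw [if_neg h, diagUnit, diagUnit, Matrix.single_mul_single_of_ne _ _ _ _ h]

end FramedRep

open FramedRep

/-- The flows have a common solution through every point framed only at the vertex `0`. With the
exponentials `G_β`, `H_β = G_β⁻¹` of the combinations `∑ t_{mj,β} Y^{mj}`, it is given by
`w = ∑ E_β w₀ G_β`, `v = ∑ H_β v₀ E_β`, and `X = X₀ - ∑ C_β`, where `C_β` integrates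
`∑ Y^a (H_β v₀ E_β w₀ G_β) Y^{mj-1-a}`. -/
theorem exists_solvesFlows (q₀ : FramedRep m α d)
    (hq : ∀ i, i ≠ 0 → q₀.vAt i = 0 ∧ q₀.wAt i = 0) :
    ∃ q : SphericalTimes d → FramedRep m α d, q 0 = q₀ ∧ SolvesFlows q := by
  have hexp := fun β : Fin d => exists_matrix_flow_exponentials q₀.Y
    (q₀.v * diagUnit β * q₀.w) (fun a : ℕ × Fin d => m * a.1) (fun a => if a.2 = β then 1 else 0)
  choose G H C hG0 hH0 hC0 hcomm hder using hexp
  let q : SphericalTimes d → FramedRep m α d := fun t =>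
    { X := gradedPart (q₀.X - ∑ β, C β t)
      Y := q₀.Y
      v := ∑ β, H β t * (q₀.v * diagUnit β)
      w := ∑ β, diagUnit β * q₀.w * G β t
      X_graded := vproj_mul_gradedPart _
      Y_graded := q₀.Y_graded }
  have hpr : ∀ i (a : ℕ × Fin d), Commute (vproj α i) (q₀.Y ^ (m * a.1)) := fun i a => by
    rw [Commute, SemiconjBy, vproj_mul_pow_Y]
    simp
  have hGc : ∀ i β t, Commute (vproj α i) (G β t) := fun i β t => (hcomm β _ (hpr i) t).1
  have hHc : ∀ i β t, Commute (vproj α i) (H β t) := fun i β t => (hcomm β _ (hpr i) t).2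
  have hv0 : q₀.vAt 0 = q₀.v := vAt_zero_eq fun i hi => (hq i hi).1
  have hw0 : q₀.wAt 0 = q₀.w := wAt_zero_eq fun i hi => (hq i hi).2
  have hvAt : ∀ t i, (q t).vAt i = ∑ β, H β t * (q₀.vAt i * diagUnit β) := fun t i => by
    simp only [vAt, q, Matrix.mul_sum]
    refine Finset.sum_congr rfl fun β _ => ?_
    rw [← Matrix.mul_assoc, (hHc i β t).eq]
    simp only [Matrix.mul_assoc]
  have hwAt : ∀ t i, (q t).wAt i = ∑ β, diagUnit β * q₀.wAt i * G β t := fun t i => by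
    simp only [wAt, q, Matrix.sum_mul]
    refine Finset.sum_congr rfl fun β _ => ?_
    rw [Matrix.mul_assoc, ← (hGc i β t).eq]
    simp only [Matrix.mul_assoc]
  have hvw : ∀ t i, i ≠ 0 → (q t).vAt i = 0 ∧ (q t).wAt i = 0 := fun t i hi => by
    rw [hvAt, hwAt, (hq i hi).1, (hq i hi).2]
    simp
  have hvE : ∀ t β, (q t).vAt 0 * diagUnit β = H β t * (q₀.v * diagUnit β) := fun t β => by
    rw [hvAt, hv0, Matrix.sum_mul, Finset.sum_eq_single β]
    · simp only [Matrix.mul_assoc, diagUnit_mul_diagUnit, if_true]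
    · intro γ _ h
      simp only [Matrix.mul_assoc, diagUnit_mul_diagUnit, if_neg h, Matrix.mul_zero]
    · simp
  have hEw : ∀ t β, diagUnit β * (q t).wAt 0 = diagUnit β * q₀.w * G β t := fun t β => by
    rw [hwAt, hw0, Matrix.mul_sum, Finset.sum_eq_single β]
    · rw [← Matrix.mul_assoc, ← Matrix.mul_assoc, diagUnit_mul_diagUnit, if_pos rfl]
    · intro γ _ h
      rw [← Matrix.mul_assoc, ← Matrix.mul_assoc, diagUnit_mul_diagUnit, if_neg h.symm,
        Matrix.zero_mul, Matrix.zero_mul]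
    · simp
  refine ⟨q, ?_, fun t j β => ?_⟩
  · obtain ⟨X, Y, v, w, hX, hY⟩ := q₀
    simp only [q, hH0, hG0, hC0, Finset.sum_const_zero, sub_zero, gradedPart_eq_self hX,
      Matrix.one_mul, Matrix.mul_one, ← Matrix.mul_sum, ← Matrix.sum_mul, sum_diagUnit]
  · have hd := fun γ => hder γ t (j, β)
    refine flowAt_of_spherical (fun s => hvw _) ?_ (HasMatDerivAt.const _) ?_ ?_
    · have hN : ∀ i, Commute (vproj α i) (H β t * (q₀.v * diagUnit β * q₀.w) * G β t) := by
        intro i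
        refine ((hHc i β t).mul_right ?_).mul_right (hGc i β t)
        rw [Commute, SemiconjBy]
        by_cases hi : i = 0
        · subst hi
          have h1 := vproj_mul_vAt q₀
          have h2 := wAt_mul_vproj q₀
          rw [hv0] at h1
          rw [hw0] at h2
          rw [← Matrix.mul_assoc, ← Matrix.mul_assoc, h1, Matrix.mul_assoc _ q₀.w, h2]
        · have h1 : vproj α i * q₀.v = 0 := (hq i hi).1
          have h2 : q₀.w * vproj α i = 0 := (hq i hi).2
          rw [← Matrix.mul_assoc, ← Matrix.mul_assoc, h1, Matrix.mul_assoc _ q₀.w, h2]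
          simp
      have h1 : HasMatDerivAt (fun s => q₀.X - ∑ γ, C γ (t + Finsupp.single (j, β) s))
          (-∑ a ∈ Finset.range (m * j), q₀.Y ^ a *
            (H β t * (q₀.v * diagUnit β * q₀.w) * G β t) * q₀.Y ^ (m * j - 1 - a)) 0 := by
        have h := (HasMatDerivAt.const (t := 0) q₀.X).sub
          (HasMatDerivAt.sum (I := Finset.univ) fun γ _ => (hd γ).2.2)
        simpa only [ite_smul, one_smul, zero_smul, Finset.sum_ite_eq, Finset.mem_univ, if_true,
          zero_sub] using h
      have h2 := HasMatDerivAt.sum (I := Finset.univ) fun i _ =>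
        (h1.const_mul (vproj α (i + 1))).mul_const (vproj α i)
      -- The velocity of `X` is graded already, so that taking the graded part does not change it.
      have h3 := gradedPart_eq_self fun i =>
        show vproj α (i + 1) * (-∑ a ∈ Finset.range (m * j), q₀.Y ^ a *
            (H β t * (q₀.v * diagUnit β * q₀.w) * G β t) * q₀.Y ^ (m * j - 1 - a)) = _ by
          rw [mul_neg, vproj_mul_flowX q₀ hN, ← neg_mul]
      rw [gradedPart] at h3
      rw [h3] at h2
      refine h2.congr_deriv (congrArg _ (Finset.sum_congr rfl fun a _ => ?_))
      have hNt : (q t).vAt 0 * (diagUnit β * (q t).wAt 0) =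
          H β t * (q₀.v * diagUnit β * q₀.w) * G β t := by
        have h4 : (diagUnit β : Matrix (Fin d) (Fin d) ℂ) = diagUnit β * diagUnit β := by
          rw [diagUnit_mul_diagUnit, if_pos rfl]
        rw [h4, Matrix.mul_assoc, hEw, ← Matrix.mul_assoc, hvE]
        simp only [Matrix.mul_assoc]
      rw [Finsupp.single_zero, add_zero, ← hNt]
      simp only [Matrix.mul_assoc]
      rfl
    · simp only [hwAt, hw0]
      refine (HasMatDerivAt.sum (I := Finset.univ) fun γ _ =>
        (hd γ).1.const_mul (diagUnit γ * q₀.w)).congr_deriv ?_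
      rw [Finset.sum_eq_single β (fun γ _ h => by simp [h.symm]) (by simp), if_pos rfl, one_smul,
        Finsupp.single_zero, add_zero, ← hw0, ← hwAt, ← Matrix.mul_assoc (diagUnit β), hEw, hw0,
        Matrix.mul_assoc _ (G β t)]
    · simp only [hvAt, hv0]
      refine (HasMatDerivAt.sum (I := Finset.univ) fun γ _ =>
        (hd γ).2.1.mul_const (q₀.v * diagUnit γ)).congr_deriv ?_
      rw [Finset.sum_eq_single β (fun γ _ h => by simp [h.symm]) (by simp), if_pos rfl, one_smul,
        Finsupp.single_zero, add_zero, ← hv0, ← hvAt, hvE, hv0, Matrix.neg_mul, Matrix.mul_assoc]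

end SphericalFlows

section Conservation

variable {m : ℕ} [NeZero m] {α : ZMod m → ℕ} {d : ℕ}

open FramedRep

theorem hasMatDerivAt_shift {ι κ : Type*} {A : ℂ → Matrix ι κ ℂ} {A' : Matrix ι κ ℂ} {s : ℂ}
    (h : HasMatDerivAt (fun u => A (s + u)) A' 0) : HasMatDerivAt A A' s := fun a b => by
  have h1 := HasDerivAt.comp_add_const s (-s) (f := fun u => A (s + u) a b) (f' := A' a b)
    (by simpa using h a b)
  simpa using h1

/-- The flow equations hold at every point of a line in a coordinate direction, not only at its
origin. -/
theorem SolvesFlows.flowAt {q : SphericalTimes d → FramedRep m α d} (h : SolvesFlows q)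
    (t : SphericalTimes d) (j : ℕ) (β : Fin d) (s : ℂ) :
    FlowAt (m * j) β (fun s => q (t + Finsupp.single (j, β) s)) s := by
  obtain ⟨hX, hY, hw, hv⟩ := h (t + Finsupp.single (j, β) s) j β
  simp only [Finsupp.single_zero, add_zero, add_assoc, ← Finsupp.single_add] at hX hY hw hv
  exact ⟨hasMatDerivAt_shift hX, hasMatDerivAt_shift hY, fun i => hasMatDerivAt_shift (hw i),
    fun i => hasMatDerivAt_shift (hv i)⟩

/-- The commutator of `Y` with the velocity of `X` telescopes. -/
theorem mul_sum_pow_sub_sum_pow_mul {R : Type*} [Ring R] (Y N : R) (r : ℕ) :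
    Y * (∑ a ∈ Finset.range r, Y ^ a * N * Y ^ (r - 1 - a)) -
      (∑ a ∈ Finset.range r, Y ^ a * N * Y ^ (r - 1 - a)) * Y = Y ^ r * N - N * Y ^ r := by
  rw [Finset.mul_sum, Finset.sum_mul, ← Finset.sum_sub_distrib]
  have h : ∀ a ∈ Finset.range r, Y * (Y ^ a * N * Y ^ (r - 1 - a)) -
      Y ^ a * N * Y ^ (r - 1 - a) * Y =
        Y ^ (a + 1) * N * Y ^ (r - (a + 1)) - Y ^ a * N * Y ^ (r - a) := fun a ha => by
    rw [Finset.mem_range] at ha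
    rw [show r - a = r - 1 - a + 1 by omega, pow_succ Y (r - 1 - a), pow_succ' Y a,
      Nat.sub_sub r 1 a, add_comm 1 a]
    simp only [mul_assoc]
  rw [Finset.sum_congr rfl h, Finset.sum_range_sub (fun a => Y ^ a * N * Y ^ (r - a))]
  simp

/-- The relations defining the spherical Calogero–Moser space are preserved by the flows: `Y` is
constant, so that the components of `v` and `w` at the vertices `i ≠ 0` satisfy linear equations
with constant coefficients, and the moment map is constant. -/
theorem mem_sphericalCM_of_flowAt {lam : ZMod m → ℂ} {j : ℕ} {β : Fin d} {q : ℂ → FramedRep m α d}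
    (h : ∀ s, FlowAt (m * j) β q s) (h0 : q 0 ∈ sphericalCM lam) (s : ℂ) :
    q s ∈ sphericalCM lam := by
  obtain ⟨hmom, hvw⟩ := h0
  have hr : ((m * j : ℕ) : ZMod m) = 0 := by simp
  have hY : ∀ s, (q s).Y = (q 0).Y := HasMatDerivAt.eq_const fun s => (h s).2.1
  have hv : ∀ s i, i ≠ 0 → (q s).vAt i = 0 := fun s i hi =>
    HasMatDerivAt.eq_zero_of_linear (A := fun s => (q s).vAt i) (P := -(q 0).Y ^ (m * j))
      (Q := diagUnit β) (fun s => ((h s).2.2.2 i).congr_deriv (by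
        rw [hr, add_zero, hY s, Matrix.neg_mul, Matrix.neg_mul])) (hvw i hi).1 s
  have hw : ∀ s i, i ≠ 0 → (q s).wAt i = 0 := fun s i hi =>
    HasMatDerivAt.eq_zero_of_linear (A := fun s => (q s).wAt i) (P := diagUnit β)
      (Q := (q 0).Y ^ (m * j)) (fun s => ((h s).2.2.1 i).congr_deriv (by
        rw [hr, sub_zero, hY s])) (hvw i hi).2 s
  -- Only the vertex `0` is framed, so that this is the moment map.
  have hK : ∀ s, HasMatDerivAt (fun s => (q s).Y * (q s).X - (q s).X * (q s).Y -
      (q s).vAt 0 * (q s).wAt 0) 0 s := fun s => by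
    obtain ⟨h1, h2, h3, h4⟩ := (h s).spherical (hv s)
    refine (((h2.mul h1).sub (h1.mul h2)).sub (h4.mul h3)).congr_deriv ?_
    have h5 := mul_sum_pow_sub_sum_pow_mul (q s).Y
      ((q s).vAt 0 * (diagUnit β * (q s).wAt 0)) (m * j)
    simp only [Matrix.mul_assoc] at h5
    rw [Matrix.zero_mul, Matrix.mul_zero, zero_add, add_zero, Matrix.mul_neg, Matrix.neg_mul,
      Matrix.neg_mul]
    simp only [Matrix.mul_assoc]
    rw [← neg_sub', h5]
    abel
  refine ⟨?_, fun i hi => ⟨hv s i hi, hw s i hi⟩⟩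
  have h1 := HasMatDerivAt.eq_const hK s
  rw [sum_vAt_mul_wAt fun i hi => (hvw i hi).1] at hmom
  rw [sum_vAt_mul_wAt (hv s), h1, hmom]

theorem SolvesFlows.mem_sphericalCM {lam : ZMod m → ℂ} {q : SphericalTimes d → FramedRep m α d}
    (h : SolvesFlows q) (h0 : q 0 ∈ sphericalCM lam) (t : SphericalTimes d) :
    q t ∈ sphericalCM lam := by
  induction t using Finsupp.induction with
  | zero => exact h0
  | single_add a c t _ _ ih =>
    obtain ⟨j, β⟩ := a
    rw [add_comm]
    exact mem_sphericalCM_of_flowAt (q := fun s => q (t + Finsupp.single (j, β) s))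
      (h.flowAt t j β) (by simpa using ih) c

end Conservation

end

theorem mainTheorem3 (m : ℕ) [NeZero m] (τ : ℂ) (hτ : τ ≠ 0) (k : ZMod m → ℂ)
    (α : ZMod m → ℕ) (d : ℕ) :
    (∀ q ∈ FramedRep.sphericalCM (α := α) (d := d) (dunklLambda τ k),
      IsUnit (hatX τ k q) ∧ IsUnit (hatY τ k q) ∧ IsUnit (dressM τ k q) ∧
      IsSphericalLaxTuple (laxL τ k q) (laxR τ k q)) ∧
    (∀ (j : ℕ) (β : Fin d) (U : Set ℂ) (q : ℂ → FramedRep m α d), IsOpen U →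
      (∀ t ∈ U, q t ∈ FramedRep.sphericalCM (dunklLambda τ k)) →
      (∀ t ∈ U, FramedRep.FlowAt (m * j) β q t) →
      ∀ t ∈ U, LaxEqAt (m * j) β (fun s => laxL τ k (q s)) (fun s => laxR τ k (q s)) t) ∧
    (∀ q₀ ∈ FramedRep.sphericalCM (α := α) (d := d) (dunklLambda τ k),
      (∃ q : SphericalTimes d → FramedRep m α d, q 0 = q₀ ∧ SolvesFlows q) ∧
      ∀ q : SphericalTimes d → FramedRep m α d, q 0 = q₀ → SolvesFlows q →
        (∀ t, q t ∈ FramedRep.sphericalCM (dunklLambda τ k)) ∧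
        SolvesSphericalHierarchy (fun t => laxL τ k (q t)) (fun t => laxR τ k (q t))) := by
  refine ⟨fun q hq => ⟨isUnit_hatX q, isUnit_hatY q,
      ⟨⟨_, _, dressM_mul_inv hq, inv_mul_dressM hq⟩, rfl⟩, isSphericalLaxTuple hq⟩,
    fun j β U q hU hq hflow t ht => laxEqAt_of_flowAt
      (Filter.mem_of_superset (hU.mem_nhds ht) hq) (hflow t ht),
    fun q₀ hq₀ => ⟨exists_solvesFlows q₀ hq₀.2, fun q h0 hq => ?_⟩⟩
  have hmem := hq.mem_sphericalCM (h0 ▸ hq₀)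
  exact ⟨hmem, fun t => isSphericalLaxTuple (hmem t), fun t j β =>
    laxEqAt_of_flowAt (Filter.Eventually.of_forall fun s => hmem _) (hq t j β)⟩
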